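/- **Setting.** Let $\mathcal A$ be a compact metrizable action space and $\mathcal Z$ a measurable space of contexts. For $z\in\mathcal Z$ let $\mathcal A(z)\subset\mathcal A$ be a nonempty compact set of available actions (depending measurably on $z$), and for $a\in\mathcal A$ let $\phi_a^z\in\mathbb R^d$ and $M_a^z\in\mathbb R^{m\times d}$ be reward features and feedback matrices, continuous in $a$ and measurable in $z$, such that $\|M_a^z\|_2\le L$ and $\|\phi_a^z-\phi_b^z\|_2\le 1$ for $a,b\in\mathcal A(z)$. The unknown parameter is $\theta^*\in\mathbb R^d$ with $\|\theta^*-\theta_0\|_2\le B$ for a known $\theta_0$ (for instance $\theta_0=0$). In round $t=1,\dots,n$ a context $z_t$ is revealed, the learner plays $a_t\in\mathcal A(z_t)$ and observes $y_t=M_{a_t}^{z_t}\theta^*+\epsilon_t$. Let $(\mathcal F_t)$ be a filtration to which $(a_t,y_t)$ is adapted and for which $(z_t)$ is predictable ($z_t$ is $\mathcal F_{t-1}$-measurable; otherwise arbitrary), and let the noise be conditionally $\rho$-sub-Gaussian with $\rho>0$: $\mathbb E[e^{\langle u,\epsilon_t\rangle}\mid\mathcal F_{t-1},a_t]\le e^{\rho^2\|u\|^2/2}$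 for all $u\in\mathbb R^m$. Put $\Delta(a,z|\theta)=\max_{b\in\mathcal A(z)}\langle\phi_b^z-\phi_a^z,\theta\rangle$; the contextual regret is $\mathfrak R_n=\mathbb E\sum_{t=1}^n\Delta(a_t,z_t|\theta^*)$. **Conditional IDS.** Fix $\lambda>0$. Let $V_t=\lambda I_d+\sum_{s<t}(M_{a_s}^{z_s})^\top M_{a_s}^{z_s}$, $\hat\theta_t=V_t^{-1}\bigl(\lambda\theta_0+\sum_{s<t}(M_{a_s}^{z_s})^\top y_s\bigr)$ (the regularized least squares estimate), $\beta_t^{1/2}=\rho\sqrt{2\log t^2+\log\det V_t-\log\det(\lambda I_d)}+\sqrt\lambda B$, and $\mathcal E_t=\{\theta\in\mathbb R^d:\|\theta-\hat\theta_t\|_{V_t}^2\le\beta_t\}$. Let $\hat\Delta_t(a,z)=\max_{b\in\mathcal A(z)}\max_{\theta\in\mathcal E_t}\langle\phi_b^z-\phi_a^z,\theta\rangle$ and $I_t(a,z)=\frac12\log\det(I_m+M_a^zV_t^{-1}(M_a^z)^\top)$. Given $\mathcal F_{t-1}$ (hence $z_t$), conditional IDS samples $a_t$ from an $\mathcal F_{t-1}$-measurable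 minimizer $\mu_t$ of the information ratio $\bigl(\int\hat\Delta_t(a,z_t)\,\mu(da)\bigr)^2\big/\int I_t(a,z_t)\,\mu(da)$ over all probability measures $\mu$ on $\mathcal A(z_t)$. Let $\gamma_n=\sum_{t=1}^nI_t(a_t,z_t)$. **Alignment constants.** Let $\mathcal P(z)$ be the set of $a\in\mathcal A(z)$ that for some $\theta\in\mathbb R^d$ maximize $\langle\phi_a^z,\theta\rangle$ over $\mathcal A(z)$, uniquely up to actions with the same reward feature. For $\mathcal E\subset\mathbb R^d$ let $\mathcal P(\mathcal E,z)$ be the set of $a\in\mathcal P(z)$ that are optimal in $\mathcal A(z)$ for some $\theta\in\mathcal E$, and for $\eta>0$ let $\bar{\mathcal P}_\eta(\mathcal E,z)=\{a\in\mathcal A(z):\sup_{\theta\in\mathcal E}\Delta(a,z|\theta)\le\eta\sup_{b\in\mathcal P(\mathcal E,z)}\sup_{\theta\in\mathcal E}\Delta(b,z|\theta)\}$. Define $$\alpha(z)=\sup_{\omega\in\mathbb R^d}\sup_{a,b\in\mathcal P(z)}\inf_{c\in\mathcal A(z)}\frac{\langle\phi_a^z-\phi_b^z,\omega\rangle^2}{\|M_c^z\omega\|^2},\qquad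 \alpha_\eta(\mathcal E,z)=\sup_{\omega\in\mathbb R^d}\sup_{a,b\in\mathcal P(\mathcal E,z)}\inf_{c\in\bar{\mathcal P}_\eta(\mathcal E,z)}\frac{\langle\phi_a^z-\phi_b^z,\omega\rangle^2}{\|M_c^z\omega\|^2},$$ and $\alpha(\mathcal E,z)=\inf_{\eta>0}\eta^2\alpha_\eta(\mathcal E,z)$, all in $[0,\infty]$. In all ratios, $0/0=0$ and $x/0=\infty$ for $x>0$; moreover $0\cdot\infty=0$. **Claim.** There is a constant $C<\infty$ depending only on $d,m,\lambda,L,\rho,B,\theta_0$ such that for every such game, $\theta^*$, environment, horizon $n\ge1$ and predictable context sequence: 1. (local) if $\alpha(\mathcal E_t,z_t)<\infty$ almost surely for all $t\le n$, then with $\bar\alpha_n=\frac1n\sum_{t=1}^n\alpha(\mathcal E_t,z_t)$, $$\mathfrak R_n\le\sqrt{8\,\mathbb E[\bar\alpha_n\beta_n]\,\mathbb E[\gamma_n]\,n}+C;$$ 2. (global) if $\alpha(z_t)<\infty$ almost surely for all $t\le n$, then with $\bar\alpha_n=\frac1n\sum_{t=1}^n\alpha(z_t)$, $$\mathfrak R_n\le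 C\,n^{2/3}\bigl(\mathbb E[\bar\alpha_n\beta_n]\,\mathbb E[\gamma_n]\bigr)^{1/3}.$$ -/

import Mathlib

open MeasureTheory ProbabilityTheory Matrix
open scoped ENNReal NNReal

noncomputable section

namespace ContextualPM

/-- The Euclidean space of dimension `k`. -/
abbrev Vec (k : ℕ) : Type := EuclideanSpace ℝ (Fin k)

/-- The linear map between Euclidean spaces given by a matrix. -/
abbrev act {k l : ℕ} (T : Matrix (Fin k) (Fin l) ℝ) : Vec l →ₗ[ℝ] Vec k :=
  Matrix.toEuclideanLin T

/-- A contextual linear partial monitoring game with parameter set `ℝ^d` and observations in `ℝ^m`: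
reward features `φ z a`, feedback matrices `M z a` and nonempty compact sets `avail z` of available
actions.  Features and feedback matrices are continuous in the action and measurable in the
context, and `avail` is a measurable correspondence. -/
structure Game (A Z : Type*) [TopologicalSpace A] [MeasurableSpace Z] (d m : ℕ) where
  φ : Z → A → Vec d
  M : Z → A → Matrix (Fin m) (Fin d) ℝ
  avail : Z → Set A
  avail_nonempty : ∀ z, (avail z).Nonempty
  avail_compact : ∀ z, IsCompact (avail z)
  avail_measurable : ∀ U : Set A, IsOpen U → MeasurableSet {z | (avail z ∩ U).Nonempty}
  φ_continuous : ∀ z, Continuous (φ z)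
  φ_measurable : ∀ a, Measurable (fun z => φ z a)
  M_continuous : ∀ z, Continuous (M z)
  M_measurable : ∀ a i j, Measurable (fun z => M z a i j)

namespace Game

variable {A Z : Type*} [TopologicalSpace A] [MeasurableSpace Z] {d m : ℕ}

/-- In every context the available reward features have diameter at most `1`
and the available feedback matrices have spectral norm at most `L`. -/
def Bounded (G : Game A Z d m) (L : ℝ) : Prop :=
  ∀ z, ∀ a ∈ G.avail z,
    (∀ b ∈ G.avail z, ‖G.φ z a - G.φ z b‖ ≤ 1) ∧ ∀ v : Vec d, ‖act (G.M z a) v‖ ≤ L * ‖v‖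

/-! ### Optimality, Pareto optimal actions and alignment constants -/

/-- Action `a` is optimal in context `z` for the parameter `θ`. -/
def IsOptimal (G : Game A Z d m) (z : Z) (θ : Vec d) (a : A) : Prop :=
  a ∈ G.avail z ∧ ∀ b ∈ G.avail z, inner ℝ (G.φ z b) θ ≤ inner ℝ (G.φ z a) θ

/-- The gap `Δ(a, z | θ) = max_{b ∈ A(z)} ⟨φ_b - φ_a, θ⟩`. -/
def gap (G : Game A Z d m) (a : A) (z : Z) (θ : Vec d) : ℝ :=
  ⨆ b : G.avail z, inner ℝ (G.φ z b - G.φ z a) θ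

/-- Pareto optimal actions for the context `z`: for some parameter, the action is optimal, and
uniquely so up to duplicates, that is, up to actions with the same reward feature. -/
def pareto (G : Game A Z d m) (z : Z) : Set A :=
  {a | ∃ θ : Vec d, G.IsOptimal z θ a ∧ ∀ b, G.IsOptimal z θ b → G.φ z b = G.φ z a}

/-- Pareto optimal actions that are optimal for some parameter in `E`. -/
def plausible (G : Game A Z d m) (E : Set (Vec d)) (z : Z) : Set A :=
  {a | a ∈ G.pareto z ∧ ∃ θ ∈ E, G.IsOptimal z θ a}

/-- The extended plausible set: available actions whose largest gap over `E` is at most `η` times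
the largest gap over `E` of a plausible Pareto optimal action. -/
def extPlausible (G : Game A Z d m) (η : ℝ) (E : Set (Vec d)) (z : Z) : Set A :=
  {a | a ∈ G.avail z ∧
    (⨆ θ : E, G.gap a z θ) ≤ η * ⨆ b : G.plausible E z, ⨆ θ : E, G.gap b z θ}

/-- `⟨φ_a - φ_b, ω⟩² / ‖M_c ω‖²` in `[0, ∞]`, with `0 / 0 = 0` and `x / 0 = ∞` for `x > 0`. -/
def costToSignal (G : Game A Z d m) (z : Z) (a b c : A) (ω : Vec d) : ℝ≥0∞ :=
  ENNReal.ofReal (inner ℝ (G.φ z a - G.φ z b) ω ^ 2) / ENNReal.ofReal (‖act (G.M z c) ω‖ ^ 2)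

/-- The conditional global alignment constant `α(z)`. -/
def globalAlignment (G : Game A Z d m) (z : Z) : ℝ≥0∞ :=
  ⨆ ω : Vec d, ⨆ a ∈ G.pareto z, ⨆ b ∈ G.pareto z, ⨅ c ∈ G.avail z, G.costToSignal z a b c ω

/-- The conditional local alignment constant `α_η(E, z)`. -/
def localAlignmentAt (G : Game A Z d m) (η : ℝ) (E : Set (Vec d)) (z : Z) : ℝ≥0∞ :=
  ⨆ ω : Vec d, ⨆ a ∈ G.plausible E z, ⨆ b ∈ G.plausible E z,
    ⨅ c ∈ G.extPlausible η E z, G.costToSignal z a b c ω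

/-- The conditional local alignment constant `α(E, z) = inf_{η > 0} η² α_η(E, z)`. -/
def localAlignment (G : Game A Z d m) (E : Set (Vec d)) (z : Z) : ℝ≥0∞ :=
  ⨅ η : ℝ, ⨅ _ : 0 < η, ENNReal.ofReal (η ^ 2) * G.localAlignmentAt η E z

/-! ### Estimation from a history

Rounds are numbered from `1`; the quantities of round `t` depend on the contexts `z s`, actions
`a s` and observations `y s` of the rounds `1 ≤ s < t` only. -/

/-- `V_t = λ I + ∑_{s < t} M_sᵀ M_s`. -/
def covMat (G : Game A Z d m) (lam : ℝ) (z : ℕ → Z) (a : ℕ → A) (t : ℕ) :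
    Matrix (Fin d) (Fin d) ℝ :=
  lam • (1 : Matrix (Fin d) (Fin d) ℝ)
    + ∑ s ∈ Finset.Ico 1 t, (G.M (z s) (a s))ᵀ * G.M (z s) (a s)

/-- The regularised least squares estimate
`V_t⁻¹ (λ θ₀ + ∑_{s < t} M_sᵀ y_s) = argmin_θ ∑_{s < t} ‖M_s θ - y_s‖² + λ ‖θ - θ₀‖²`. -/
def lsEstimate (G : Game A Z d m) (lam : ℝ) (θ₀ : Vec d) (z : ℕ → Z) (a : ℕ → A)
    (y : ℕ → Vec m) (t : ℕ) : Vec d :=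
  act (G.covMat lam z a t)⁻¹
    (lam • θ₀ + ∑ s ∈ Finset.Ico 1 t, act (G.M (z s) (a s))ᵀ (y s))

/-- The confidence coefficient `β_t = β_{t, 1/t²}`, where
`β_{t, δ}^{1/2} = ρ √(2 log (1/δ) + log det V_t - log det (λ I)) + √λ B`. -/
def confCoef (G : Game A Z d m) (lam ρ B : ℝ) (z : ℕ → Z) (a : ℕ → A) (t : ℕ) : ℝ :=
  (ρ * √(2 * Real.log ((t : ℝ) ^ 2) + Real.log (G.covMat lam z a t).det
      - Real.log (lam • (1 : Matrix (Fin d) (Fin d) ℝ)).det) + √lam * B) ^ 2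

/-- The confidence set `E_t = {θ : ‖θ - θ̂_t‖²_{V_t} ≤ β_t}`. -/
def confSet (G : Game A Z d m) (lam ρ B : ℝ) (θ₀ : Vec d) (z : ℕ → Z) (a : ℕ → A)
    (y : ℕ → Vec m) (t : ℕ) : Set (Vec d) :=
  {θ | inner ℝ (θ - G.lsEstimate lam θ₀ z a y t)
      (act (G.covMat lam z a t) (θ - G.lsEstimate lam θ₀ z a y t)) ≤ G.confCoef lam ρ B z a t}

/-- The conditional gap estimate of action `a` in context `z` for a confidence set `E`:
`max_{b ∈ A(z)} max_{θ ∈ E} ⟨φ_b - φ_a, θ⟩`. -/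
def gapEstimate (G : Game A Z d m) (E : Set (Vec d)) (a : A) (z : Z) : ℝ :=
  ⨆ b : G.avail z, ⨆ θ : E, inner ℝ (G.φ z b - G.φ z a) (θ : Vec d)

/-- The information gain `½ log det (I + M V⁻¹ Mᵀ)` of action `a` in context `z`. -/
def infoGain (G : Game A Z d m) (V : Matrix (Fin d) (Fin d) ℝ) (a : A) (z : Z) : ℝ :=
  (1 / 2) * Real.log (1 + G.M z a * V⁻¹ * (G.M z a)ᵀ).det

/-! ### Conditional information-directed sampling -/

section IDS

variable [MeasurableSpace A]

/-- The information ratio of a sampling distribution in context `z`, in `[0, ∞]`, with `0 / 0 = 0`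
and `x / 0 = ∞` for `x > 0`. -/
def infoRatio (G : Game A Z d m) (E : Set (Vec d)) (V : Matrix (Fin d) (Fin d) ℝ) (z : Z)
    (μ : Measure A) : ℝ≥0∞ :=
  ENNReal.ofReal (∫ b, G.gapEstimate E b z ∂μ) ^ 2 / ENNReal.ofReal (∫ b, G.infoGain V b z ∂μ)

/-- `μ` minimises the information ratio among all probability measures on the available actions. -/
def IsIDS (G : Game A Z d m) (E : Set (Vec d)) (V : Matrix (Fin d) (Fin d) ℝ) (z : Z)
    (μ : Measure A) : Prop :=
  IsProbabilityMeasure μ ∧ μ (G.avail z)ᶜ = 0 ∧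
    ∀ ν : Measure A, IsProbabilityMeasure ν → ν (G.avail z)ᶜ = 0 →
      G.infoRatio E V z μ ≤ G.infoRatio E V z ν

/-- The interaction of conditional IDS with an environment over `n` rounds.  `F t` is the
information available after round `t`, and `θs` is the true parameter. -/
structure IsConditionalIDS (G : Game A Z d m) (lam ρ B : ℝ) (θ₀ θs : Vec d)
    {Ω : Type*} [mΩ : MeasurableSpace Ω] (P : Measure Ω) (F : Filtration ℕ mΩ) (n : ℕ)
    (z : ℕ → Ω → Z) (μ : ℕ → Ω → Measure A) (a : ℕ → Ω → A) (y ε : ℕ → Ω → Vec m) : Prop where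
  /-- The contexts are predictable. -/
  context_predictable : ∀ t ∈ Finset.Icc 1 n, Measurable[F (t - 1)] (z t)
  /-- The sampling distributions are predictable. -/
  policy_predictable : ∀ t ∈ Finset.Icc 1 n, Measurable[F (t - 1)] (μ t)
  /-- The sampling distribution of round `t` minimises the information ratio given the observed
  context and the history. -/
  policy_ids : ∀ t ∈ Finset.Icc 1 n, ∀ᵐ ω ∂P,
    G.IsIDS (G.confSet lam ρ B θ₀ (fun s => z s ω) (fun s => a s ω) (fun s => y s ω) t)
      (G.covMat lam (fun s => z s ω) (fun s => a s ω) t) (z t ω) (μ t ω)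
  action_adapted : ∀ t ∈ Finset.Icc 1 n, Measurable[F t] (a t)
  /-- The action is sampled from `μ t`, given the past. -/
  action_law : ∀ t ∈ Finset.Icc 1 n, ∀ S : Set A, MeasurableSet S →
    P[(a t ⁻¹' S).indicator (fun _ => (1 : ℝ)) | F (t - 1)] =ᵐ[P] fun ω => (μ t ω).real S
  observation_adapted : ∀ t ∈ Finset.Icc 1 n, Measurable[F t] (y t)
  /-- The observation is `y_t = M θ + ε_t`. -/
  observation_eq : ∀ t ∈ Finset.Icc 1 n, ∀ ω, y t ω = act (G.M (z t ω) (a t ω)) θs + ε t ω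
  /-- Given the past and the current action, the noise is `ρ`-sub-Gaussian. -/
  noise_integrable : ∀ t ∈ Finset.Icc 1 n, ∀ u : Vec m,
    Integrable (fun ω => Real.exp (inner ℝ u (ε t ω))) P
  noise_subgaussian : ∀ t ∈ Finset.Icc 1 n, ∀ u : Vec m,
    P[fun ω => Real.exp (inner ℝ u (ε t ω)) |
        (F (t - 1) : MeasurableSpace Ω) ⊔ MeasurableSpace.comap (a t) inferInstance]
      ≤ᵐ[P] fun _ => Real.exp (‖u‖ ^ 2 * ρ ^ 2 / 2)

end IDS

/-! ### Regret and the quantities in the bounds -/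

section Bounds

variable {Ω : Type*} [MeasurableSpace Ω]

/-- The expected contextual regret `E[∑_{t ≤ n} ⟨φ_{a*(z_t)} - φ_{a_t}, θ⟩]`, in `[0, ∞]`;
the summands are nonnegative when the actions are available. -/
def regret (G : Game A Z d m) (θs : Vec d) (P : Measure Ω) (n : ℕ)
    (z : ℕ → Ω → Z) (a : ℕ → Ω → A) : ℝ≥0∞ :=
  ∫⁻ ω, ∑ t ∈ Finset.Icc 1 n, ENNReal.ofReal (G.gap (a t ω) (z t ω) θs) ∂P

/-- The expected total information gain `E[γ_n]`, where `γ_n = ∑_{t ≤ n} I_t(a_t, z_t)`. -/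
def expTotalInfo (G : Game A Z d m) (lam : ℝ) (P : Measure Ω) (n : ℕ)
    (z : ℕ → Ω → Z) (a : ℕ → Ω → A) : ℝ≥0∞ :=
  ∫⁻ ω, ENNReal.ofReal (∑ t ∈ Finset.Icc 1 n,
    G.infoGain (G.covMat lam (fun s => z s ω) (fun s => a s ω) t) (a t ω) (z t ω)) ∂P

/-- `E[ᾱ_n β_n]`, where `ᾱ_n = n⁻¹ ∑_{t ≤ n} α t` for alignment constants `α t` and `β_n` is
the confidence coefficient of round `n`. -/
def expAlignConf (G : Game A Z d m) (lam ρ B : ℝ) (P : Measure Ω) (n : ℕ)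
    (z : ℕ → Ω → Z) (a : ℕ → Ω → A) (α : ℕ → Ω → ℝ≥0∞) : ℝ≥0∞ :=
  ∫⁻ ω, ((∑ t ∈ Finset.Icc 1 n, α t ω) / n)
    * ENNReal.ofReal (G.confCoef lam ρ B (fun s => z s ω) (fun s => a s ω) n) ∂P

/-- The local alignment constant `α(E_t, z_t)` realised in round `t`. -/
def realizedLocalAlignment (G : Game A Z d m) (lam ρ B : ℝ) (θ₀ : Vec d)
    (z : ℕ → Ω → Z) (a : ℕ → Ω → A) (y : ℕ → Ω → Vec m) (t : ℕ) (ω : Ω) : ℝ≥0∞ :=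
  G.localAlignment
    (G.confSet lam ρ B θ₀ (fun s => z s ω) (fun s => a s ω) (fun s => y s ω) t) (z t ω)

/-- The global alignment constant `α(z_t)` of the context of round `t`. -/
def realizedGlobalAlignment (G : Game A Z d m) (z : ℕ → Ω → Z) (t : ℕ) (ω : Ω) : ℝ≥0∞ :=
  G.globalAlignment (z t ω)

end Bounds

end Game

end ContextualPM

end

open ContextualPM

namespace ContextualPM

/-! ### Linear algebra -/

section LinearAlgebra

variable {d m k : ℕ}

/-! Since `μ t` is the conditional law of the action, the regret equals the sum over t of E ∫ Δ(b,
z_t | θ*) μ_t(db) (`regret_eq`). It remains to bound one round when the noise is small, and to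
control the exceptional events.

Confidence. Averaging the exponential process of the noise over a Gaussian direction (method of
mixtures) gives E exp(‖S_t‖² / (2ρ²) - `logVol` / 2) ≤ 1, where S_t is the accumulated noise and the
norm is the one of V_t⁻¹ (`lintegral_mixture_le`). The exceptional event `noiseFailure` is cut at 3
log t, whereas β_t contains 2 log t² = 4 log t. Its probability t^(-3/2) is still summable, and off
it θ* lies in E_t at a distance from the boundary of order √(log t), a fixed fraction of the radius
(`exists_margin`). Both parts live on this slack.

Minimisers. Write Δ and I for the means of the gap estimate and of the information gain under μ.
Comparing μ with the mixtures (1-p)μ + pδ_a, at p = 1 and to first order at p = 0, yields Δ² I(a) ≤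
D(a)² I and Δ (I(a) + I) ≤ 2 I D(a), where D(a) is the gap estimate of a (`ratio_minimizer`). It
remains to exhibit one action that is informative and not too bad.

Local case. Two plausible actions whose estimated gap is nearly maximal are optimal for two
parameters of E_t, whose difference has V_t-norm at most 2 β_t^{1/2}. The alignment constant then
provides an informative action with controlled D. Since I(a) is about half the trace of M V⁻¹ Mᵀ
only when that trace is small, the outcome is Δ² ≤ 8 α β I (1 + K I) rather than 8 α β I
(`IsIDS.local_bound`). The excess K ∑ I² is bounded by a constant (`sum_infoGain_sq_le`), but under
the square root a constant added to γ_n would not give an additive constant regret. It is therefore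
repaid by savings: as long as `logVol` ≤ ℓ the matrix V_t is bounded while the confidence radius
grows, so the gap estimate exceeds the true gap by a factor κ (`mul_gap_le_gapEstimate`), and such
rounds need only half of their information. If the volume ever passes ℓ, the total saved is at least
ℓ/4, which covers the excess (`sum_infoBudget_le`). A fixed number t₀ of initial rounds and the
exceptional events go into C.

Global case. Let Γ be the gap estimate of an action that is greedy for the centre of E_t. It comes
from the uncertainty term alone, so alignment gives an action a with I(a) of order Γ²/(αβ). The
slack gives D(a) ≤ Q (Γ + R), with R bounding the true gaps and no growth in t
(`gapEstimate_le_of_greedy`), and first order optimality turns this into min(Δ, R)³ ≤ C α β I. The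
bound has no additive constant, so the exceptional events too must be paid by information: their
probability is also at most 2 t^(-3/2) E[γ_n] (`measure_noiseFailure_le_mul_info`), and the gap
itself is bounded through α (`gap_sq_le_globalAlignment`).

Hölder's inequality over rounds and outcomes, with exponents 1/2 or 1/3, sums up the rounds. -/

theorem act_mul (S : Matrix (Fin k) (Fin m) ℝ) (T : Matrix (Fin m) (Fin d) ℝ) (v : Vec d) :
    act (S * T) v = act S (act T v) := by
  simp [act, Matrix.toLpLin_apply, Matrix.mulVec_mulVec]

theorem act_one (v : Vec d) : act (1 : Matrix (Fin d) (Fin d) ℝ) v = v := by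
  simp [act]

theorem inner_act (T : Matrix (Fin m) (Fin d) ℝ) (u : Vec m) (v : Vec d) :
    inner ℝ u (act T v) = inner ℝ (act Tᵀ u) v := by
  simp only [act, Matrix.toLpLin_apply, EuclideanSpace.inner_eq_star_dotProduct,
    star_trivial]
  rw [dotProduct_comm, Matrix.dotProduct_mulVec, Matrix.mulVec_transpose, dotProduct_comm]

theorem act_inv_act {V : Matrix (Fin d) (Fin d) ℝ} (hV : IsUnit V.det) (v : Vec d) :
    act V⁻¹ (act V v) = v := by
  rw [← act_mul, Matrix.nonsing_inv_mul _ hV, act_one]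

theorem act_act_inv {V : Matrix (Fin d) (Fin d) ℝ} (hV : IsUnit V.det) (v : Vec d) :
    act V (act V⁻¹ v) = v := by
  rw [← act_mul, Matrix.mul_nonsing_inv _ hV, act_one]

/-- The quadratic form `⟨v, W v⟩`. -/
noncomputable def quad (W : Matrix (Fin d) (Fin d) ℝ) (v : Vec d) : ℝ := inner ℝ v (act W v)

/-- The dual norm `√⟨v, V⁻¹ v⟩`. -/
noncomputable def dualNorm (V : Matrix (Fin d) (Fin d) ℝ) (v : Vec d) : ℝ := √(quad V⁻¹ v)

theorem quad_transpose_mul (M : Matrix (Fin m) (Fin d) ℝ) (v : Vec d) :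
    quad (Mᵀ * M) v = ‖act M v‖ ^ 2 := by
  rw [quad, act_mul, inner_act, Matrix.transpose_transpose, real_inner_self_eq_norm_sq]

theorem quad_add (U W : Matrix (Fin d) (Fin d) ℝ) (v : Vec d) :
    quad (U + W) v = quad U v + quad W v := by
  simp [quad, act, inner_add_right]

theorem quad_smul_one (c : ℝ) (v : Vec d) :
    quad (c • (1 : Matrix (Fin d) (Fin d) ℝ)) v = c * ‖v‖ ^ 2 := by
  have : act (c • (1 : Matrix (Fin d) (Fin d) ℝ)) v = c • v := by
    simp [act]
  rw [quad, this, inner_smul_right, real_inner_self_eq_norm_sq]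

/-- With V = Rᵀ R the norm of V is v ↦ ‖R v‖ and its dual is v ↦ ‖R⁻ᵀ v‖, so the norm inequalities
below reduce to Euclidean ones. -/
theorem posDef_factor {V : Matrix (Fin d) (Fin d) ℝ} (hV : V.PosDef) :
    ∃ R : Matrix (Fin d) (Fin d) ℝ, IsUnit R.det ∧ V = Rᵀ * R := by
  open scoped MatrixOrder Matrix.Norms.L2Operator in
  obtain ⟨R, hR, h⟩ := CStarAlgebra.isStrictlyPositive_iff_eq_star_mul_self.mp
    hV.isStrictlyPositive
  refine ⟨R, (Matrix.isUnit_iff_isUnit_det R).1 hR, ?_⟩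
  rw [h, Matrix.star_eq_conjTranspose, Matrix.conjTranspose_eq_transpose_of_trivial]

theorem posDef_isUnit_det {V : Matrix (Fin d) (Fin d) ℝ} (hV : V.PosDef) : IsUnit V.det :=
  (Matrix.isUnit_iff_isUnit_det V).1 hV.isUnit

theorem quad_inv_factor {R : Matrix (Fin d) (Fin d) ℝ} (v : Vec d) :
    quad (Rᵀ * R)⁻¹ v = ‖act (R⁻¹)ᵀ v‖ ^ 2 := by
  rw [Matrix.mul_inv_rev, ← Matrix.transpose_nonsing_inv]
  have := quad_transpose_mul (R⁻¹)ᵀ v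
  rwa [Matrix.transpose_transpose] at this

theorem dualNorm_factor {R : Matrix (Fin d) (Fin d) ℝ} (v : Vec d) :
    dualNorm (Rᵀ * R) v = ‖act (R⁻¹)ᵀ v‖ := by
  rw [dualNorm, quad_inv_factor, Real.sqrt_sq (norm_nonneg _)]

theorem dualNorm_nonneg (V : Matrix (Fin d) (Fin d) ℝ) (v : Vec d) : 0 ≤ dualNorm V v :=
  Real.sqrt_nonneg _

variable {V : Matrix (Fin d) (Fin d) ℝ}

theorem quad_nonneg (hV : V.PosDef) (v : Vec d) : 0 ≤ quad V v := by
  obtain ⟨R, -, rfl⟩ := posDef_factor hV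
  rw [quad_transpose_mul]; positivity

theorem dualNorm_sq (hV : V.PosDef) (v : Vec d) : dualNorm V v ^ 2 = quad V⁻¹ v :=
  Real.sq_sqrt (quad_nonneg hV.inv v)

theorem dualNorm_add_le (hV : V.PosDef) (u v : Vec d) :
    dualNorm V (u + v) ≤ dualNorm V u + dualNorm V v := by
  obtain ⟨R, -, rfl⟩ := posDef_factor hV
  simp only [dualNorm_factor, map_add]
  exact norm_add_le _ _

theorem dualNorm_smul (hV : V.PosDef) (c : ℝ) (v : Vec d) :
    dualNorm V (c • v) = |c| * dualNorm V v := by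
  obtain ⟨R, -, rfl⟩ := posDef_factor hV
  simp only [dualNorm_factor, map_smul, norm_smul, Real.norm_eq_abs]

theorem dualNorm_neg (hV : V.PosDef) (v : Vec d) : dualNorm V (-v) = dualNorm V v := by
  obtain ⟨R, -, rfl⟩ := posDef_factor hV
  simp only [dualNorm_factor, map_neg, norm_neg]

theorem dualNorm_sub_comm (hV : V.PosDef) (u v : Vec d) :
    dualNorm V (u - v) = dualNorm V (v - u) := by
  rw [← dualNorm_neg hV, neg_sub]

theorem abs_inner_le_dualNorm_mul (hV : V.PosDef) (v x : Vec d) :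
    |inner ℝ v x| ≤ dualNorm V v * √(quad V x) := by
  obtain ⟨R, hR, rfl⟩ := posDef_factor hV
  rw [dualNorm_factor, quad_transpose_mul, Real.sqrt_sq (norm_nonneg _)]
  have : inner ℝ v x = inner ℝ (act (R⁻¹)ᵀ v) (act R x) := by
    rw [inner_act, Matrix.transpose_nonsing_inv, ← act_mul,
      Matrix.mul_nonsing_inv _ (by simpa using hR), act_one]
  rw [this]
  exact abs_real_inner_le_norm _ _

theorem inner_act_inv (V : Matrix (Fin d) (Fin d) ℝ) (v : Vec d) :
    inner ℝ v (act V⁻¹ v) = quad V⁻¹ v := rfl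

theorem quad_act_inv (hV : V.PosDef) (v : Vec d) : quad V (act V⁻¹ v) = quad V⁻¹ v := by
  rw [quad, act_act_inv (posDef_isUnit_det hV), real_inner_comm, quad]

theorem quad_smul (W : Matrix (Fin d) (Fin d) ℝ) (c : ℝ) (v : Vec d) :
    quad W (c • v) = c ^ 2 * quad W v := by
  simp only [quad, map_smul, inner_smul_left, inner_smul_right, conj_trivial]; ring

theorem sqrt_quad_add_le (hV : V.PosDef) (u v : Vec d) :
    √(quad V (u + v)) ≤ √(quad V u) + √(quad V v) := by
  obtain ⟨R, -, rfl⟩ := posDef_factor hV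
  simp only [quad_transpose_mul, map_add, Real.sqrt_sq (norm_nonneg _)]
  exact norm_add_le _ _

/-- A direction in which the dual norm is attained. -/
theorem exists_dual_direction (hV : V.PosDef) (v : Vec d) :
    ∃ x : Vec d, quad V x ≤ 1 ∧ inner ℝ v x = dualNorm V v := by
  rcases eq_or_lt_of_le (dualNorm_nonneg V v) with h | h
  · exact ⟨0, by simp [quad], by rw [← h]; simp⟩
  · refine ⟨(dualNorm V v)⁻¹ • act V⁻¹ v, ?_, ?_⟩
    · rw [quad_smul, quad_act_inv hV, ← dualNorm_sq hV]
      field_simp; exact le_refl _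
    · rw [inner_smul_right, inner_act_inv, ← dualNorm_sq hV]
      field_simp

theorem trace_mul_transpose_self (Y : Matrix (Fin m) (Fin d) ℝ) :
    (Y * Yᵀ).trace = ∑ i, ∑ j, Y i j ^ 2 := by
  simp [Matrix.trace, Matrix.mul_apply, sq]

theorem norm_act_sq_le_trace (Y : Matrix (Fin m) (Fin d) ℝ) (x : Vec d) :
    ‖act Y x‖ ^ 2 ≤ (Y * Yᵀ).trace * ‖x‖ ^ 2 := by
  rw [trace_mul_transpose_self, EuclideanSpace.norm_sq_eq, EuclideanSpace.norm_sq_eq,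
    Finset.sum_mul]
  refine Finset.sum_le_sum fun i _ => ?_
  simp only [act, Matrix.toLpLin_apply, Matrix.mulVec, dotProduct, Real.norm_eq_abs, sq_abs]
  exact Finset.sum_mul_sq_le_sq_mul_sq _ _ _

theorem factor_signal (M : Matrix (Fin m) (Fin d) ℝ) (R : Matrix (Fin d) (Fin d) ℝ) :
    M * (Rᵀ * R)⁻¹ * Mᵀ = (M * R⁻¹) * (M * R⁻¹)ᵀ := by
  rw [Matrix.mul_inv_rev, Matrix.transpose_mul, Matrix.transpose_nonsing_inv]
  simp only [Matrix.mul_assoc]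

/-- The signal `‖M x‖²` is controlled by the trace of the information matrix. -/
theorem norm_act_sq_le (hV : V.PosDef) (M : Matrix (Fin m) (Fin d) ℝ) (x : Vec d) :
    ‖act M x‖ ^ 2 ≤ (M * V⁻¹ * Mᵀ).trace * quad V x := by
  obtain ⟨R, hR, rfl⟩ := posDef_factor hV
  rw [factor_signal, quad_transpose_mul]
  have := norm_act_sq_le_trace (M * R⁻¹) (act R x)
  rwa [← act_mul, Matrix.mul_assoc, Matrix.nonsing_inv_mul _ hR, Matrix.mul_one] at this

theorem infoMatrix_posSemidef (hV : V.PosDef) (M : Matrix (Fin m) (Fin d) ℝ) :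
    (M * V⁻¹ * Mᵀ).PosSemidef := by
  obtain ⟨R, hR, rfl⟩ := posDef_factor hV
  rw [factor_signal]
  have := Matrix.posSemidef_self_mul_conjTranspose (M * R⁻¹)
  rwa [Matrix.conjTranspose_eq_transpose_of_trivial] at this

end LinearAlgebra

/-! ### Determinant and trace of `1 + N` for positive semidefinite `N`. -/

section Det

variable {k : ℕ} {N : Matrix (Fin k) (Fin k) ℝ}

theorem one_add_sum_le_prod {ι : Type*} (s : Finset ι) {f : ι → ℝ} (hf : ∀ i, 0 ≤ f i) :
    1 + ∑ i ∈ s, f i ≤ ∏ i ∈ s, (1 + f i) := by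
  classical
  induction s using Finset.induction_on with
  | empty => simp
  | insert i s hi ih =>
    rw [Finset.sum_insert hi, Finset.prod_insert hi]
    have h1 : 0 ≤ ∑ i ∈ s, f i := Finset.sum_nonneg fun i _ => hf i
    nlinarith [hf i, mul_le_mul_of_nonneg_left ih (by linarith [hf i] : 0 ≤ 1 + f i),
      mul_nonneg (hf i) h1]

theorem det_one_add_eq_prod (hN : N.PosSemidef) :
    (1 + N).det = ∏ i, (1 + hN.isHermitian.eigenvalues i) := by
  have h := hN.isHermitian.spectral_theorem
  set U := hN.isHermitian.eigenvectorUnitary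
  set D : Matrix (Fin k) (Fin k) ℝ := diagonal (RCLike.ofReal ∘ hN.isHermitian.eigenvalues)
  have hU : (U : Matrix (Fin k) (Fin k) ℝ) * star (U : Matrix (Fin k) (Fin k) ℝ) = 1 :=
    Unitary.mul_star_self_of_mem U.2
  have hU' : star (U : Matrix (Fin k) (Fin k) ℝ) * (U : Matrix (Fin k) (Fin k) ℝ) = 1 :=
    Unitary.star_mul_self_of_mem U.2
  have h' : N = (U : Matrix (Fin k) (Fin k) ℝ) * D * star (U : Matrix (Fin k) (Fin k) ℝ) := by
    simpa [Unitary.conjStarAlgAut_apply] using h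
  have h2 : (1 + N).det = (1 + D).det := by
    rw [h', Matrix.mul_assoc, Matrix.det_one_add_mul_comm, Matrix.mul_assoc, hU', Matrix.mul_one]
  rw [h2, ← Matrix.diagonal_one, Matrix.diagonal_add, Matrix.det_diagonal]
  rfl

theorem one_add_trace_le_det (hN : N.PosSemidef) : 1 + N.trace ≤ (1 + N).det := by
  rw [det_one_add_eq_prod hN, hN.isHermitian.trace_eq_sum_eigenvalues]
  exact one_add_sum_le_prod _ fun i => hN.eigenvalues_nonneg i

theorem det_le_exp_trace (hN : N.PosSemidef) : (1 + N).det ≤ Real.exp N.trace := by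
  rw [det_one_add_eq_prod hN, hN.isHermitian.trace_eq_sum_eigenvalues]
  exact Real.prod_one_add_le_exp_sum _ fun i => hN.eigenvalues_nonneg i

theorem det_le_one_add_trace_pow (hN : N.PosSemidef) : (1 + N).det ≤ (1 + N.trace) ^ k := by
  rw [det_one_add_eq_prod hN, hN.isHermitian.trace_eq_sum_eigenvalues]
  refine (Finset.prod_le_prod (fun i _ => by linarith [hN.eigenvalues_nonneg i])
    (fun i _ => ?_)).trans (b := ∏ _i : Fin k, (1 + ∑ j, hN.isHermitian.eigenvalues j)) (by simp)
  have := Finset.single_le_sum (fun j _ => hN.eigenvalues_nonneg j) (Finset.mem_univ i)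
  simpa using this

end Det

/-! ### Trace estimates for the information matrix `M V⁻¹ Mᵀ`. -/

section InfoMatrix

variable {d m : ℕ} {V : Matrix (Fin d) (Fin d) ℝ} {lam L : ℝ}

theorem infoMatrix_diag (W : Matrix (Fin d) (Fin d) ℝ) (M : Matrix (Fin m) (Fin d) ℝ)
    (i : Fin m) : (M * W * Mᵀ) i i = quad W (WithLp.toLp 2 (M i)) := by
  simp only [quad, act, Matrix.toLpLin_apply, EuclideanSpace.inner_eq_star_dotProduct,
    star_trivial]
  rw [Matrix.mul_assoc, Matrix.mul_apply_eq_vecMul, Matrix.vecMul, dotProduct_comm,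
    dotProduct]
  simp [Matrix.mul_apply, Matrix.mulVec, dotProduct, mul_comm]

theorem quad_inv_le (hlam : 0 < lam) (hV : V.PosDef) (hVl : ∀ v, lam * ‖v‖ ^ 2 ≤ quad V v)
    (v : Vec d) : quad V⁻¹ v ≤ ‖v‖ ^ 2 / lam := by
  have h1 := hVl (act V⁻¹ v)
  rw [quad_act_inv hV] at h1
  have h2 : quad V⁻¹ v ≤ ‖v‖ * ‖act V⁻¹ v‖ := (le_abs_self _).trans (abs_real_inner_le_norm _ _)
  have h3 := quad_nonneg hV.inv v
  rw [le_div_iff₀ hlam]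
  rcases eq_or_lt_of_le h3 with h | h
  · rw [← h]; nlinarith [sq_nonneg ‖v‖]
  · have h4 : quad V⁻¹ v ^ 2 ≤ ‖v‖ ^ 2 * ‖act V⁻¹ v‖ ^ 2 := by
      rw [← mul_pow]; exact pow_le_pow_left₀ h3 h2 2
    have h5 : lam * quad V⁻¹ v ^ 2 ≤ ‖v‖ ^ 2 * quad V⁻¹ v := by
      nlinarith [mul_le_mul_of_nonneg_left h1 (sq_nonneg ‖v‖)]
    nlinarith

theorem dualNorm_le (hlam : 0 < lam) (hV : V.PosDef) (hVl : ∀ v, lam * ‖v‖ ^ 2 ≤ quad V v)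
    (v : Vec d) : dualNorm V v ≤ ‖v‖ / √lam := by
  rw [dualNorm, ← Real.sqrt_sq (norm_nonneg v), ← Real.sqrt_div (sq_nonneg _)]
  exact Real.sqrt_le_sqrt (quad_inv_le hlam hV hVl v)

theorem trace_mul_transpose_le {M : Matrix (Fin m) (Fin d) ℝ}
    (hM : ∀ v : Vec d, ‖act M v‖ ≤ L * ‖v‖) : (M * Mᵀ).trace ≤ d * L ^ 2 := by
  rw [trace_mul_transpose_self, Finset.sum_comm]
  have : ∀ j ∈ (Finset.univ : Finset (Fin d)), ∑ i, M i j ^ 2 ≤ L ^ 2 := by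
    intro j _
    have h := hM (EuclideanSpace.single j 1)
    have h0 := norm_nonneg (act M (EuclideanSpace.single j 1))
    rw [PiLp.norm_single, norm_one, mul_one] at h
    have h2 : ‖act M (EuclideanSpace.single j (1:ℝ))‖ ^ 2 = ∑ i, M i j ^ 2 := by
      rw [EuclideanSpace.norm_sq_eq]
      simp [act, Matrix.toLpLin_apply]
    rw [← h2]
    exact pow_le_pow_left₀ h0 h 2
  calc _ ≤ ∑ _j : Fin d, L ^ 2 := Finset.sum_le_sum this
    _ = _ := by simp

theorem trace_infoMatrix_le_div (hlam : 0 < lam) (hV : V.PosDef)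
    (hVl : ∀ v, lam * ‖v‖ ^ 2 ≤ quad V v) (M : Matrix (Fin m) (Fin d) ℝ) :
    (M * V⁻¹ * Mᵀ).trace ≤ (M * Mᵀ).trace / lam := by
  rw [trace_mul_transpose_self, Finset.sum_div]
  refine Finset.sum_le_sum fun i _ => ?_
  rw [Matrix.diag_apply, infoMatrix_diag]
  refine (quad_inv_le hlam hV hVl _).trans_eq ?_
  rw [EuclideanSpace.norm_sq_eq]
  simp

theorem trace_infoMatrix_le (hlam : 0 < lam) (hV : V.PosDef)
    (hVl : ∀ v, lam * ‖v‖ ^ 2 ≤ quad V v) {M : Matrix (Fin m) (Fin d) ℝ}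
    (hM : ∀ v : Vec d, ‖act M v‖ ≤ L * ‖v‖) :
    (M * V⁻¹ * Mᵀ).trace ≤ d * L ^ 2 / lam :=
  (trace_infoMatrix_le_div hlam hV hVl M).trans
    (div_le_div_of_nonneg_right (trace_mul_transpose_le hM) hlam.le)

theorem norm_sq_le_quad_mul (hV : V.PosDef) (v : Vec d) :
    (‖v‖ ^ 2) ^ 2 ≤ quad V⁻¹ v * quad V v := by
  have h := abs_inner_le_dualNorm_mul hV v v
  rw [real_inner_self_eq_norm_sq, abs_of_nonneg (sq_nonneg _)] at h
  have := pow_le_pow_left₀ (sq_nonneg _) h 2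
  rwa [mul_pow, dualNorm_sq hV, Real.sq_sqrt (quad_nonneg hV v)] at this

/-- If `V ≤ c` then `V⁻¹ ≥ 1 / c`. -/
theorem le_quad_inv {c : ℝ} (hV : V.PosDef) (hc : ∀ v, quad V v ≤ c * ‖v‖ ^ 2) (v : Vec d) :
    ‖v‖ ^ 2 ≤ c * quad V⁻¹ v := by
  rcases eq_or_lt_of_le (sq_nonneg ‖v‖) with h | h
  · have hv : v = 0 := by
      have : ‖v‖ = 0 := by
        exact pow_eq_zero_iff two_ne_zero |>.1 h.symm
      exact norm_eq_zero.1 this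
    simp [hv, quad]
  · have h1 := norm_sq_le_quad_mul hV v
    have h2 := mul_le_mul_of_nonneg_left (hc v) (quad_nonneg hV.inv v)
    have h3 : ‖v‖ ^ 2 * ‖v‖ ^ 2 ≤ (c * quad V⁻¹ v) * ‖v‖ ^ 2 := by nlinarith
    exact le_of_mul_le_mul_right h3 h

theorem quad_le_trace_mul {N : Matrix (Fin m) (Fin m) ℝ} (hN : N.PosSemidef) (v : Vec m) :
    quad N v ≤ N.trace * ‖v‖ ^ 2 := by
  open scoped MatrixOrder Matrix.Norms.L2Operator in
  obtain ⟨R, h⟩ := CStarAlgebra.nonneg_iff_eq_star_mul_self.mp hN.nonneg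
  rw [Matrix.star_eq_conjTranspose, Matrix.conjTranspose_eq_transpose_of_trivial] at h
  rw [h, quad_transpose_mul, Matrix.trace_mul_comm]
  exact norm_act_sq_le_trace R v

/-- Cauchy–Schwarz for the Frobenius inner product of M and (V⁻¹ Mᵀ)ᵀ. -/
theorem trace_sq_le (V : Matrix (Fin d) (Fin d) ℝ) (M : Matrix (Fin m) (Fin d) ℝ) :
    (M * V⁻¹ * Mᵀ).trace ^ 2 ≤
      (M * Mᵀ).trace * ((V⁻¹ * Mᵀ) * (V⁻¹ * Mᵀ)ᵀ).trace := by
  rw [Matrix.mul_assoc]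
  set B := V⁻¹ * Mᵀ
  have h : (M * B).trace = ∑ p : Fin m × Fin d, M p.1 p.2 * B p.2 p.1 := by
    rw [Fintype.sum_prod_type]; simp [Matrix.trace, Matrix.mul_apply]
  rw [h, trace_mul_transpose_self, trace_mul_transpose_self, Finset.sum_comm (γ := Fin d),
    ← Fintype.sum_prod_type' (f := fun i j => M i j ^ 2),
    ← Fintype.sum_prod_type' (f := fun i j => B j i ^ 2)]
  exact Finset.sum_mul_sq_le_sq_mul_sq _ _ _

/-- An observation decreases the trace of the inverse. -/
theorem trace_inv_sub_le (hV : V.PosDef) (M : Matrix (Fin m) (Fin d) ℝ) :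
    ((V⁻¹ * Mᵀ) * (V⁻¹ * Mᵀ)ᵀ).trace ≤
      (1 + (M * V⁻¹ * Mᵀ).trace) * (V⁻¹.trace - (V + Mᵀ * M)⁻¹.trace) := by
  have hN := infoMatrix_posSemidef hV M
  have hN1 : (1 + M * V⁻¹ * Mᵀ).PosDef := Matrix.PosDef.one.add_posSemidef hN
  -- Woodbury: V⁻¹ - (V + Mᵀ M)⁻¹ = V⁻¹ Mᵀ (1 + N)⁻¹ M V⁻¹ with N = M V⁻¹ Mᵀ. As 1 + N ≤ 1 + tr N,
  -- dropping (1 + N)⁻¹ costs at most the factor 1 + tr N, row by row.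
  have hw := Matrix.add_mul_mul_inv_eq_sub (A := V) (U := Mᵀ) (C := 1) (V := M) hV.isUnit
    isUnit_one (by simpa using hN1.isUnit)
  rw [Matrix.mul_one, inv_one] at hw
  have hVt : (V⁻¹ * Mᵀ)ᵀ = M * V⁻¹ := by
    have : V⁻¹ᵀ = V⁻¹ := by
      have := hV.inv.isHermitian
      rwa [Matrix.IsHermitian, Matrix.conjTranspose_eq_transpose_of_trivial] at this
    rw [Matrix.transpose_mul, Matrix.transpose_transpose, this]
  have hw' : V⁻¹.trace - (V + Mᵀ * M)⁻¹.trace =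
      ((V⁻¹ * Mᵀ) * (1 + M * V⁻¹ * Mᵀ)⁻¹ * (V⁻¹ * Mᵀ)ᵀ).trace := by
    rw [hw, Matrix.trace_sub, hVt]
    simp only [Matrix.mul_assoc]; ring
  have htr : ∀ N : Matrix (Fin d) (Fin d) ℝ, N.trace = ∑ i, N i i := fun _ => rfl
  rw [hw', trace_mul_transpose_self, htr (_ * _ * _), Finset.mul_sum]
  refine Finset.sum_le_sum fun i _ => ?_
  rw [infoMatrix_diag]
  have := le_quad_inv hN1 (c := 1 + (M * V⁻¹ * Mᵀ).trace) (fun v => by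
    have h1 := quad_le_trace_mul hN v
    have h2 := quad_smul_one 1 v
    rw [one_smul] at h2
    rw [quad_add, h2]; linarith) (WithLp.toLp 2 ((V⁻¹ * Mᵀ) i))
  rw [EuclideanSpace.norm_sq_eq] at this
  simpa using this

end InfoMatrix

namespace Game

variable {A Z : Type*} [TopologicalSpace A] [MeasurableSpace Z] {d m : ℕ}
  {G : Game A Z d m} {lam L : ℝ}

/-- The trace of the information matrix of action `a`. -/
noncomputable def signal (G : Game A Z d m) (V : Matrix (Fin d) (Fin d) ℝ) (a : A) (z : Z) : ℝ :=
  (G.M z a * V⁻¹ * (G.M z a)ᵀ).trace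

section Info

variable {V : Matrix (Fin d) (Fin d) ℝ}

theorem signal_nonneg (hV : V.PosDef) (a : A) (z : Z) : 0 ≤ G.signal V a z :=
  (infoMatrix_posSemidef hV _).trace_nonneg

theorem infoGain_le (hV : V.PosDef) (a : A) (z : Z) :
    G.infoGain V a z ≤ G.signal V a z / 2 := by
  have hN := infoMatrix_posSemidef hV (G.M z a)
  have h1 := one_add_trace_le_det hN
  have h2 := det_le_exp_trace hN
  have h0 := hN.trace_nonneg
  have h3 := (Real.log_le_iff_le_exp (by linarith)).2 h2
  rw [infoGain, signal]; linarith

theorem le_infoGain (hV : V.PosDef) (a : A) (z : Z) :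
    Real.log (1 + G.signal V a z) / 2 ≤ G.infoGain V a z := by
  have hN := infoMatrix_posSemidef hV (G.M z a)
  have h1 := one_add_trace_le_det hN
  have h0 := hN.trace_nonneg
  have h3 := Real.log_le_log (by linarith) h1
  rw [infoGain, signal]; linarith

theorem infoGain_nonneg (hV : V.PosDef) (a : A) (z : Z) : 0 ≤ G.infoGain V a z := by
  refine le_trans ?_ (le_infoGain hV a z)
  have := Real.log_nonneg (by linarith [signal_nonneg (G := G) hV a z] : 1 ≤ 1 + G.signal V a z)
  linarith

theorem signal_le (hlam : 0 < lam) (hV : V.PosDef) (hVl : ∀ v, lam * ‖v‖ ^ 2 ≤ quad V v)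
    (hB : G.Bounded L) {z : Z} {a : A} (ha : a ∈ G.avail z) :
    G.signal V a z ≤ d * L ^ 2 / lam :=
  trace_infoMatrix_le hlam hV hVl (hB z a ha).2

end Info

/-! ### Volume growth and information gains along a history. -/

section History

variable (z : ℕ → Z) (a : ℕ → A)

theorem covMat_one : G.covMat lam z a 1 = lam • 1 := by simp [covMat]

theorem covMat_succ {t : ℕ} (ht : 1 ≤ t) :
    G.covMat lam z a (t + 1) = G.covMat lam z a t + (G.M (z t) (a t))ᵀ * G.M (z t) (a t) := by
  rw [covMat, covMat, Finset.sum_Ico_succ_top ht, add_assoc]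

theorem smul_one_posDef (hlam : 0 < lam) :
    (lam • (1 : Matrix (Fin d) (Fin d) ℝ)).PosDef := Matrix.PosDef.one.smul hlam

theorem gram_posSemidef (t : ℕ) :
    (∑ s ∈ Finset.Ico 1 t, (G.M (z s) (a s))ᵀ * G.M (z s) (a s)).PosSemidef := by
  refine Matrix.posSemidef_sum _ fun s _ => ?_
  have := Matrix.posSemidef_conjTranspose_mul_self (G.M (z s) (a s))
  rwa [Matrix.conjTranspose_eq_transpose_of_trivial] at this

theorem covMat_posDef (hlam : 0 < lam) (t : ℕ) : (G.covMat lam z a t).PosDef :=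
  (smul_one_posDef hlam).add_posSemidef (gram_posSemidef z a t)

theorem quad_posSemidef_nonneg {N : Matrix (Fin d) (Fin d) ℝ} (hN : N.PosSemidef) (v : Vec d) :
    0 ≤ quad N v := by
  have := hN.dotProduct_mulVec_nonneg v.ofLp
  simp only [quad, act, Matrix.toLpLin_apply, EuclideanSpace.inner_eq_star_dotProduct]
  rw [dotProduct_comm]; exact this

theorem le_quad_covMat (t : ℕ) (v : Vec d) : lam * ‖v‖ ^ 2 ≤ quad (G.covMat lam z a t) v := by
  rw [covMat, quad_add, quad_smul_one]
  linarith [quad_posSemidef_nonneg (gram_posSemidef (G := G) z a t) v]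

/-- `log det V_t - log det (λ I)`. -/
noncomputable def logVol (G : Game A Z d m) (lam : ℝ) (z : ℕ → Z) (a : ℕ → A) (t : ℕ) : ℝ :=
  Real.log (G.covMat lam z a t).det - Real.log (lam • (1 : Matrix (Fin d) (Fin d) ℝ)).det

theorem logVol_one : G.logVol lam z a 1 = 0 := by rw [logVol, covMat_one, sub_self]

/-- The matrix determinant lemma: det(V + Mᵀ M) = det V · det(1 + M V⁻¹ Mᵀ). The volume therefore
telescopes into twice the total information gain. -/
theorem logVol_succ (hlam : 0 < lam) {t : ℕ} (ht : 1 ≤ t) :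
    G.logVol lam z a (t + 1) = G.logVol lam z a t
      + 2 * G.infoGain (G.covMat lam z a t) (a t) (z t) := by
  have hV := covMat_posDef (G := G) z a hlam t
  have hdet := hV.det_pos
  have h1 := one_add_trace_le_det (infoMatrix_posSemidef hV (G.M (z t) (a t)))
  have h0 := (infoMatrix_posSemidef hV (G.M (z t) (a t))).trace_nonneg
  rw [logVol, covMat_succ z a ht, Matrix.det_add_mul _ _ (posDef_isUnit_det hV),
    Real.log_mul hdet.ne' (by linarith), logVol, infoGain]
  ring

theorem logVol_eq_sum (hlam : 0 < lam) {t : ℕ} (ht : 1 ≤ t) :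
    G.logVol lam z a t = 2 * ∑ s ∈ Finset.Ico 1 t,
      G.infoGain (G.covMat lam z a s) (a s) (z s) := by
  induction t, ht using Nat.le_induction with
  | base => simp [logVol_one]
  | succ t ht ih => rw [logVol_succ z a hlam ht, ih, Finset.sum_Ico_succ_top ht]; ring

theorem logVol_mono (hlam : 0 < lam) {s t : ℕ} (hs : 1 ≤ s) (hst : s ≤ t) :
    G.logVol lam z a s ≤ G.logVol lam z a t := by
  rw [logVol_eq_sum z a hlam hs, logVol_eq_sum z a hlam (hs.trans hst)]
  have := Finset.sum_le_sum_of_subset_of_nonneg (Finset.Ico_subset_Ico_right hst (a := 1))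
    (f := fun s => G.infoGain (G.covMat lam z a s) (a s) (z s))
    fun i _ _ => infoGain_nonneg (covMat_posDef z a hlam i) _ _
  linarith

theorem logVol_nonneg (hlam : 0 < lam) {t : ℕ} (ht : 1 ≤ t) : 0 ≤ G.logVol lam z a t := by
  rw [← logVol_one (G := G) (lam := lam) z a]; exact logVol_mono z a hlam le_rfl ht

theorem covMat_eq_smul (hlam : 0 < lam) (t : ℕ) : G.covMat lam z a t = lam • (1 + lam⁻¹ •
    ∑ s ∈ Finset.Ico 1 t, (G.M (z s) (a s))ᵀ * G.M (z s) (a s)) := by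
  rw [smul_add, smul_smul, mul_inv_cancel₀ hlam.ne', one_smul, covMat]

theorem exp_logVol (hlam : 0 < lam) (t : ℕ) : Real.exp (G.logVol lam z a t) =
    (1 + lam⁻¹ • ∑ s ∈ Finset.Ico 1 t, (G.M (z s) (a s))ᵀ * G.M (z s) (a s)).det := by
  have h1 := (covMat_posDef (G := G) z a hlam t).det_pos
  have h2 := (smul_one_posDef (d := d) hlam).det_pos
  rw [logVol, ← Real.log_div h1.ne' h2.ne', Real.exp_log (div_pos h1 h2), covMat_eq_smul z a hlam,
    Matrix.det_smul, Matrix.det_smul, Matrix.det_one, mul_one]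
  field_simp

theorem smul_gram_posSemidef (hlam : 0 < lam) (t : ℕ) :
    (lam⁻¹ • ∑ s ∈ Finset.Ico 1 t, (G.M (z s) (a s))ᵀ * G.M (z s) (a s)).PosSemidef :=
  (gram_posSemidef z a t).smul (inv_pos.2 hlam).le

/-- For the Gram matrix P scaled by 1/λ one has 1 + P ≤ 1 + tr P ≤ det(1 + P), and this determinant
is the exponential of `logVol`. A small volume thus keeps V_t bounded, hence the confidence set wide
in every direction. -/
theorem quad_covMat_le (hlam : 0 < lam) (t : ℕ) (v : Vec d) :
    quad (G.covMat lam z a t) v ≤ lam * Real.exp (G.logVol lam z a t) * ‖v‖ ^ 2 := by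
  have hP := smul_gram_posSemidef (G := G) z a hlam t
  have h1 := one_add_trace_le_det hP
  have h2 := quad_le_trace_mul hP v
  rw [← exp_logVol z a hlam] at h1
  have h3 : quad (G.covMat lam z a t) v = lam * ‖v‖ ^ 2 + lam * quad (lam⁻¹ •
      ∑ s ∈ Finset.Ico 1 t, (G.M (z s) (a s))ᵀ * G.M (z s) (a s)) v := by
    rw [covMat_eq_smul z a hlam, smul_add, quad_add, quad_smul_one]
    congr 1
    simp only [quad, act, map_smul, LinearMap.smul_apply, inner_smul_right]
  rw [h3]
  have h4 := mul_le_mul_of_nonneg_right h1 (sq_nonneg ‖v‖)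
  have h5 := mul_le_mul_of_nonneg_left (h2.trans (by linarith :
    _ ≤ Real.exp (G.logVol lam z a t) * ‖v‖ ^ 2 - ‖v‖ ^ 2)) hlam.le
  linarith

theorem norm_le_dualNorm (hlam : 0 < lam) (t : ℕ) (v : Vec d) :
    ‖v‖ ≤ √(lam * Real.exp (G.logVol lam z a t)) * dualNorm (G.covMat lam z a t) v := by
  have h := le_quad_inv (covMat_posDef z a hlam t) (quad_covMat_le (G := G) z a hlam t) v
  rw [← dualNorm_sq (covMat_posDef z a hlam t)] at h
  rw [← Real.sqrt_sq (dualNorm_nonneg _ v), ← Real.sqrt_mul (by positivity)]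
  exact Real.le_sqrt_of_sq_le h

theorem logVol_le (hlam : 0 < lam) (hB : G.Bounded L) {t : ℕ} (ht : 1 ≤ t)
    (ha : ∀ s ∈ Finset.Ico 1 t, a s ∈ G.avail (z s)) :
    G.logVol lam z a t ≤ d * Real.log (1 + t * (d * L ^ 2 / lam)) := by
  have hP := smul_gram_posSemidef (G := G) z a hlam t
  have h2 := det_le_one_add_trace_pow hP
  have h0 := hP.trace_nonneg
  have h3 : (lam⁻¹ • ∑ s ∈ Finset.Ico 1 t, (G.M (z s) (a s))ᵀ * G.M (z s) (a s)).trace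
      ≤ t * (d * L ^ 2 / lam) := by
    rw [Matrix.trace_smul, Matrix.trace_sum, smul_eq_mul]
    have : ∑ s ∈ Finset.Ico 1 t, ((G.M (z s) (a s))ᵀ * G.M (z s) (a s)).trace
        ≤ t * (d * L ^ 2) := by
      calc _ ≤ ∑ s ∈ Finset.Ico 1 t, (d * L ^ 2) := Finset.sum_le_sum fun s hs => by
            rw [Matrix.trace_mul_comm]
            exact trace_mul_transpose_le (hB _ _ (ha s hs)).2
        _ = (t - 1 : ℕ) * (d * L ^ 2) := by simp
        _ ≤ _ := by
          gcongr; omega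
    calc _ ≤ lam⁻¹ * (t * (d * L ^ 2)) := mul_le_mul_of_nonneg_left this (inv_pos.2 hlam).le
      _ = _ := by field_simp
  rw [← Real.log_exp (G.logVol lam z a t), exp_logVol z a hlam, ← Real.log_pow]
  refine Real.log_le_log (by linarith [one_add_trace_le_det hP]) (h2.trans ?_)
  exact pow_le_pow_left₀ (by linarith) (by linarith) d

/-- The squared information gains are summable with a bound that does not depend on the
horizon. -/
theorem sum_infoGain_sq_le (hlam : 0 < lam) (hB : G.Bounded L) {n : ℕ}
    (ha : ∀ s ∈ Finset.Icc 1 n, a s ∈ G.avail (z s)) :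
    ∑ t ∈ Finset.Icc 1 n, G.infoGain (G.covMat lam z a t) (a t) (z t) ^ 2 ≤
      d * L ^ 2 * (1 + d * L ^ 2 / lam) * (d / lam) / 4 := by
  set c : ℝ := d * L ^ 2 * (1 + d * L ^ 2 / lam) / 4 with hc
  have hc0 : 0 ≤ c := by positivity
  -- The potential is tr V_t⁻¹. One round has I ≤ tr N / 2, and (tr N)² ≤ d L² (1 + d L² / λ) times
  -- the drop of the potential, by `trace_sq_le` and `trace_inv_sub_le`. The potential starts at d /
  -- λ and stays nonnegative.
  have key : ∀ k ≤ n, ∑ t ∈ Finset.Icc 1 k, G.infoGain (G.covMat lam z a t) (a t) (z t) ^ 2 ≤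
      c * ((G.covMat lam z a 1)⁻¹.trace - (G.covMat lam z a (k + 1))⁻¹.trace) := by
    intro k
    induction k with
    | zero => simp
    | succ k ih =>
      intro hk
      have hV := covMat_posDef (G := G) z a hlam (k + 1)
      have hVl := le_quad_covMat (G := G) (lam := lam) z a (k + 1)
      have hmem := ha (k + 1) (Finset.mem_Icc.2 ⟨by omega, hk⟩)
      rw [Finset.sum_Icc_succ_top (by omega)]
      have h1 := infoGain_le (G := G) hV (a (k + 1)) (z (k + 1))
      have h0 := infoGain_nonneg (G := G) hV (a (k + 1)) (z (k + 1))
      have h2 := trace_sq_le (G.covMat lam z a (k + 1)) (G.M (z (k + 1)) (a (k + 1)))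
      have h3 := trace_inv_sub_le hV (G.M (z (k + 1)) (a (k + 1)))
      have h4 := trace_mul_transpose_le (hB _ _ hmem).2
      have h5 := signal_le hlam hV hVl hB hmem
      have h6 := signal_nonneg (G := G) hV (a (k + 1)) (z (k + 1))
      rw [← covMat_succ z a (by omega)] at h3
      change _ ≤ (1 + G.signal _ _ _) * _ at h3
      change G.signal _ _ _ ^ 2 ≤ _ at h2
      have h7 : 0 ≤ ((G.covMat lam z a (k + 1))⁻¹ * (G.M (z (k + 1)) (a (k + 1)))ᵀ *
          ((G.covMat lam z a (k + 1))⁻¹ * (G.M (z (k + 1)) (a (k + 1)))ᵀ)ᵀ).trace := by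
        rw [trace_mul_transpose_self]; positivity
      have h8 : 0 ≤ (G.covMat lam z a (k + 1))⁻¹.trace - (G.covMat lam z a (k + 1 + 1))⁻¹.trace :=
        nonneg_of_mul_nonneg_right (h7.trans h3) (by linarith)
      have h9 : G.infoGain (G.covMat lam z a (k + 1)) (a (k + 1)) (z (k + 1)) ^ 2 ≤
          c * ((G.covMat lam z a (k + 1))⁻¹.trace - (G.covMat lam z a (k + 1 + 1))⁻¹.trace) := by
        have e1 := pow_le_pow_left₀ h0 h1 2
        have e2 := mul_le_mul h4 (h3.trans (mul_le_mul_of_nonneg_right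
          (by linarith : _ ≤ 1 + d * L ^ 2 / lam) h8)) h7 (by positivity)
        rw [hc]
        nlinarith
      have := ih (by omega)
      linarith
  refine (key n le_rfl).trans ?_
  have h1 : (G.covMat lam z a 1)⁻¹.trace = d / lam := by
    have : (lam • (1 : Matrix (Fin d) (Fin d) ℝ))⁻¹ = lam⁻¹ • 1 := by
      apply Matrix.inv_eq_left_inv
      rw [smul_mul_smul_comm, inv_mul_cancel₀ hlam.ne', one_smul, Matrix.one_mul]
    rw [covMat_one, this, Matrix.trace_smul, Matrix.trace_one]
    simp; field_simp
  have h2 := (covMat_posDef (G := G) z a hlam (n + 1)).inv.posSemidef.trace_nonneg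
  rw [h1, hc]
  nlinarith

end History

end Game

/-- The ellipsoid `{θ : ⟨θ - c, V (θ - c)⟩ ≤ s²}`. -/
def ellipsoid {d : ℕ} (V : Matrix (Fin d) (Fin d) ℝ) (c : Vec d) (s : ℝ) : Set (Vec d) :=
  {θ | quad V (θ - c) ≤ s ^ 2}

namespace Game

variable {A Z : Type*} [TopologicalSpace A] [MeasurableSpace Z] {d m : ℕ}
  {G : Game A Z d m} {lam L : ℝ}

/-! ### Gaps -/

section Gap

theorem bddAbove_inner (G : Game A Z d m) (a : A) (z : Z) (θ : Vec d) :
    BddAbove (Set.range fun b : G.avail z => (inner ℝ (G.φ z b - G.φ z a) θ : ℝ)) := by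
  have h := (G.avail_compact z).bddAbove_image
    (f := fun b => (inner ℝ (G.φ z b - G.φ z a) θ : ℝ))
    (by have := G.φ_continuous z; fun_prop)
  rwa [Set.image_eq_range] at h

theorem inner_le_gap {a b : A} {z : Z} (hb : b ∈ G.avail z) (θ : Vec d) :
    inner ℝ (G.φ z b - G.φ z a) θ ≤ G.gap a z θ :=
  le_ciSup (G.bddAbove_inner a z θ) ⟨b, hb⟩

theorem gap_le {a : A} {z : Z} {θ : Vec d} {r : ℝ}
    (h : ∀ b ∈ G.avail z, inner ℝ (G.φ z b - G.φ z a) θ ≤ r) : G.gap a z θ ≤ r := by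
  have : Nonempty (G.avail z) := (G.avail_nonempty z).to_subtype
  exact ciSup_le fun b => h b b.2

theorem gap_nonneg {a : A} {z : Z} (ha : a ∈ G.avail z) (θ : Vec d) : 0 ≤ G.gap a z θ := by
  have := inner_le_gap ha θ (a := a)
  simpa using this

theorem exists_isOptimal (G : Game A Z d m) (z : Z) (θ : Vec d) : ∃ a, G.IsOptimal z θ a := by
  obtain ⟨a, ha, h⟩ := (G.avail_compact z).exists_isMaxOn (G.avail_nonempty z)
    (f := fun b => (inner ℝ (G.φ z b) θ : ℝ))
    (by have := G.φ_continuous z; fun_prop)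
  exact ⟨a, ha, fun b hb => h hb⟩

theorem IsOptimal.inner_sub_nonpos {a b : A} {z : Z} {θ : Vec d} (h : G.IsOptimal z θ a)
    (hb : b ∈ G.avail z) : inner ℝ (G.φ z b - G.φ z a) θ ≤ 0 := by
  rw [inner_sub_left]; linarith [h.2 b hb]

theorem gap_le_norm (hB : G.Bounded L) {a : A} {z : Z} (ha : a ∈ G.avail z) (θ : Vec d) :
    G.gap a z θ ≤ ‖θ‖ := by
  refine gap_le fun b hb => (real_inner_le_norm _ _).trans ?_
  have := ((hB z b hb).1 a ha)
  nlinarith [norm_nonneg θ]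

end Gap

/-! ### Support functions of ellipsoids and the resulting gap estimates. -/

section Ellipsoid

variable {V : Matrix (Fin d) (Fin d) ℝ} {c : Vec d} {s : ℝ}

theorem center_mem (V : Matrix (Fin d) (Fin d) ℝ) (c : Vec d) (s : ℝ) : c ∈ ellipsoid V c s := by
  simp [ellipsoid, quad]; positivity

theorem sqrt_quad_le_of_mem (hs : 0 ≤ s) {θ : Vec d} (h : θ ∈ ellipsoid V c s) :
    √(quad V (θ - c)) ≤ s :=
  (Real.sqrt_le_sqrt h).trans_eq (Real.sqrt_sq hs)

theorem inner_le_of_mem (hV : V.PosDef) (hs : 0 ≤ s) {θ : Vec d} (h : θ ∈ ellipsoid V c s)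
    (v : Vec d) : inner ℝ v θ ≤ inner ℝ v c + s * dualNorm V v := by
  have h1 := (le_abs_self _).trans (abs_inner_le_dualNorm_mul hV v (θ - c))
  rw [inner_sub_right] at h1
  have h2 := mul_le_mul_of_nonneg_left (sqrt_quad_le_of_mem hs h) (dualNorm_nonneg V v)
  linarith

theorem exists_mem_inner_eq (hV : V.PosDef) (c : Vec d) (s : ℝ) (v : Vec d) :
    ∃ θ ∈ ellipsoid V c s, inner ℝ v θ = inner ℝ v c + s * dualNorm V v := by
  obtain ⟨x, hx, hvx⟩ := exists_dual_direction hV v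
  refine ⟨c + s • x, ?_, ?_⟩
  · simp only [ellipsoid, Set.mem_ofPred_eq, add_sub_cancel_left, quad_smul]
    nlinarith [sq_nonneg s]
  · rw [inner_add_right, inner_smul_right, hvx]

/-- The support function of an ellipsoid, attained along the direction dual to v. It puts the gap
estimate in upper-confidence form: estimated gap plus radius times dual norm. -/
theorem iSup_inner_ellipsoid (hV : V.PosDef) (hs : 0 ≤ s) (v : Vec d) :
    ⨆ θ : ellipsoid V c s, inner ℝ v (θ : Vec d) = inner ℝ v c + s * dualNorm V v := by
  have : Nonempty (ellipsoid V c s) := ⟨⟨c, center_mem V c s⟩⟩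
  refine le_antisymm (ciSup_le fun θ => inner_le_of_mem hV hs θ.2 v) ?_
  obtain ⟨θ, hθ, h⟩ := exists_mem_inner_eq hV c s v
  rw [← h]
  exact le_ciSup (f := fun θ : ellipsoid V c s => (inner ℝ v (θ : Vec d) : ℝ))
    ⟨_, by rintro _ ⟨θ, rfl⟩; exact inner_le_of_mem hV hs θ.2 v⟩ ⟨θ, hθ⟩

theorem gapEstimate_ellipsoid (hV : V.PosDef) (hs : 0 ≤ s) (a : A) (z : Z) :
    G.gapEstimate (ellipsoid V c s) a z = ⨆ b : G.avail z,
      (inner ℝ (G.φ z b - G.φ z a) c + s * dualNorm V (G.φ z b - G.φ z a)) := by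
  simp only [gapEstimate, iSup_inner_ellipsoid hV hs]

theorem continuous_dualNorm (V : Matrix (Fin d) (Fin d) ℝ) : Continuous (dualNorm V) := by
  have h : Continuous (act V⁻¹) := LinearMap.continuous_of_finiteDimensional _
  unfold dualNorm quad
  fun_prop

theorem bddAbove_ucb (G : Game A Z d m) (V : Matrix (Fin d) (Fin d) ℝ) (c : Vec d) (s : ℝ)
    (a : A) (z : Z) : BddAbove (Set.range fun b : G.avail z =>
      (inner ℝ (G.φ z b - G.φ z a) c + s * dualNorm V (G.φ z b - G.φ z a) : ℝ)) := by
  have h := (G.avail_compact z).bddAbove_image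
    (f := fun b => (inner ℝ (G.φ z b - G.φ z a) c + s * dualNorm V (G.φ z b - G.φ z a) : ℝ))
    (by have := G.φ_continuous z; have := continuous_dualNorm V; fun_prop)
  rwa [Set.image_eq_range] at h

theorem ucb_le_gapEstimate (hV : V.PosDef) (hs : 0 ≤ s) {a b : A} {z : Z} (hb : b ∈ G.avail z) :
    inner ℝ (G.φ z b - G.φ z a) c + s * dualNorm V (G.φ z b - G.φ z a) ≤
      G.gapEstimate (ellipsoid V c s) a z := by
  rw [gapEstimate_ellipsoid hV hs]
  exact le_ciSup (G.bddAbove_ucb V c s a z) ⟨b, hb⟩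

theorem gapEstimate_le (hV : V.PosDef) (hs : 0 ≤ s) {a : A} {z : Z} {r : ℝ}
    (h : ∀ b ∈ G.avail z,
      inner ℝ (G.φ z b - G.φ z a) c + s * dualNorm V (G.φ z b - G.φ z a) ≤ r) :
    G.gapEstimate (ellipsoid V c s) a z ≤ r := by
  have : Nonempty (G.avail z) := (G.avail_nonempty z).to_subtype
  rw [gapEstimate_ellipsoid hV hs]
  exact ciSup_le fun b => h b b.2

theorem gap_le_gapEstimate (hV : V.PosDef) (hs : 0 ≤ s) {θ : Vec d} (hθ : θ ∈ ellipsoid V c s)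
    (a : A) (z : Z) : G.gap a z θ ≤ G.gapEstimate (ellipsoid V c s) a z :=
  gap_le fun _ hb => (inner_le_of_mem hV hs hθ _).trans (ucb_le_gapEstimate hV hs hb)

theorem gapEstimate_nonneg (hV : V.PosDef) (hs : 0 ≤ s) {a : A} {z : Z} (ha : a ∈ G.avail z) :
    0 ≤ G.gapEstimate (ellipsoid V c s) a z := by
  have := ucb_le_gapEstimate (c := c) hV hs ha (a := a)
  simpa [dualNorm, quad] using this

theorem gapEstimate_le_const (hlam : 0 < lam) (hV : V.PosDef)
    (hVl : ∀ v, lam * ‖v‖ ^ 2 ≤ quad V v) (hs : 0 ≤ s) (hB : G.Bounded L) {a : A} {z : Z}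
    (ha : a ∈ G.avail z) :
    G.gapEstimate (ellipsoid V c s) a z ≤ ‖c‖ + s / √lam := by
  refine gapEstimate_le hV hs fun b hb => ?_
  have h1 := (hB z b hb).1 a ha
  have h2 := real_inner_le_norm (G.φ z b - G.φ z a) c
  have h3 := dualNorm_le hlam hV hVl (G.φ z b - G.φ z a)
  have h4 : dualNorm V (G.φ z b - G.φ z a) ≤ 1 / √lam := h3.trans (by gcongr)
  have h5 := mul_le_mul_of_nonneg_left h4 hs
  have h6 := mul_le_mul_of_nonneg_right h1 (norm_nonneg c)
  rw [mul_one_div] at h5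
  linarith

/-- The suprema over actions and over parameters commute. Membership in `extPlausible` thereby
becomes a bound on the gap estimate. -/
theorem iSup_gap_ellipsoid (hV : V.PosDef) (hs : 0 ≤ s) (a : A) (z : Z) :
    ⨆ θ : ellipsoid V c s, G.gap a z θ = G.gapEstimate (ellipsoid V c s) a z := by
  have : Nonempty (ellipsoid V c s) := ⟨⟨c, center_mem V c s⟩⟩
  refine le_antisymm (ciSup_le fun θ => gap_le_gapEstimate hV hs θ.2 a z) ?_
  refine gapEstimate_le hV hs fun b hb => ?_
  obtain ⟨θ, hθ, h⟩ := exists_mem_inner_eq hV c s (G.φ z b - G.φ z a)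
  rw [← h]
  exact (inner_le_gap hb θ).trans (le_ciSup (f := fun θ : ellipsoid V c s => G.gap a z θ)
    ⟨_, by rintro _ ⟨θ, rfl⟩; exact gap_le_gapEstimate hV hs θ.2 a z⟩ ⟨θ, hθ⟩)

/-- When the parameter lies well inside the ellipsoid and the ellipsoid is wide, the gap estimate
exceeds the gap by a large factor. -/
theorem mul_gap_le_gapEstimate (hV : V.PosDef) (hs : 0 ≤ s) {θ : Vec d} {ξ κ W R : ℝ}
    (hθ : √(quad V (θ - c)) ≤ ξ) (hξ : ξ ≤ s) (hW : 0 < W)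
    (hVW : ∀ v : Vec d, ‖v‖ ≤ W * dualNorm V v) (hR : 0 < R) (hθR : ‖θ‖ ≤ R)
    (hκ : κ ≤ 1 + (s - ξ) / (W * R)) (hκ0 : 0 < κ) {a : A} {z : Z} (ha : a ∈ G.avail z) :
    κ * G.gap a z θ ≤ G.gapEstimate (ellipsoid V c s) a z := by
  rw [← le_div_iff₀' hκ0]
  refine gap_le fun b hb => ?_
  rw [le_div_iff₀' hκ0]
  set v := G.φ z b - G.φ z a
  rcases le_or_gt (inner ℝ v θ) 0 with h | h
  · exact (mul_nonpos_of_nonneg_of_nonpos hκ0.le h).trans (gapEstimate_nonneg hV hs ha)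
  · refine le_trans ?_ (ucb_le_gapEstimate hV hs hb)
    -- Passing from c to θ costs at most ξ times the dual norm of v, so the surplus s - ξ remains.
    -- Since ⟨v, θ⟩ is at most W R times the dual norm, the surplus is a fixed multiple of ⟨v, θ⟩
    -- itself.
    have h1 := (le_abs_self _).trans (abs_inner_le_dualNorm_mul hV v (θ - c))
    rw [inner_sub_right] at h1
    have h2 := mul_le_mul_of_nonneg_left hθ (dualNorm_nonneg V v)
    have h3 : inner ℝ v θ ≤ W * R * dualNorm V v := by
      calc inner ℝ v θ ≤ ‖v‖ * ‖θ‖ := real_inner_le_norm _ _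
        _ ≤ (W * dualNorm V v) * R := mul_le_mul (hVW v) hθR (norm_nonneg _)
            (mul_nonneg hW.le (dualNorm_nonneg V v))
        _ = _ := by ring
    have h4 : (s - ξ) / (W * R) * inner ℝ v θ ≤ (s - ξ) * dualNorm V v := by
      calc _ ≤ (s - ξ) / (W * R) * (W * R * dualNorm V v) :=
            mul_le_mul_of_nonneg_left h3 (div_nonneg (by linarith) (by positivity))
        _ = _ := by field_simp
    have h5 := mul_le_mul_of_nonneg_right hκ h.le
    change κ * inner ℝ v θ ≤ inner ℝ v c + s * dualNorm V v
    linarith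

/-- When the parameter lies well inside the ellipsoid, the gap estimates are controlled by the gap
estimate of a greedy action. -/
theorem gapEstimate_le_of_greedy (hV : V.PosDef) (hs : 0 ≤ s) {θ : Vec d} {ζ R : ℝ}
    (hζ : 0 < ζ) (hθ : √(quad V (θ - c)) ≤ (1 - ζ) * s) (hθR : ‖θ‖ ≤ R)
    (hB : G.Bounded L) {z : Z} {g a : A} (hg : g ∈ G.avail z) (ha : a ∈ G.avail z) :
    G.gapEstimate (ellipsoid V c s) a z ≤
      (1 + 2 / ζ) * (G.gapEstimate (ellipsoid V c s) g z + R) := by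
  set w := dualNorm V (G.φ z g - G.φ z a) with hw
  have hw0 : 0 ≤ w := dualNorm_nonneg _ _
  have hR0 : 0 ≤ R := (norm_nonneg θ).trans hθR
  have h1 := abs_inner_le_dualNorm_mul hV (G.φ z g - G.φ z a) (θ - c)
  have h1' := mul_le_mul_of_nonneg_left hθ hw0
  rw [inner_sub_right] at h1
  have h2 : inner ℝ (G.φ z g - G.φ z a) θ ≤ R :=
    (inner_le_gap hg θ).trans ((gap_le_norm hB ha θ).trans hθR)
  have h3 : inner ℝ (G.φ z g - G.φ z a) c ≤ R + w * ((1 - ζ) * s) := by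
    linarith [neg_abs_le (inner ℝ (G.φ z g - G.φ z a) θ - inner ℝ (G.φ z g - G.φ z a) c)]
  have h4 := ucb_le_gapEstimate (c := c) hV hs ha (a := g)
  rw [dualNorm_sub_comm hV, ← neg_sub (G.φ z g), inner_neg_left, ← hw] at h4
  set Γ := G.gapEstimate (ellipsoid V c s) g z with hΓ
  have hG0 : 0 ≤ Γ := gapEstimate_nonneg hV hs hg
  -- The true gap between g and a is at most R, so the centre prefers g to a by at most R + (1 - ζ)
  -- s w. But a competes with g in the definition of Γ with bonus s w; adding the two inequalities
  -- leaves ζ s w ≤ Γ + R.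
  have h5 : s * w ≤ (Γ + R) / ζ := by
    rw [le_div_iff₀ hζ]; nlinarith
  refine gapEstimate_le hV hs fun b hb => ?_
  have h6 := ucb_le_gapEstimate (c := c) hV hs hb (a := g)
  have h7 := dualNorm_add_le hV (G.φ z b - G.φ z g) (G.φ z g - G.φ z a)
  rw [sub_add_sub_cancel] at h7
  have h8 : inner ℝ (G.φ z b - G.φ z a) c =
      inner ℝ (G.φ z b - G.φ z g) c + inner ℝ (G.φ z g - G.φ z a) c := by
    rw [← inner_add_left, sub_add_sub_cancel]
  have h9 := mul_le_mul_of_nonneg_left h7 hs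
  have h10 : w * ((1 - ζ) * s) ≤ s * w := by nlinarith [mul_nonneg hs hw0]
  have h11 : (1 + 2 / ζ) * (Γ + R) = Γ + R + 2 * ((Γ + R) / ζ) := by ring
  rw [h8, h11]
  linarith

end Ellipsoid

/-! ### Density of the parameters with an essentially unique optimal action -/

section Density

/-- The support function of the features is Lipschitz, hence differentiable almost everywhere by
Rademacher. Where it is differentiable, its gradient equals the feature of every maximiser, so all
maximisers share one feature. -/
theorem dense_unique_optimal (G : Game A Z d m) (z : Z) :
    Dense {θ : Vec d | ∃ a, G.IsOptimal z θ a ∧ ∀ b, G.IsOptimal z θ b → G.φ z b = G.φ z a} := by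
  have hne : Nonempty (G.avail z) := (G.avail_nonempty z).to_subtype
  obtain ⟨K, hK⟩ := (G.avail_compact z).bddAbove_image (f := fun b => ‖G.φ z b‖)
    (by have := G.φ_continuous z; fun_prop)
  have hK' : ∀ b ∈ G.avail z, ‖G.φ z b‖ ≤ max K 0 := fun b hb =>
    (hK (Set.mem_image_of_mem _ hb)).trans (le_max_left _ _)
  let h : Vec d → ℝ := fun θ => ⨆ b : G.avail z, inner ℝ (G.φ z b) θ
  have hbdd : ∀ θ, BddAbove (Set.range fun b : G.avail z => (inner ℝ (G.φ z b) θ : ℝ)) := by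
    intro θ
    have := (G.avail_compact z).bddAbove_image (f := fun b => (inner ℝ (G.φ z b) θ : ℝ))
      (by have := G.φ_continuous z; fun_prop)
    rwa [Set.image_eq_range] at this
  have hlip : LipschitzWith (Real.toNNReal (max K 0)) h := by
    refine LipschitzWith.of_le_add_mul _ fun θ θ' => ciSup_le fun b => ?_
    have h1 : inner ℝ (G.φ z b) θ' ≤ h θ' := le_ciSup (hbdd θ') b
    have h2 : inner ℝ (G.φ z b) (θ - θ') ≤ max K 0 * ‖θ - θ'‖ :=
      (real_inner_le_norm _ _).trans (mul_le_mul_of_nonneg_right (hK' b b.2) (norm_nonneg _))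
    rw [inner_sub_right] at h2
    rw [Real.coe_toNNReal _ (le_max_right _ _), dist_eq_norm]
    linarith
  refine (Measure.dense_of_ae (hlip.ae_differentiableAt (μ := volume))).mono ?_
  intro θ hθ
  have hopt : ∀ a, G.IsOptimal z θ a → fderiv ℝ h θ = innerSL ℝ (G.φ z a) := by
    intro a ha
    have hmin : IsLocalMin (fun θ' => h θ' - innerSL ℝ (G.φ z a) θ') θ := by
      refine Filter.Eventually.of_forall fun θ' => ?_
      have h1 : inner ℝ (G.φ z a) θ' ≤ h θ' := le_ciSup (hbdd θ') ⟨a, ha.1⟩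
      have h2 : h θ ≤ inner ℝ (G.φ z a) θ := ciSup_le fun b => ha.2 b b.2
      simp only [innerSL_apply_apply]
      linarith
    have h0 := hmin.fderiv_eq_zero
    rw [fderiv_fun_sub hθ (innerSL ℝ (G.φ z a)).differentiableAt,
      ContinuousLinearMap.fderiv] at h0
    exact sub_eq_zero.1 h0
  obtain ⟨a, ha⟩ := G.exists_isOptimal z θ
  refine ⟨a, ha, fun b hb => ?_⟩
  have := (hopt b hb).symm.trans (hopt a ha)
  exact ext_inner_right ℝ fun v => by
    simpa using congrArg (fun f => f v) this

end Density

end Game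

/-! ### Minimisers of the information ratio -/

section Ratio

/-- Clears the denominators under the conventions 0/0 = 0 and x/0 = ∞; the cross-multiplied form
holds even when a denominator vanishes. -/
theorem sq_mul_le_of_ratio_le {x y x' y' : ℝ} (hx : 0 ≤ x) (hy : 0 ≤ y) (hx' : 0 ≤ x')
    (hy' : 0 ≤ y') (h : ENNReal.ofReal x ^ 2 / ENNReal.ofReal y ≤
      ENNReal.ofReal x' ^ 2 / ENNReal.ofReal y') : x ^ 2 * y' ≤ x' ^ 2 * y := by
  rcases eq_or_lt_of_le hy' with h0' | h0'
  · rw [← h0', mul_zero]; positivity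
  rw [← ENNReal.ofReal_pow hx, ← ENNReal.ofReal_pow hx', ← ENNReal.ofReal_div_of_pos h0'] at h
  rcases eq_or_lt_of_le hy with h0 | h0
  · rcases eq_or_lt_of_le hx with h1 | h1
    · rw [← h1, ← h0]; simp
    · rw [← h0, ENNReal.ofReal_zero, ENNReal.div_zero
        (ENNReal.ofReal_pos.2 (by positivity)).ne'] at h
      exact absurd h (by simp)
  · rw [← ENNReal.ofReal_div_of_pos h0, ENNReal.ofReal_le_ofReal_iff (by positivity),
      div_le_div_iff₀ h0 h0'] at h
    exact h

/-- First order optimality of a minimiser of the information ratio. -/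
theorem ratio_optimality {x y f g : ℝ} (hx : 0 ≤ x) (hy : 0 ≤ y) (hf : 0 ≤ f)
    (h : ∀ p ∈ Set.Icc (0 : ℝ) 1,
      x ^ 2 * ((1 - p) * y + p * g) ≤ ((1 - p) * x + p * f) ^ 2 * y) :
    x * (g + y) ≤ 2 * y * f := by
  rcases eq_or_lt_of_le hx with h0 | h0
  · rw [← h0, zero_mul]; positivity
  -- Expand in p: the terms of order zero cancel, so dividing by p and letting p → 0 leaves the
  -- derivative of the ratio at μ.
  have key : x ^ 2 * (g + y) ≤ 2 * y * x * f := by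
    have hp : ∀ p ∈ Set.Ioc (0 : ℝ) 1,
        x ^ 2 * (g + y) - 2 * y * x * f ≤ p * (y * (x - f) ^ 2) := by
      intro p hp
      have h1 := h p ⟨hp.1.le, hp.2⟩
      have h2 : p * (x ^ 2 * (g + y) - 2 * y * x * f) ≤ p * (p * (y * (x - f) ^ 2)) := by
        nlinarith
      exact le_of_mul_le_mul_left h2 hp.1
    have hlim : Filter.Tendsto (fun p : ℝ => p * (y * (x - f) ^ 2))
        (nhdsWithin 0 (Set.Ioi 0)) (nhds 0) := by
      have : Filter.Tendsto (fun p : ℝ => p * (y * (x - f) ^ 2)) (nhds 0) (nhds 0) := by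
        have : Continuous fun p : ℝ => p * (y * (x - f) ^ 2) := by fun_prop
        simpa using this.tendsto 0
      exact this.mono_left nhdsWithin_le_nhds
    have := ge_of_tendsto hlim (Filter.mem_of_superset
      (Ioc_mem_nhdsGT (zero_lt_one : (0 : ℝ) < 1)) hp)
    linarith
  have : x * (x * (g + y)) ≤ x * (2 * y * f) := by nlinarith
  exact le_of_mul_le_mul_left this h0

variable {A : Type*} [MeasurableSpace A]

theorem ae_of_compl_eq_zero {S : Set A} {μ : Measure A} (h : μ Sᶜ = 0) : ∀ᵐ b ∂μ, b ∈ S := by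
  rw [ae_iff]; exact h

theorem integrable_of_bounded {S : Set A} {μ : Measure A} [IsFiniteMeasure μ] (hμS : μ Sᶜ = 0)
    {f : A → ℝ} (hf : Measurable f) {C : ℝ} (hC : ∀ a ∈ S, 0 ≤ f a ∧ f a ≤ C) :
    Integrable f μ := by
  refine Integrable.of_bound hf.aestronglyMeasurable C ?_
  filter_upwards [ae_of_compl_eq_zero hμS] with b hb
  rw [Real.norm_eq_abs, abs_of_nonneg (hC b hb).1]
  exact (hC b hb).2

/-- All three conclusions test μ against (1-p)μ + pδ_a, along which both means are affine in p.
Taking p = 1 gives the first and the third, the derivative at p = 0 the second. -/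
theorem ratio_minimizer {S : Set A} (hS : MeasurableSet S) {f g : A → ℝ}
    (hf : Measurable f) (hg : Measurable g) {Cf Cg : ℝ} (hfC : ∀ a ∈ S, 0 ≤ f a ∧ f a ≤ Cf)
    (hgC : ∀ a ∈ S, 0 ≤ g a ∧ g a ≤ Cg) {μ : Measure A} [IsProbabilityMeasure μ]
    (hμS : μ Sᶜ = 0)
    (hmin : ∀ ν : Measure A, IsProbabilityMeasure ν → ν Sᶜ = 0 →
      ENNReal.ofReal (∫ b, f b ∂μ) ^ 2 / ENNReal.ofReal (∫ b, g b ∂μ) ≤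
        ENNReal.ofReal (∫ b, f b ∂ν) ^ 2 / ENNReal.ofReal (∫ b, g b ∂ν))
    {a : A} (ha : a ∈ S) :
    (∫ b, f b ∂μ) ^ 2 * g a ≤ f a ^ 2 * ∫ b, g b ∂μ ∧
      (∫ b, f b ∂μ) * (g a + ∫ b, g b ∂μ) ≤ 2 * (∫ b, g b ∂μ) * f a ∧
      (f a = 0 → ∫ b, f b ∂μ = 0) := by
  have hSae := ae_of_compl_eq_zero hμS
  have hx : 0 ≤ ∫ b, f b ∂μ := integral_nonneg_of_ae (by
    filter_upwards [hSae] with b hb using (hfC b hb).1)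
  have hy : 0 ≤ ∫ b, g b ∂μ := integral_nonneg_of_ae (by
    filter_upwards [hSae] with b hb using (hgC b hb).1)
  have hfi := integrable_of_bounded hμS hf hfC
  have hgi := integrable_of_bounded hμS hg hgC
  have hdS : (Measure.dirac a) Sᶜ = 0 := by
    rw [Measure.dirac_apply' _ hS.compl]; simp [ha]
  have hint : ∀ {h : A → ℝ}, Measurable h → Integrable h μ → ∀ p ∈ Set.Icc (0 : ℝ) 1,
      ∫ b, h b ∂(ENNReal.ofReal (1 - p) • μ + ENNReal.ofReal p • Measure.dirac a) =
        (1 - p) * ∫ b, h b ∂μ + p * h a := by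
    intro h hh hhi p hp
    have hd : Integrable h (Measure.dirac a) := integrable_dirac' hh.stronglyMeasurable
      (by simp)
    rw [integral_add_measure (hhi.smul_measure ENNReal.ofReal_ne_top)
      (hd.smul_measure ENNReal.ofReal_ne_top), integral_smul_measure, integral_smul_measure,
      integral_dirac' _ _ hh.stronglyMeasurable, ENNReal.toReal_ofReal (by linarith [hp.2]),
      ENNReal.toReal_ofReal hp.1, smul_eq_mul, smul_eq_mul]
  have key : ∀ p ∈ Set.Icc (0 : ℝ) 1,
      ENNReal.ofReal (∫ b, f b ∂μ) ^ 2 / ENNReal.ofReal (∫ b, g b ∂μ) ≤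
        ENNReal.ofReal ((1 - p) * ∫ b, f b ∂μ + p * f a) ^ 2 /
          ENNReal.ofReal ((1 - p) * ∫ b, g b ∂μ + p * g a) := by
    intro p hp
    have h := hmin (ENNReal.ofReal (1 - p) • μ + ENNReal.ofReal p • Measure.dirac a)
      ⟨by
        simp only [Measure.add_apply, Measure.smul_apply, measure_univ, smul_eq_mul, mul_one]
        rw [← ENNReal.ofReal_add (by linarith [hp.2]) hp.1]; simp⟩
      (by simp [hμS, hdS])
    rwa [hint hf hfi p hp, hint hg hgi p hp] at h
  have key' : ∀ p ∈ Set.Icc (0 : ℝ) 1,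
      (∫ b, f b ∂μ) ^ 2 * ((1 - p) * ∫ b, g b ∂μ + p * g a) ≤
        ((1 - p) * ∫ b, f b ∂μ + p * f a) ^ 2 * ∫ b, g b ∂μ := fun p hp =>
    sq_mul_le_of_ratio_le hx hy
      (add_nonneg (mul_nonneg (by linarith [hp.2]) hx) (mul_nonneg hp.1 (hfC a ha).1))
      (add_nonneg (mul_nonneg (by linarith [hp.2]) hy) (mul_nonneg hp.1 (hgC a ha).1)) (key p hp)
  refine ⟨?_, ratio_optimality hx hy (hfC a ha).1 key', fun h0 => ?_⟩
  · simpa using key' 1 (by simp)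
  · have h := key 1 (by simp)
    rw [h0] at h
    simp only [sub_self, zero_mul, mul_zero, zero_add, ENNReal.ofReal_zero, ne_eq,
      OfNat.ofNat_ne_zero, not_false_eq_true, zero_pow, ENNReal.zero_div, nonpos_iff_eq_zero,
      ENNReal.div_eq_zero_iff, ENNReal.ofReal_ne_top, or_false] at h
    have := ENNReal.ofReal_eq_zero.1 (pow_eq_zero_iff two_ne_zero |>.1 h)
    exact le_antisymm this hx

end Ratio

/-! ### Elementary inequalities behind the regret bounds of a single round -/

section Real

/-- From log(1 + x) ≥ 2x/(x + 2). -/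
theorem le_mul_log {x U : ℝ} (hx : 0 ≤ x) (hxU : x ≤ U) :
    x ≤ (1 + U / 2) * Real.log (1 + x) := by
  have h := Real.le_log_one_add_of_nonneg hx
  rw [div_le_iff₀ (by linarith)] at h
  have h0 := Real.log_nonneg (by linarith : 1 ≤ 1 + x)
  nlinarith

/-- Here x is the trace of the information matrix of the test action, D its gap estimate and g its
gain. The factor 2 D² I is what g = x/2 would give. Bounding x by a multiple of the logarithm alone
would spoil this constant whenever U > 0; the two optimality conditions together confine the loss to
a term of second order in I. -/
theorem local_round_real {x U Δ I D g : ℝ} (hx : 0 ≤ x) (hxU : x ≤ U) (hΔ : 0 ≤ Δ)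
    (hI : 0 ≤ I) (hg : Real.log (1 + x) / 2 ≤ g) (h1 : Δ ^ 2 * g ≤ D ^ 2 * I)
    (h2 : Δ * (g + I) ≤ 2 * I * D) :
    Δ ^ 2 * x ≤ 2 * D ^ 2 * I * (1 + 4 * (1 + U / 2) ^ 2 * I) := by
  have hU : 0 ≤ U := hx.trans hxU
  set ℓ := Real.log (1 + x) with hℓ
  have hℓ0 : 0 ≤ ℓ := Real.log_nonneg (by linarith)
  have hxℓ : x ≤ (1 + x / 2) * ℓ := le_mul_log hx le_rfl
  have hxU' : x ≤ (1 + U / 2) * ℓ := le_mul_log hx hxU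
  have h1' : Δ ^ 2 * ℓ ≤ 2 * D ^ 2 * I := by nlinarith [sq_nonneg Δ]
  have h2' : Δ * ℓ ≤ 4 * I * D := by nlinarith [mul_nonneg hΔ hI]
  -- Small x: log(1 + x) ≥ x/(1 + x/2) is sharp enough in the zeroth-order condition `h1`. Large x:
  -- the first-order condition bounds Δ x by a multiple of I D, and squaring and dividing by x loses
  -- nothing above this threshold.
  rcases le_or_gt x (8 * (1 + U / 2) ^ 2 * I) with h | h
  · calc Δ ^ 2 * x ≤ Δ ^ 2 * ((1 + x / 2) * ℓ) := mul_le_mul_of_nonneg_left hxℓ (sq_nonneg _)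
      _ = (Δ ^ 2 * ℓ) * (1 + x / 2) := by ring
      _ ≤ (2 * D ^ 2 * I) * (1 + 4 * (1 + U / 2) ^ 2 * I) :=
          mul_le_mul h1' (by linarith) (by linarith) (by positivity)
      _ = _ := by ring
  · have hx0 : 0 < x := lt_of_le_of_lt (by positivity) h
    have h3 : (Δ * x) ^ 2 ≤ ((1 + U / 2) * (4 * I * D)) ^ 2 := by
      refine pow_le_pow_left₀ (by positivity) ?_ 2
      calc Δ * x ≤ Δ * ((1 + U / 2) * ℓ) := mul_le_mul_of_nonneg_left hxU' hΔ
        _ = (1 + U / 2) * (Δ * ℓ) := by ring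
        _ ≤ _ := mul_le_mul_of_nonneg_left h2' (by linarith)
    have h4 : (Δ ^ 2 * x) * x ≤ (2 * D ^ 2 * I) * x := by
      calc (Δ ^ 2 * x) * x = (Δ * x) ^ 2 := by ring
        _ ≤ ((1 + U / 2) * (4 * I * D)) ^ 2 := h3
        _ = (2 * D ^ 2 * I) * (8 * (1 + U / 2) ^ 2 * I) := by ring
        _ ≤ _ := mul_le_mul_of_nonneg_left h.le (by positivity)
    have h5 := le_of_mul_le_mul_right h4 hx0
    have h6 : 0 ≤ 2 * D ^ 2 * I * (4 * (1 + U / 2) ^ 2 * I) := by positivity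
    linarith

/-- Γ is the gap estimate of the greedy action. For Γ ≤ R the factor Γ + R is bounded by 2R and Δ ≤
2Γ turns Δ Γ² into Δ³. For Γ > R one power of Γ cancels, and min(Δ, R)³ ≤ Δ R² ≤ R Δ Γ suffices.
Truncation at R is harmless because the true gap never exceeds R. -/
theorem global_round_real {U Q R Γ Δ I β α : ℝ} (hU : 0 ≤ U) (hQ : 0 ≤ Q) (hR : 0 < R)
    (hΓ : 0 ≤ Γ) (hΔ : 0 ≤ Δ) (hI : 0 ≤ I) (hβ : 0 ≤ β) (hα : 0 ≤ α)
    (h : Δ * Γ ^ 2 ≤ 2 * (2 + U) * Q * (Γ + R) * β * α * I) (h0 : Γ = 0 → Δ = 0)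
    (h2 : Δ * I ≤ 2 * I * Γ) :
    (min Δ R) ^ 3 ≤ 16 * (2 + U) * Q * R * (α * β * I) := by
  have hP : 0 ≤ (2 + U) * Q * (α * β * I) := by positivity
  rcases eq_or_lt_of_le hΓ with hΓ0 | hΓ0
  · rw [h0 hΓ0.symm, min_eq_left hR.le]
    have := mul_nonneg hP hR.le
    nlinarith
  rcases eq_or_lt_of_le hI with hI0 | hI0
  · have : Δ = 0 := by
      rw [← hI0, mul_zero] at h
      by_contra hne
      exact absurd h (not_le.2 (mul_pos (lt_of_le_of_ne hΔ (Ne.symm hne)) (by positivity)))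
    rw [this, min_eq_left hR.le, ← hI0]; simp
  have hΔΓ : Δ ≤ 2 * Γ := by
    have : Δ * I ≤ (2 * Γ) * I := by linarith
    exact le_of_mul_le_mul_right this hI0
  have hm0 : 0 ≤ min Δ R := le_min hΔ hR.le
  rcases le_or_gt Γ R with hc | hc
  · calc (min Δ R) ^ 3 ≤ Δ ^ 3 := pow_le_pow_left₀ hm0 (min_le_left _ _) 3
      _ = Δ * Δ ^ 2 := by ring
      _ ≤ Δ * (2 * Γ) ^ 2 := mul_le_mul_of_nonneg_left (pow_le_pow_left₀ hΔ hΔΓ 2) hΔ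
      _ = 4 * (Δ * Γ ^ 2) := by ring
      _ ≤ 4 * (2 * (2 + U) * Q * (Γ + R) * β * α * I) := by linarith
      _ = 8 * ((2 + U) * Q * (α * β * I)) * (Γ + R) := by ring
      _ ≤ 8 * ((2 + U) * Q * (α * β * I)) * (2 * R) :=
          mul_le_mul_of_nonneg_left (by linarith) (by linarith)
      _ = _ := by ring
  · have h3 : Δ * Γ ≤ 4 * ((2 + U) * Q * (α * β * I)) := by
      have : (Δ * Γ) * Γ ≤ (4 * ((2 + U) * Q * (α * β * I))) * Γ := by
        calc (Δ * Γ) * Γ = Δ * Γ ^ 2 := by ring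
          _ ≤ _ := h
          _ = 2 * ((2 + U) * Q * (α * β * I)) * (Γ + R) := by ring
          _ ≤ 2 * ((2 + U) * Q * (α * β * I)) * (2 * Γ) :=
            mul_le_mul_of_nonneg_left (by linarith) (by linarith)
          _ = _ := by ring
      exact le_of_mul_le_mul_right this hΓ0
    calc (min Δ R) ^ 3 = min Δ R * (min Δ R) ^ 2 := by ring
      _ ≤ Δ * R ^ 2 := mul_le_mul (min_le_left _ _) (pow_le_pow_left₀ hm0 (min_le_right _ _) 2)
          (by positivity) hΔ
      _ ≤ R * (Δ * Γ) := by nlinarith [mul_nonneg hΔ hR.le]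
      _ ≤ R * (4 * ((2 + U) * Q * (α * β * I))) := mul_le_mul_of_nonneg_left h3 hR.le
      _ ≤ _ := by nlinarith [mul_nonneg hR.le hP]

end Real

namespace Game

variable {A Z : Type*} [TopologicalSpace A] [MeasurableSpace Z] {d m : ℕ}
  {G : Game A Z d m} {lam L : ℝ}

/-! ### Alignment -/

section Alignment

variable {V : Matrix (Fin d) (Fin d) ℝ} {c : Vec d} {s : ℝ}

theorem le_mul_of_ofReal_div_lt {p q r : ℝ} (hq : 0 ≤ q)
    (h : ENNReal.ofReal p / ENNReal.ofReal q < ENNReal.ofReal r) : p ≤ r * q := by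
  rcases eq_or_lt_of_le hq with h0 | h0
  · rw [← h0, mul_zero]
    by_contra hp
    rw [← h0, ENNReal.ofReal_zero,
      ENNReal.div_zero (ENNReal.ofReal_pos.2 (not_le.1 hp)).ne'] at h
    exact absurd h (by simp)
  · rw [← ENNReal.ofReal_div_of_pos h0] at h
    have := ((ENNReal.ofReal_lt_ofReal_iff').1 h).1.le
    rwa [div_le_iff₀ h0] at this

theorem quad_neg (W : Matrix (Fin d) (Fin d) ℝ) (v : Vec d) : quad W (-v) = quad W v := by
  simp [quad]

theorem continuous_quad (W : Matrix (Fin d) (Fin d) ℝ) : Continuous (quad W) := by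
  have h : Continuous (act W) := LinearMap.continuous_of_finiteDimensional _
  unfold quad
  fun_prop

/-- Pulling θ slightly towards the centre makes `O` meet the interior of the ellipsoid, where a
parameter with an essentially unique optimal action exists by density. Positivity of the radius
provides the interior. -/
theorem exists_plausible (G : Game A Z d m) (hV : V.PosDef) (hs : 0 < s) {θ : Vec d}
    (hθ : θ ∈ ellipsoid V c s) {O : Set (Vec d)} (hO : IsOpen O) (hθO : θ ∈ O) (z : Z) :
    ∃ θ' ∈ O, θ' ∈ ellipsoid V c s ∧ ∃ a ∈ G.plausible (ellipsoid V c s) z,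
      G.IsOptimal z θ' a := by
  have hopen : IsOpen {x : Vec d | quad V (x - c) < s ^ 2} :=
    isOpen_lt ((continuous_quad V).comp (by fun_prop)) continuous_const
  have hlim : Filter.Tendsto (fun r : ℝ => c + r • (θ - c)) (nhdsWithin 1 (Set.Iio 1))
      (nhds θ) := by
    have : Continuous fun r : ℝ => c + r • (θ - c) := by fun_prop
    have := this.tendsto 1
    rw [one_smul, add_sub_cancel] at this
    exact this.mono_left nhdsWithin_le_nhds
  obtain ⟨r, hrO, hr⟩ := ((hlim.eventually (hO.mem_nhds hθO)).and
    (Filter.mem_of_superset (Ioo_mem_nhdsLT (zero_lt_one : (0 : ℝ) < 1)) fun _ h => h)).exists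
  have hne : (O ∩ {x : Vec d | quad V (x - c) < s ^ 2}).Nonempty := by
    refine ⟨_, hrO, ?_⟩
    simp only [Set.mem_ofPred_eq, add_sub_cancel_left, quad_smul]
    have h1 : quad V (θ - c) ≤ s ^ 2 := hθ
    have h2 := quad_nonneg hV (θ - c)
    have h3 : r ^ 2 < 1 := by nlinarith [hr.1, hr.2]
    nlinarith [pow_pos hs 2, sq_nonneg r]
  obtain ⟨θ', h', a, ha, hau⟩ := (G.dense_unique_optimal z).inter_open_nonempty _
    (hO.inter hopen) hne
  have hmem : θ' ∈ ellipsoid V c s := (show quad V (θ' - c) < s ^ 2 from h'.2).le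
  exact ⟨θ', h'.1, hmem, a, ⟨⟨θ', ha, hau⟩, θ', hmem, ha⟩, ha⟩

/-- A plausible b is optimal at some θ₂ in E, and its gap exceeds σ at some θ₁ in E. After a
perturbation, θ₁ has a plausible optimal action a. In the direction ω = θ₁ - θ₂ the pair (a, b)
differs by at least σ, and the alignment constant supplies an action whose feedback sees ω. As ω has
V-norm at most 2s, the factor is 4 s². -/
theorem exists_informative_local (hV : V.PosDef) (hs : 0 < s) {z : Z} {η A' σ : ℝ}
    (hA : G.localAlignmentAt η (ellipsoid V c s) z < ENNReal.ofReal A')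
    (hσ0 : 0 ≤ σ) (hσ : σ < ⨆ b : G.plausible (ellipsoid V c s) z,
      ⨆ _θ : ellipsoid V c s, G.gap b z _θ) :
    ∃ a ∈ G.extPlausible η (ellipsoid V c s) z, σ ^ 2 ≤ 4 * s ^ 2 * A' * G.signal V a z := by
  set E := ellipsoid V c s with hE
  have : Nonempty E := ⟨⟨c, center_mem V c s⟩⟩
  have hA0 : 0 < A' := ENNReal.ofReal_pos.1 (lt_of_le_of_lt (zero_le) hA)
  obtain ⟨_, _, _, a₀, ha₀, _⟩ := exists_plausible G hV hs (center_mem V c s) isOpen_univ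
    (Set.mem_univ c) z
  have : Nonempty (G.plausible E z) := ⟨⟨a₀, ha₀⟩⟩
  have hav : Nonempty (G.avail z) := (G.avail_nonempty z).to_subtype
  obtain ⟨⟨b, hb⟩, hb1⟩ := exists_lt_of_lt_ciSup hσ
  obtain ⟨⟨θ, hθ⟩, hθ1⟩ := exists_lt_of_lt_ciSup hb1
  obtain ⟨⟨b', hb'⟩, hb1'⟩ := exists_lt_of_lt_ciSup hθ1
  obtain ⟨θ₁, hθ₁O, hθ₁E, a, ha, hopt⟩ := exists_plausible G hV hs hθ
    (O := {x | σ < inner ℝ (G.φ z b' - G.φ z b) x})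
    (isOpen_lt continuous_const (by fun_prop)) hb1' z
  obtain ⟨θ₂, hθ₂E, hopt₂⟩ := hb.2
  have h1 : σ < inner ℝ (G.φ z a - G.φ z b) θ₁ := by
    have := hopt.2 b' hb'
    have h' : σ < inner ℝ (G.φ z b' - G.φ z b) θ₁ := hθ₁O
    rw [inner_sub_left] at h' ⊢
    linarith
  have h2 := hopt₂.inner_sub_nonpos (b := a) hopt.1
  set ω := θ₁ - θ₂ with hω
  have h3 : σ ≤ inner ℝ (G.φ z a - G.φ z b) ω := by rw [hω, inner_sub_right]; linarith
  have h4 : √(quad V ω) ≤ 2 * s := by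
    have e : ω = (θ₁ - c) + -(θ₂ - c) := by rw [hω]; abel
    rw [e]
    refine (sqrt_quad_add_le hV _ _).trans ?_
    rw [quad_neg]
    linarith [sqrt_quad_le_of_mem hs.le hθ₁E, sqrt_quad_le_of_mem hs.le hθ₂E]
  have h5 : quad V ω ≤ (2 * s) ^ 2 := by
    rw [← Real.sq_sqrt (quad_nonneg hV ω)]
    exact pow_le_pow_left₀ (Real.sqrt_nonneg _) h4 2
  have h6 : ⨅ a' ∈ G.extPlausible η E z, G.costToSignal z a b a' ω < ENNReal.ofReal A' := by
    refine lt_of_le_of_lt ?_ hA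
    refine le_trans ?_ (le_iSup _ ω)
    exact le_trans (le_iSup₂ (f := fun b (_ : b ∈ G.plausible E z) =>
      ⨅ c ∈ G.extPlausible η E z, G.costToSignal z a b c ω) b hb) (le_iSup₂ (f := fun a
        (_ : a ∈ G.plausible E z) => ⨆ b ∈ G.plausible E z, ⨅ c ∈ G.extPlausible η E z,
          G.costToSignal z a b c ω) a ha)
  simp only [iInf_lt_iff] at h6
  obtain ⟨a', ha', h7⟩ := h6
  refine ⟨a', ha', ?_⟩
  have h8 := le_mul_of_ofReal_div_lt (sq_nonneg _) h7
  have h9 := norm_act_sq_le hV (G.M z a') ω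
  have h10 := signal_nonneg (G := G) hV a' z
  calc σ ^ 2 ≤ (inner ℝ (G.φ z a - G.φ z b) ω : ℝ) ^ 2 := pow_le_pow_left₀ hσ0 h3 2
    _ ≤ A' * ‖act (G.M z a') ω‖ ^ 2 := h8
    _ ≤ A' * (G.signal V a' z * (2 * s) ^ 2) :=
        mul_le_mul_of_nonneg_left (h9.trans (mul_le_mul_of_nonneg_left h5 h10)) hA0.le
    _ = _ := by ring

/-- The global constant compares only Pareto optimal actions, but its parameters are unrestricted.
Replacing b by a near maximiser for ϑ and a by a near maximiser for -ϑ gives Pareto optimal actions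
at the cost of δ each, with 2δ equal to the available slack. -/
theorem exists_informative_global {z : Z} {a b : A} (ha : a ∈ G.avail z) (hb : b ∈ G.avail z)
    {ϑ : Vec d} {A' σ : ℝ} (hA : G.globalAlignment z < ENNReal.ofReal A') (hσ0 : 0 ≤ σ)
    (hσ : σ < inner ℝ (G.φ z b - G.φ z a) ϑ) :
    ∃ a' ∈ G.avail z, σ ^ 2 ≤ A' * ‖act (G.M z a') ϑ‖ ^ 2 := by
  set g := inner ℝ (G.φ z b - G.φ z a) ϑ with hg
  set δ := (g - σ) / 2 with hδ
  have hδ0 : 0 < δ := by rw [hδ]; linarith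
  obtain ⟨K, hK0, hK⟩ : ∃ K : ℝ, 0 ≤ K ∧ ∀ a₁ ∈ G.avail z, ‖G.φ z a₁‖ ≤ K := by
    obtain ⟨K, hK⟩ := (G.avail_compact z).bddAbove_image (f := fun b => ‖G.φ z b‖)
      (by have := G.φ_continuous z; fun_prop)
    exact ⟨K, (norm_nonneg _).trans (hK (Set.mem_image_of_mem _ ha)),
      fun a₁ h₁ => hK (Set.mem_image_of_mem _ h₁)⟩
  have key : ∀ (b : A) (_ : b ∈ G.avail z) (ϑ : Vec d), ∃ b₁ ∈ G.pareto z,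
      inner ℝ (G.φ z b) ϑ - δ ≤ inner ℝ (G.φ z b₁) ϑ := by
    intro b hb ϑ
    obtain ⟨ϑ', h', b₁, hb₁, hu⟩ := (G.dense_unique_optimal z).inter_open_nonempty
      (Metric.ball ϑ (δ / (2 * K + 1))) Metric.isOpen_ball
      ⟨ϑ, Metric.mem_ball_self (by positivity)⟩
    refine ⟨b₁, ⟨ϑ', hb₁, hu⟩, ?_⟩
    have h1 := hb₁.inner_sub_nonpos hb
    have h2 : |inner ℝ (G.φ z b - G.φ z b₁) (ϑ - ϑ')| ≤ (2 * K) * (δ / (2 * K + 1)) := by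
      refine (abs_real_inner_le_norm _ _).trans (mul_le_mul ?_ ?_ (norm_nonneg _) (by positivity))
      · exact (norm_sub_le _ _).trans (by linarith [hK b hb, hK b₁ hb₁.1])
      · rw [← dist_eq_norm, dist_comm]; exact le_of_lt h'
    have h3 : (2 * K) * (δ / (2 * K + 1)) ≤ δ := by
      rw [mul_div_assoc', div_le_iff₀ (by positivity)]; nlinarith
    have h4 := (le_abs_self _).trans (h2.trans h3)
    rw [inner_sub_right] at h4
    rw [inner_sub_left] at h1
    simp only [inner_sub_left] at h4
    linarith
  obtain ⟨b₁, hb₁, h1⟩ := key b hb ϑ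
  obtain ⟨a₁, ha₁, h2⟩ := key a ha (-ϑ)
  rw [inner_neg_right, inner_neg_right] at h2
  have h3 : σ ≤ inner ℝ (G.φ z b₁ - G.φ z a₁) ϑ := by
    rw [inner_sub_left] at hg ⊢
    linarith
  have h6 : ⨅ a' ∈ G.avail z, G.costToSignal z b₁ a₁ a' ϑ < ENNReal.ofReal A' := by
    refine lt_of_le_of_lt ?_ hA
    refine le_trans ?_ (le_iSup _ ϑ)
    exact le_trans (le_iSup₂ (f := fun b (_ : b ∈ G.pareto z) =>
      ⨅ c ∈ G.avail z, G.costToSignal z b₁ b c ϑ) a₁ ha₁) (le_iSup₂ (f := fun a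
        (_ : a ∈ G.pareto z) => ⨆ b ∈ G.pareto z, ⨅ c ∈ G.avail z,
          G.costToSignal z a b c ϑ) b₁ hb₁)
  simp only [iInf_lt_iff] at h6
  obtain ⟨a', ha', h7⟩ := h6
  exact ⟨a', ha', (pow_le_pow_left₀ hσ0 h3 2).trans
    (le_mul_of_ofReal_div_lt (sq_nonneg _) h7)⟩

/-- Passage to the limit σ ↑ S and A' ↓ α: suprema and infima in the alignment constants need not be
attained, so the bounds are first proved with strict slack. -/
theorem le_of_forall_lt_of_gt {x α S : ℝ} {f : ℝ → ℝ → ℝ} (hf : Continuous (Function.uncurry f))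
    (hS : 0 < S) (h : ∀ σ A', 0 < σ → σ < S → α < A' → x ≤ f σ A' ) : x ≤ f S α := by
  have h1 : Filter.Tendsto (fun ε : ℝ => f (S - ε) (α + ε)) (nhdsWithin 0 (Set.Ioi 0))
      (nhds (f S α)) := by
    have : Continuous fun ε : ℝ => f (S - ε) (α + ε) :=
      hf.comp (by fun_prop : Continuous fun ε : ℝ => (S - ε, α + ε))
    have := this.tendsto 0
    simp only [sub_zero, add_zero] at this
    exact this.mono_left nhdsWithin_le_nhds
  refine ge_of_tendsto h1 (Filter.mem_of_superset (Ioo_mem_nhdsGT hS) fun ε hε => ?_)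
  exact h _ _ (by linarith [hε.2]) (by linarith [hε.1]) (by linarith [hε.1])

/-- In the globally observable case the gap is controlled by the alignment constant. -/
theorem gap_sq_le_globalAlignment (hB : G.Bounded L) {z : Z} {a : A} (ha : a ∈ G.avail z)
    (hα : G.globalAlignment z ≠ ⊤) (θ : Vec d) :
    G.gap a z θ ^ 2 ≤ ‖θ‖ ^ 2 * L ^ 2 * (G.globalAlignment z).toReal := by
  have hα0 : 0 ≤ (G.globalAlignment z).toReal := ENNReal.toReal_nonneg
  have key : ∀ b ∈ G.avail z,
      ‖G.φ z b - G.φ z a‖ ^ 2 ≤ L ^ 2 * (G.globalAlignment z).toReal := by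
    intro b hb
    set v := G.φ z b - G.φ z a with hv
    rcases eq_or_lt_of_le (norm_nonneg v) with h0 | h0
    · rw [← h0]; simp; positivity
    have h1 : 0 ≤ L ^ 2 * (G.globalAlignment z).toReal * ‖v‖ ^ 2 - (‖v‖ ^ 2) ^ 2 := by
      refine le_of_forall_lt_of_gt (f := fun σ A' => L ^ 2 * A' * ‖v‖ ^ 2 - σ ^ 2)
        (α := (G.globalAlignment z).toReal) (S := ‖v‖ ^ 2)
        (by unfold Function.uncurry; fun_prop) (by positivity) fun σ A' hσ0 hσ hA => ?_
      -- The direction is the feature difference v itself. With ‖M v‖ ≤ L ‖v‖ this gives ‖v‖⁴ ≤ α L²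
      -- ‖v‖² in the limit.
      obtain ⟨a', ha', h⟩ := exists_informative_global ha hb (ϑ := v) (A' := A') (σ := σ)
        ((ENNReal.lt_ofReal_iff_toReal_lt hα).2 hA) hσ0.le
        (by rw [← hv, real_inner_self_eq_norm_sq]; exact hσ)
      have h2 := pow_le_pow_left₀ (norm_nonneg _) ((hB z a' ha').2 v) 2
      have h3 := mul_le_mul_of_nonneg_left h2 (hα0.trans hA.le)
      nlinarith
    have h2 : ‖v‖ ^ 2 * ‖v‖ ^ 2 ≤ (L ^ 2 * (G.globalAlignment z).toReal) * ‖v‖ ^ 2 := by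
      nlinarith
    exact le_of_mul_le_mul_right h2 (by positivity)
  have h1 : G.gap a z θ ≤ √(L ^ 2 * (G.globalAlignment z).toReal) * ‖θ‖ := by
    refine gap_le fun b hb => (real_inner_le_norm _ _).trans ?_
    exact mul_le_mul_of_nonneg_right (Real.le_sqrt_of_sq_le (key b hb)) (norm_nonneg _)
  have h2 := pow_le_pow_left₀ (gap_nonneg ha θ) h1 2
  rw [mul_pow, Real.sq_sqrt (by positivity)] at h2
  linarith

end Alignment

/-! ### Conditional IDS in a single round -/

section Round

variable {V : Matrix (Fin d) (Fin d) ℝ} {c : Vec d} {s : ℝ}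

theorem continuous_gapEstimate (G : Game A Z d m) (hV : V.PosDef) (hs : 0 ≤ s) (z : Z) :
    Continuous fun a => G.gapEstimate (ellipsoid V c s) a z := by
  have h := (G.avail_compact z).continuous_sSup (f := fun a b : A =>
    (inner ℝ (G.φ z b - G.φ z a) c + s * dualNorm V (G.φ z b - G.φ z a) : ℝ))
    (by have := G.φ_continuous z; have := continuous_dualNorm V; fun_prop)
  convert h using 2 with a
  rw [gapEstimate_ellipsoid hV hs, sSup_image']

theorem continuous_infoGain (G : Game A Z d m) (hV : V.PosDef) (z : Z) :
    Continuous fun a => G.infoGain V a z := by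
  have h : Continuous fun a => (1 + G.M z a * V⁻¹ * (G.M z a)ᵀ).det := by
    have := G.M_continuous z
    fun_prop
  unfold infoGain
  refine continuous_const.mul (h.log fun a => ?_)
  have h1 := one_add_trace_le_det (infoMatrix_posSemidef hV (G.M z a))
  have h0 := (infoMatrix_posSemidef hV (G.M z a)).trace_nonneg
  linarith

theorem infoGain_le_const (hlam : 0 < lam) (hV : V.PosDef)
    (hVl : ∀ v, lam * ‖v‖ ^ 2 ≤ quad V v) (hB : G.Bounded L) {a : A} {z : Z} (ha : a ∈ G.avail z) :
    G.infoGain V a z ≤ d * L ^ 2 / lam / 2 := by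
  linarith [infoGain_le (G := G) hV a z, signal_le hlam hV hVl hB ha]

/-- For an action g that is optimal at the centre, ⟨φ_b - φ_g, c⟩ ≤ 0, so its gap estimate comes
from the confidence bonus alone. -/
theorem exists_greedy (G : Game A Z d m) (hV : V.PosDef) (hs : 0 ≤ s) (c : Vec d) (z : Z) :
    ∃ g ∈ G.avail z, ∀ σ < G.gapEstimate (ellipsoid V c s) g z, ∃ b ∈ G.avail z,
      σ < s * dualNorm V (G.φ z b - G.φ z g) := by
  obtain ⟨g, hg⟩ := G.exists_isOptimal z c
  refine ⟨g, hg.1, fun σ hσ => ?_⟩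
  by_contra hcon
  push Not at hcon
  refine absurd hσ (not_lt.2 (gapEstimate_le hV hs fun b hb => ?_))
  linarith [hg.inner_sub_nonpos hb, hcon b hb]

variable [MeasurableSpace A] {z : Z} {μ : Measure A}

theorem IsIDS.integral_gapEstimate_nonneg (hV : V.PosDef) (hs : 0 ≤ s) {E : Set (Vec d)}
    {W : Matrix (Fin d) (Fin d) ℝ} (h : G.IsIDS E W z μ) :
    0 ≤ ∫ b, G.gapEstimate (ellipsoid V c s) b z ∂μ :=
  integral_nonneg_of_ae (by
    filter_upwards [ae_of_compl_eq_zero h.2.1] with b hb using gapEstimate_nonneg hV hs hb)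

theorem integral_infoGain_nonneg (hV : V.PosDef) : 0 ≤ ∫ b, G.infoGain V b z ∂μ :=
  integral_nonneg fun b => infoGain_nonneg hV b z

variable [T2Space A] [BorelSpace A]

theorem IsIDS.optimality (hlam : 0 < lam) (hV : V.PosDef)
    (hVl : ∀ v, lam * ‖v‖ ^ 2 ≤ quad V v) (hs : 0 ≤ s) (hB : G.Bounded L)
    (h : G.IsIDS (ellipsoid V c s) V z μ) {a : A} (ha : a ∈ G.avail z) :
    (∫ b, G.gapEstimate (ellipsoid V c s) b z ∂μ) ^ 2 * G.infoGain V a z ≤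
        G.gapEstimate (ellipsoid V c s) a z ^ 2 * ∫ b, G.infoGain V b z ∂μ ∧
      (∫ b, G.gapEstimate (ellipsoid V c s) b z ∂μ) *
          (G.infoGain V a z + ∫ b, G.infoGain V b z ∂μ) ≤
        2 * (∫ b, G.infoGain V b z ∂μ) * G.gapEstimate (ellipsoid V c s) a z ∧
      (G.gapEstimate (ellipsoid V c s) a z = 0 →
        ∫ b, G.gapEstimate (ellipsoid V c s) b z ∂μ = 0) := by
  have := h.1
  exact ratio_minimizer (G.avail_compact z).measurableSet
    (G.continuous_gapEstimate hV hs z).measurable (G.continuous_infoGain hV z).measurable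
    (fun a ha => ⟨gapEstimate_nonneg hV hs ha, gapEstimate_le_const hlam hV hVl hs hB ha⟩)
    (fun a ha => ⟨infoGain_nonneg hV a z, infoGain_le_const hlam hV hVl hB ha⟩) h.2.1 h.2.2 ha

/-- With S the largest gap estimate of a plausible action, the test action has S² ≤ 4 s² α_η ·
signal (in the limit) and gap estimate at most η S. `local_round_real` contributes the further
factor 2, hence 8, and S cancels. -/
theorem IsIDS.local_bound_at (hlam : 0 < lam) (hV : V.PosDef)
    (hVl : ∀ v, lam * ‖v‖ ^ 2 ≤ quad V v) (hs : 0 < s) (hB : G.Bounded L)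
    (h : G.IsIDS (ellipsoid V c s) V z μ) {η : ℝ} (hη : 0 < η)
    (hα : G.localAlignmentAt η (ellipsoid V c s) z ≠ ⊤) :
    (∫ b, G.gapEstimate (ellipsoid V c s) b z ∂μ) ^ 2 ≤
      η ^ 2 * (G.localAlignmentAt η (ellipsoid V c s) z).toReal * (8 * s ^ 2 *
        ((∫ b, G.infoGain V b z ∂μ) * (1 + 4 * (1 + d * L ^ 2 / lam / 2) ^ 2 *
          ∫ b, G.infoGain V b z ∂μ))) := by
  have hI := integral_infoGain_nonneg (G := G) (z := z) (μ := μ) hV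
  have hΔ := h.integral_gapEstimate_nonneg (c := c) hV hs.le
  have hopt := fun a ha => h.optimality hlam hV hVl hs.le hB (a := a) ha
  set Δ := ∫ b, G.gapEstimate (ellipsoid V c s) b z ∂μ
  set I := ∫ b, G.infoGain V b z ∂μ
  set E := ellipsoid V c s with hE
  set α := (G.localAlignmentAt η E z).toReal with hαdef
  have hα0 : 0 ≤ α := ENNReal.toReal_nonneg
  set S := ⨆ b : G.plausible E z, ⨆ θ : E, G.gap b z θ with hS
  obtain ⟨_, _, _, a₀, ha₀, hopt₀⟩ := exists_plausible G hV hs (center_mem V c s) isOpen_univ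
    (Set.mem_univ c) z
  have hle : G.gapEstimate E a₀ z ≤ S := by
    rw [← iSup_gap_ellipsoid hV hs.le]
    refine le_ciSup (f := fun b : G.plausible E z => ⨆ θ : E, G.gap b z θ) ?_ ⟨a₀, ha₀⟩
    refine ⟨‖c‖ + s / √lam, ?_⟩
    rintro _ ⟨⟨b, hb⟩, rfl⟩
    simp only
    rw [iSup_gap_ellipsoid hV hs.le]
    obtain ⟨_, _, ho⟩ := hb.2
    exact gapEstimate_le_const hlam hV hVl hs.le hB ho.1
  have hS0 : 0 ≤ S := (gapEstimate_nonneg hV hs.le hopt₀.1).trans hle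
  -- S = 0 cannot be cancelled. Then some available action has zero gap estimate, and a minimiser of
  -- the ratio must do equally well.
  rcases eq_or_lt_of_le hS0 with hS0 | hS0
  · have h0 : G.gapEstimate E a₀ z = 0 :=
      le_antisymm (hS0 ▸ hle) (gapEstimate_nonneg hV hs.le hopt₀.1)
    rw [(hopt a₀ hopt₀.1).2.2 h0]
    simp only [ne_eq, OfNat.ofNat_ne_zero, not_false_eq_true, zero_pow]
    positivity
  set K := 4 * (1 + d * L ^ 2 / lam / 2) ^ 2 with hK
  have hK0 : 0 ≤ K := by positivity
  have key : 0 ≤ 4 * s ^ 2 * α * (2 * (η * S) ^ 2 * I * (1 + K * I)) - Δ ^ 2 * S ^ 2 := by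
    refine le_of_forall_lt_of_gt
      (f := fun σ A' => 4 * s ^ 2 * A' * (2 * (η * S) ^ 2 * I * (1 + K * I)) - Δ ^ 2 * σ ^ 2)
      (by unfold Function.uncurry; fun_prop) hS0 fun σ A' hσ0 hσ hA => ?_
    obtain ⟨a, ha, hsig⟩ := exists_informative_local hV hs (η := η) (A' := A')
      ((ENNReal.lt_ofReal_iff_toReal_lt hα).2 hA) hσ0.le hσ
    have hD : G.gapEstimate E a z ≤ η * S := by
      rw [← iSup_gap_ellipsoid hV hs.le]; exact ha.2
    obtain ⟨h1, h2, -⟩ := hopt a ha.1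
    have hD0 : 0 ≤ G.gapEstimate E a z := gapEstimate_nonneg hV hs.le ha.1
    have h3 := local_round_real (signal_nonneg (G := G) hV a z) (signal_le hlam hV hVl hB ha.1)
      hΔ hI (le_infoGain hV a z) h1 h2
    have h4 : Δ ^ 2 * G.signal V a z ≤ 2 * (η * S) ^ 2 * I * (1 + K * I) := by
      refine h3.trans ?_
      have := pow_le_pow_left₀ hD0 hD 2
      gcongr
    have hA0 : 0 ≤ A' := hα0.trans hA.le
    have h5 := mul_le_mul_of_nonneg_left hsig (sq_nonneg Δ)
    have h6 := mul_le_mul_of_nonneg_left h4 (by positivity : 0 ≤ 4 * s ^ 2 * A')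
    linarith
  have h7 : Δ ^ 2 * S ^ 2 ≤ (η ^ 2 * α * (8 * s ^ 2 * (I * (1 + K * I)))) * S ^ 2 := by
    linarith
  exact le_of_mul_le_mul_right h7 (by positivity)

/-- The information ratio of conditional IDS is controlled by the local alignment constant, up to
a factor that tends to one as the expected information gain of the round vanishes. -/
theorem IsIDS.local_bound (hlam : 0 < lam) (hV : V.PosDef)
    (hVl : ∀ v, lam * ‖v‖ ^ 2 ≤ quad V v) (hs : 0 ≤ s) (hB : G.Bounded L)
    (h : G.IsIDS (ellipsoid V c s) V z μ)
    (hα : G.localAlignment (ellipsoid V c s) z ≠ ⊤) :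
    (∫ b, G.gapEstimate (ellipsoid V c s) b z ∂μ) ^ 2 ≤
      (G.localAlignment (ellipsoid V c s) z).toReal * (8 * s ^ 2 *
        ((∫ b, G.infoGain V b z ∂μ) * (1 + 4 * (1 + d * L ^ 2 / lam / 2) ^ 2 *
          ∫ b, G.infoGain V b z ∂μ))) := by
  have hI := integral_infoGain_nonneg (G := G) (z := z) (μ := μ) hV
  -- For radius zero the ellipsoid has no interior and the greedy action has gap estimate zero,
  -- which forces the mean gap estimate to vanish.
  rcases eq_or_lt_of_le hs with h0 | hs0
  · obtain ⟨g, hg, hg'⟩ := G.exists_greedy hV hs c z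
    have hg0 : G.gapEstimate (ellipsoid V c s) g z = 0 := by
      refine le_antisymm (le_of_not_gt fun hlt => ?_) (gapEstimate_nonneg hV hs hg)
      obtain ⟨b, -, hb⟩ := hg' 0 hlt
      rw [← h0, zero_mul] at hb
      exact lt_irrefl _ hb
    rw [(h.optimality hlam hV hVl hs hB hg).2.2 hg0]
    simp only [ne_eq, OfNat.ofNat_ne_zero, not_false_eq_true, zero_pow]
    positivity
  have key := fun η hη hα => h.local_bound_at hlam hV hVl hs0 hB (η := η) hη hα
  set E := ellipsoid V c s
  set Δ := ∫ b, G.gapEstimate E b z ∂μ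
  set I := ∫ b, G.infoGain V b z ∂μ
  set C := 8 * s ^ 2 * (I * (1 + 4 * (1 + d * L ^ 2 / lam / 2) ^ 2 * I)) with hC
  have hC0 : 0 ≤ C := by positivity
  obtain ⟨η, hη, hfin⟩ : ∃ η, 0 < η ∧ G.localAlignmentAt η E z ≠ ⊤ := by
    by_contra hcon
    push Not at hcon
    refine hα ?_
    rw [localAlignment]
    refine iInf_eq_top.2 fun η => iInf_eq_top.2 fun hη => ?_
    rw [hcon η hη, ENNReal.mul_top (ENNReal.ofReal_pos.2 (by positivity)).ne']
  rcases eq_or_lt_of_le hC0 with hC1 | hC1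
  · have := key η hη hfin
    rw [← hC1] at this ⊢
    simpa using this
  · rw [← div_le_iff₀ hC1]
    -- The infimum over η is taken in [0, ∞]; values of η with infinite constant satisfy the bound
    -- trivially since η² > 0.
    have : ENNReal.ofReal (Δ ^ 2 / C) ≤ G.localAlignment E z := by
      refine le_iInf₂ fun η hη => ?_
      by_cases hf : G.localAlignmentAt η E z = ⊤
      · rw [hf, ENNReal.mul_top (ENNReal.ofReal_pos.2 (by positivity)).ne']; exact le_top
      · rw [← ENNReal.ofReal_toReal hf, ← ENNReal.ofReal_mul (by positivity)]
        refine ENNReal.ofReal_le_ofReal ?_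
        rw [div_le_iff₀ hC1]
        exact key η hη hf
    exact (ENNReal.ofReal_le_iff_le_toReal hα).1 this

/-- The regret of conditional IDS in a round is controlled by the global alignment constant. -/
theorem IsIDS.global_bound (hlam : 0 < lam) (hV : V.PosDef)
    (hVl : ∀ v, lam * ‖v‖ ^ 2 ≤ quad V v) (hs : 0 ≤ s) (hB : G.Bounded L)
    (h : G.IsIDS (ellipsoid V c s) V z μ) (hα : G.globalAlignment z ≠ ⊤) {Q R : ℝ}
    (hQ : 0 ≤ Q) (hR : 0 < R)
    (hQR : ∀ g ∈ G.avail z, ∀ a ∈ G.avail z, G.gapEstimate (ellipsoid V c s) a z ≤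
      Q * (G.gapEstimate (ellipsoid V c s) g z + R)) :
    (min (∫ b, G.gapEstimate (ellipsoid V c s) b z ∂μ) R) ^ 3 ≤
      16 * (2 + d * L ^ 2 / lam) * Q * R *
        ((G.globalAlignment z).toReal * s ^ 2 * ∫ b, G.infoGain V b z ∂μ) := by
  have hI := integral_infoGain_nonneg (G := G) (z := z) (μ := μ) hV
  have hΔ := h.integral_gapEstimate_nonneg (c := c) hV hs
  have hopt := fun a ha => h.optimality hlam hV hVl hs hB (a := a) ha
  obtain ⟨g, hg, hg'⟩ := G.exists_greedy hV hs c z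
  have hΓ : 0 ≤ G.gapEstimate (ellipsoid V c s) g z := gapEstimate_nonneg hV hs hg
  have hQR' := hQR g hg
  obtain ⟨-, hg2, hg0⟩ := hopt g hg
  set Δ := ∫ b, G.gapEstimate (ellipsoid V c s) b z ∂μ
  set I := ∫ b, G.infoGain V b z ∂μ
  set Γ := G.gapEstimate (ellipsoid V c s) g z
  set α := (G.globalAlignment z).toReal with hαdef
  set U := d * L ^ 2 / lam with hU
  have hU0 : 0 ≤ U := by positivity
  have hα0 : 0 ≤ α := ENNReal.toReal_nonneg
  refine global_round_real hU0 hQ hR hΓ hΔ hI (sq_nonneg s) hα0 ?_ hg0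
    (by nlinarith [mul_nonneg hΔ (infoGain_nonneg (G := G) hV g z)])
  rcases eq_or_lt_of_le hΓ with h0 | hΓ0
  · rw [hg0 h0.symm, zero_mul]; positivity
  -- The action b attaining the bonus of g defines a unit dual direction ϑ with ⟨φ_b - φ_g, ϑ⟩ >
  -- σ/s. Alignment in direction ϑ gives an action with I(a) at least σ² / ((2 + U) s² A'), and the
  -- first-order condition at that action bounds Δ I(a) by 2 I Q (Γ + R).
  have key : 0 ≤ 2 * (2 + U) * Q * (Γ + R) * s ^ 2 * α * I - Δ * Γ ^ 2 := by
    refine le_of_forall_lt_of_gt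
      (f := fun σ A' => 2 * (2 + U) * Q * (Γ + R) * s ^ 2 * A' * I - Δ * σ ^ 2)
      (by unfold Function.uncurry; fun_prop) hΓ0 fun σ A' hσ0 hσ hA => ?_
    obtain ⟨b, hb, hbσ⟩ := hg' σ hσ
    have hs0 : 0 < s := by
      rcases eq_or_lt_of_le hs with h1 | h1
      · rw [← h1, zero_mul] at hbσ; linarith
      · exact h1
    obtain ⟨ϑ, hϑ, hϑw⟩ := exists_dual_direction hV (G.φ z b - G.φ z g)
    obtain ⟨a, ha, hsig⟩ := exists_informative_global hg hb (ϑ := ϑ) (A' := A') (σ := σ / s)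
      ((ENNReal.lt_ofReal_iff_toReal_lt hα).2 hA) (by positivity)
      (by rw [hϑw, div_lt_iff₀ hs0]; linarith)
    have hA0 : 0 ≤ A' := hα0.trans hA.le
    have hx0 := signal_nonneg (G := G) hV a z
    have h1 : σ ^ 2 ≤ s ^ 2 * A' * G.signal V a z := by
      rw [div_pow, div_le_iff₀ (by positivity)] at hsig
      have h2 := norm_act_sq_le hV (G.M z a) ϑ
      have h3 : ‖act (G.M z a) ϑ‖ ^ 2 ≤ G.signal V a z :=
        h2.trans (mul_le_of_le_one_right hx0 hϑ)
      calc σ ^ 2 ≤ _ := hsig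
        _ ≤ A' * G.signal V a z * s ^ 2 := by gcongr
        _ = _ := by ring
    have h2 : G.signal V a z ≤ (2 + U) * G.infoGain V a z := by
      have h3 := le_mul_log hx0 (signal_le hlam hV hVl hB ha)
      have h4 := le_infoGain (G := G) hV a z
      rw [← hU] at h3
      nlinarith
    have h3 := (hopt a ha).2.1
    have h4 : Δ * G.infoGain V a z ≤ 2 * I * (Q * (Γ + R)) := by
      have := mul_le_mul_of_nonneg_left (hQR' a ha) (by positivity : 0 ≤ 2 * I)
      nlinarith [mul_nonneg hΔ hI]
    have h5 : Δ * σ ^ 2 ≤ 2 * (2 + U) * Q * (Γ + R) * s ^ 2 * A' * I := by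
      calc Δ * σ ^ 2 ≤ Δ * (s ^ 2 * A' * ((2 + U) * G.infoGain V a z)) := by
            refine mul_le_mul_of_nonneg_left (h1.trans ?_) hΔ
            gcongr
        _ = (s ^ 2 * A' * (2 + U)) * (Δ * G.infoGain V a z) := by ring
        _ ≤ (s ^ 2 * A' * (2 + U)) * (2 * I * (Q * (Γ + R))) := by gcongr
        _ = _ := by ring
    linarith
  linarith

end Round

end Game

/-! ### Measurability -/

section MatrixMeasurability

variable {Ω : Type*} [MeasurableSpace Ω] {d m k : ℕ}

/-- Entrywise measurability of a random matrix. -/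
def EntryMeasurable (S : Ω → Matrix (Fin m) (Fin d) ℝ) : Prop := ∀ i j, Measurable fun ω => S ω i j

theorem measurable_vec {f : Ω → Vec k} (h : ∀ i, Measurable fun ω => f ω i) : Measurable f := by
  have : Measurable fun ω => (f ω).ofLp := measurable_pi_iff.2 h
  exact (WithLp.measurable_toLp 2 (Fin k → ℝ)).comp this

theorem measurable_coord {f : Ω → Vec k} (h : Measurable f) (i : Fin k) :
    Measurable fun ω => f ω i :=
  (measurable_pi_apply i).comp ((WithLp.measurable_ofLp 2 (Fin k → ℝ)).comp h)

namespace EntryMeasurable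

variable {S : Ω → Matrix (Fin m) (Fin d) ℝ}

theorem act (hS : EntryMeasurable S) {v : Ω → Vec d} (hv : Measurable v) :
    Measurable fun ω => ContextualPM.act (S ω) (v ω) := by
  refine measurable_vec fun i => ?_
  simp only [ContextualPM.act, Matrix.toLpLin_apply, Matrix.mulVec, dotProduct]
  exact Finset.measurable_fun_sum _ fun j _ => (hS i j).mul (measurable_coord hv j)

theorem transpose (hS : EntryMeasurable S) : EntryMeasurable fun ω => (S ω)ᵀ :=
  fun i j => hS j i

theorem mul (hS : EntryMeasurable S) {T : Ω → Matrix (Fin d) (Fin k) ℝ}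
    (hT : EntryMeasurable T) : EntryMeasurable fun ω => S ω * T ω := by
  intro i j
  simp only [Matrix.mul_apply]
  exact Finset.measurable_fun_sum _ fun l _ => (hS i l).mul (hT l j)

theorem add (hS : EntryMeasurable S) {T : Ω → Matrix (Fin m) (Fin d) ℝ}
    (hT : EntryMeasurable T) : EntryMeasurable fun ω => S ω + T ω :=
  fun i j => (hS i j).add (hT i j)

theorem const (T : Matrix (Fin m) (Fin d) ℝ) : EntryMeasurable fun _ : Ω => T :=
  fun _ _ => measurable_const

theorem sum {ι : Type*} (s : Finset ι) {T : ι → Ω → Matrix (Fin m) (Fin d) ℝ}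
    (hT : ∀ i ∈ s, EntryMeasurable (T i)) : EntryMeasurable fun ω => ∑ i ∈ s, T i ω := by
  intro i j
  simp only [Matrix.sum_apply]
  exact Finset.measurable_fun_sum _ fun l hl => hT l hl i j

variable {W : Ω → Matrix (Fin d) (Fin d) ℝ}

theorem det (hW : EntryMeasurable W) : Measurable fun ω => (W ω).det := by
  simp only [Matrix.det_apply]
  refine Finset.measurable_fun_sum _ fun σ _ => ?_
  exact (Finset.measurable_fun_prod _ fun i _ => hW (σ i) i).const_smul _

theorem inv (hW : EntryMeasurable W) : EntryMeasurable fun ω => (W ω)⁻¹ := by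
  intro i j
  simp only [Matrix.inv_def, Ring.inverse_eq_inv', Matrix.smul_apply, smul_eq_mul,
    Matrix.adjugate_apply]
  refine hW.det.inv.mul (det fun k l => ?_)
  simp only [Matrix.updateRow_apply]
  split_ifs
  · exact measurable_const
  · exact hW k l

theorem quad (hW : EntryMeasurable W) {v : Ω → Vec d} (hv : Measurable v) :
    Measurable fun ω => ContextualPM.quad (W ω) (v ω) :=
  hv.inner (hW.act hv)

theorem dualNorm (hW : EntryMeasurable W) {v : Ω → Vec d} (hv : Measurable v) :
    Measurable fun ω => ContextualPM.dualNorm (W ω) (v ω) :=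
  (hW.inv.quad hv).sqrt

theorem comp {Ω' : Type*} [MeasurableSpace Ω'] (hS : EntryMeasurable S) {f : Ω' → Ω}
    (hf : Measurable f) : EntryMeasurable fun ω => S (f ω) :=
  fun i j => (hS i j).comp hf

end EntryMeasurable

end MatrixMeasurability

namespace Game

variable {A Z : Type*} [TopologicalSpace A] [MeasurableSpace Z] {d m : ℕ}
  {G : Game A Z d m} {lam L : ℝ} {Ω : Type*} [MeasurableSpace Ω]

section Correspondence

variable [MeasurableSpace A] [OpensMeasurableSpace A] [SecondCountableTopology A]

/-- No measurable selection is needed. By joint continuity the supremum exceeds r at b exactly when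
some basic neighbourhoods W of b and U, with U meeting the available set, have f ≥ q > r on their
points from a countable dense set. This is a countable union of measurable conditions on ω times
open conditions on b. -/
theorem measurable_iSup_avail {z : Ω → Z} (hz : Measurable z) {f : Ω → A → A → ℝ}
    (hfm : ∀ b c, Measurable fun ω => f ω b c)
    (hfc : ∀ ω, Continuous fun p : A × A => f ω p.1 p.2) :
    Measurable fun p : Ω × A => ⨆ c : G.avail (z p.1), f p.1 p.2 c := by
  obtain ⟨D, hDc, hDd⟩ := TopologicalSpace.exists_countable_dense A
  set 𝔅 := TopologicalSpace.countableBasis A with h𝔅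
  have hbasis := TopologicalSpace.isBasis_countableBasis A
  have hcount := TopologicalSpace.countable_countableBasis A
  refine measurable_of_Ioi fun r => ?_
  have hset : (fun p : Ω × A => ⨆ c : G.avail (z p.1), f p.1 p.2 c) ⁻¹' Set.Ioi r =
      ⋃ W ∈ 𝔅, ⋃ U ∈ 𝔅, ⋃ q ∈ {q : ℚ | r < q}, ({p : Ω × A | p.2 ∈ W} ∩
        ({p : Ω × A | (G.avail (z p.1) ∩ U).Nonempty} ∩
          ⋂ b ∈ D ∩ W, ⋂ c ∈ D ∩ U, {p : Ω × A | (q : ℝ) ≤ f p.1 b c})) := by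
    ext ⟨ω, b⟩
    have hne : Nonempty (G.avail (z ω)) := (G.avail_nonempty _).to_subtype
    have hbdd : BddAbove (Set.range fun c : G.avail (z ω) => f ω b c) := by
      have := (G.avail_compact (z ω)).bddAbove_image (f := fun c => f ω b c)
        ((hfc ω).comp (by fun_prop : Continuous fun c : A => (b, c))).continuousOn
      rwa [Set.image_eq_range] at this
    simp only [Set.mem_preimage, Set.mem_Ioi, lt_ciSup_iff hbdd, Set.mem_iUnion, Set.mem_inter_iff,
      Set.mem_ofPred_eq, Set.mem_iInter, exists_prop]
    constructor
    · rintro ⟨⟨c, hc⟩, hrc⟩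
      obtain ⟨q, hq1, hq2⟩ := exists_rat_btwn hrc
      have hopen : IsOpen {p : A × A | (q : ℝ) < f ω p.1 p.2} :=
        isOpen_lt continuous_const (hfc ω)
      obtain ⟨W', U', hW', hU', hbW', hcU', hsub⟩ := isOpen_prod_iff.1 hopen b c hq2
      obtain ⟨W, hW, hbW, hWW⟩ := hbasis.exists_subset_of_mem_open hbW' hW'
      obtain ⟨U, hU, hcU, hUU⟩ := hbasis.exists_subset_of_mem_open hcU' hU'
      exact ⟨W, hW, U, hU, q, hq1, hbW, ⟨c, hc, hcU⟩, fun b' hb' c' hc' =>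
        le_of_lt (hsub (Set.mk_mem_prod (hWW hb'.2) (hUU hc'.2)))⟩
    · rintro ⟨W, hW, U, hU, q, hrq, hbW, ⟨c, hc, hcU⟩, hle⟩
      refine ⟨⟨c, hc⟩, hrq.trans_le ?_⟩
      have hWo := hbasis.isOpen hW
      have hUo := hbasis.isOpen hU
      have hcl : IsClosed {p : A × A | (q : ℝ) ≤ f ω p.1 p.2} :=
        isClosed_le continuous_const (hfc ω)
      have hmem : ((b, c) : A × A) ∈ closure ((D ∩ W) ×ˢ (D ∩ U)) := by
        rw [closure_prod_eq]
        refine Set.mk_mem_prod ?_ ?_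
        · rw [Set.inter_comm]; exact hDd.open_subset_closure_inter hWo hbW
        · rw [Set.inter_comm]; exact hDd.open_subset_closure_inter hUo hcU
      exact closure_minimal (fun p hp => hle p.1 hp.1 p.2 hp.2) hcl hmem
  rw [hset]
  refine MeasurableSet.biUnion hcount fun W hW => MeasurableSet.biUnion hcount fun U hU =>
    MeasurableSet.biUnion (Set.to_countable _) fun q _ => ?_
  refine (measurable_snd (hbasis.isOpen hW).measurableSet).inter (MeasurableSet.inter ?_ ?_)
  · exact (hz.comp measurable_fst) (G.avail_measurable U (hbasis.isOpen hU))
  · refine MeasurableSet.biInter (hDc.mono Set.inter_subset_left) fun b _ =>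
      MeasurableSet.biInter (hDc.mono Set.inter_subset_left) fun c _ => ?_
    exact measurableSet_le measurable_const ((hfm b c).comp measurable_fst)

theorem measurableSet_graph [T2Space A] {z : Ω → Z} (hz : Measurable z) :
    MeasurableSet {p : Ω × A | p.2 ∈ G.avail (z p.1)} := by
  have hbasis := TopologicalSpace.isBasis_countableBasis A
  have hcount := TopologicalSpace.countable_countableBasis A
  have hset : {p : Ω × A | p.2 ∈ G.avail (z p.1)}ᶜ =
      ⋃ U ∈ TopologicalSpace.countableBasis A, ({p : Ω × A | p.2 ∈ U} ∩
        {p : Ω × A | (G.avail (z p.1) ∩ U).Nonempty}ᶜ) := by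
    ext ⟨ω, b⟩
    simp only [Set.mem_compl_iff, Set.mem_ofPred_eq, Set.mem_iUnion, Set.mem_inter_iff, exists_prop,
      Set.not_nonempty_iff_eq_empty]
    constructor
    · intro hb
      obtain ⟨U, hU, hbU, hsub⟩ := hbasis.exists_subset_of_mem_open
        (show b ∈ (G.avail (z ω))ᶜ from hb) (G.avail_compact (z ω)).isClosed.isOpen_compl
      exact ⟨U, hU, hbU, Set.eq_empty_of_forall_notMem fun x hx => hsub hx.2 hx.1⟩
    · rintro ⟨U, hU, hbU, hemp⟩ hb
      exact absurd (hemp ▸ (⟨hb, hbU⟩ : b ∈ G.avail (z ω) ∩ U)) (Set.notMem_empty b)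
  rw [← MeasurableSet.compl_iff, hset]
  refine MeasurableSet.biUnion hcount fun U hU => ?_
  exact (measurable_snd (hbasis.isOpen hU).measurableSet).inter
    ((hz.comp measurable_fst) (G.avail_measurable U (hbasis.isOpen hU))).compl

section Gap

variable {z : Ω → Z} {V : Ω → Matrix (Fin d) (Fin d) ℝ} {c : Ω → Vec d} {s : Ω → ℝ}

theorem measurable_gap (hz : Measurable z) (θ : Vec d) :
    Measurable fun p : Ω × A => G.gap p.2 (z p.1) θ := by
  refine measurable_iSup_avail hz (f := fun ω b c => inner ℝ (G.φ (z ω) c - G.φ (z ω) b) θ)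
    (fun b c => ?_) fun ω => ?_
  · exact (((G.φ_measurable c).comp hz).sub ((G.φ_measurable b).comp hz)).inner measurable_const
  · have := G.φ_continuous (z ω)
    fun_prop

end Gap

variable [TopologicalSpace.MetrizableSpace A]

theorem entryMeasurable_M (G : Game A Z d m) :
    EntryMeasurable fun p : Z × A => G.M p.1 p.2 := by
  intro i j
  exact (measurable_uncurry_of_continuous_of_measurable (u := fun (a : A) (z : Z) => G.M z a i j)
    (fun z => (G.M_continuous z).matrix_elem i j) (fun a => G.M_measurable a i j)).comp
      measurable_swap

section History

variable {z : ℕ → Ω → Z} {a : ℕ → Ω → A} {y : ℕ → Ω → Vec m} {t : ℕ}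

theorem entryMeasurable_M_comp {z : Ω → Z} {a : Ω → A} (hz : Measurable z) (ha : Measurable a) :
    EntryMeasurable fun ω => G.M (z ω) (a ω) :=
  G.entryMeasurable_M.comp (hz.prodMk ha)

theorem entryMeasurable_covMat (hz : ∀ s ∈ Finset.Ico 1 t, Measurable (z s))
    (ha : ∀ s ∈ Finset.Ico 1 t, Measurable (a s)) :
    EntryMeasurable fun ω => G.covMat lam (fun s => z s ω) (fun s => a s ω) t :=
  (EntryMeasurable.const _).add (EntryMeasurable.sum _ fun s hs =>
    (entryMeasurable_M_comp (hz s hs) (ha s hs)).transpose.mul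
      (entryMeasurable_M_comp (hz s hs) (ha s hs)))

theorem measurable_logVol (hz : ∀ s ∈ Finset.Ico 1 t, Measurable (z s))
    (ha : ∀ s ∈ Finset.Ico 1 t, Measurable (a s)) :
    Measurable fun ω => G.logVol lam (fun s => z s ω) (fun s => a s ω) t :=
  ((entryMeasurable_covMat hz ha).det.log).sub measurable_const

end History

section Joint

variable {z : Ω → Z} {V : Ω → Matrix (Fin d) (Fin d) ℝ}

theorem measurable_infoGain (hz : Measurable z) (hV : EntryMeasurable V) :
    Measurable fun p : Ω × A => G.infoGain (V p.1) p.2 (z p.1) := by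
  have hM : EntryMeasurable fun p : Ω × A => G.M (z p.1) p.2 :=
    entryMeasurable_M_comp (hz.comp measurable_fst) measurable_snd
  exact (((EntryMeasurable.const 1).add
    ((hM.mul (hV.comp measurable_fst).inv).mul hM.transpose)).det.log).const_mul _

end Joint

end Correspondence

end Game

/-! ### Integrating out the sampled action. -/

section Transfer

variable {Ω Ω' A : Type*} [MeasurableSpace Ω] [MeasurableSpace Ω'] [MeasurableSpace A]

/-- A measurable family of measures agrees with a finite kernel at its probability measures. -/
theorem exists_kernel_eq {κ : Ω' → Measure A} (hκ : Measurable κ) :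
    ∃ K : Kernel Ω' A, IsFiniteKernel K ∧ ∀ x, IsProbabilityMeasure (κ x) → K x = κ x := by
  classical
  have hset : MeasurableSet {x | κ x Set.univ = 1} :=
    (Measure.measurable_measure.1 hκ _ MeasurableSet.univ) (measurableSet_singleton 1)
  refine ⟨⟨fun x => if κ x Set.univ = 1 then κ x else 0,
    Measurable.ite hset hκ measurable_const⟩, ⟨⟨1, ENNReal.one_lt_top, fun x => ?_⟩⟩,
    fun x hx => if_pos hx.measure_univ⟩
  change (if κ x Set.univ = 1 then κ x else 0) Set.univ ≤ 1
  split_ifs with h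
  · exact h.le
  · simp

/-- If `κ (X ω)` is the conditional law of `a` given `X`, then integrating a function of `X` and `a`
amounts to integrating out `a` first. -/
theorem lintegral_comp_of_condLaw {P : Measure Ω} [IsFiniteMeasure P] {X : Ω → Ω'}
    (hX : Measurable X) {a : Ω → A} (ha : Measurable a) {κ : Ω' → Measure A} (hκ : Measurable κ)
    (hprob : ∀ᵐ ω ∂P, IsProbabilityMeasure (κ (X ω)))
    (hlaw : ∀ T, MeasurableSet T → ∀ S, MeasurableSet S →
      P (X ⁻¹' T ∩ a ⁻¹' S) = ∫⁻ ω in X ⁻¹' T, κ (X ω) S ∂P)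
    {g : Ω' → A → ℝ≥0∞} (hg : Measurable (Function.uncurry g)) :
    ∫⁻ ω, g (X ω) (a ω) ∂P = ∫⁻ ω, ∫⁻ b, g (X ω) b ∂κ (X ω) ∂P := by
  obtain ⟨K, hKf, hK⟩ := exists_kernel_eq hκ
  have hKae : ∀ᵐ ω ∂P, K (X ω) = κ (X ω) := by
    filter_upwards [hprob] with ω hω
    exact hK _ hω
  -- The hypothesis `hlaw` identifies the joint law with the composition product on rectangles,
  -- which determine it.
  have hjoint : P.map (fun ω => (X ω, a ω)) = (P.map X) ⊗ₘ K := by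
    refine Measure.ext_prod fun {T S} hT hS => ?_
    rw [Measure.compProd_apply_prod hT hS, Measure.map_apply (hX.prodMk ha) (hT.prod hS),
      setLIntegral_map hT (K.measurable_coe hS) hX]
    refine (hlaw T hT S hS).trans (lintegral_congr_ae (ae_restrict_of_ae ?_))
    filter_upwards [hKae] with ω hω
    rw [hω]
  calc ∫⁻ ω, g (X ω) (a ω) ∂P
      = ∫⁻ p, Function.uncurry g p ∂P.map (fun ω => (X ω, a ω)) := by
        rw [lintegral_map hg (hX.prodMk ha)]; rfl
    _ = ∫⁻ ω, ∫⁻ b, g (X ω) b ∂K (X ω) ∂P := by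
        rw [hjoint, Measure.lintegral_compProd hg, lintegral_map _ hX]
        · rfl
        · exact Measurable.lintegral_kernel_prod_right' (κ := K) hg
    _ = _ := by
        refine lintegral_congr_ae ?_
        filter_upwards [hKae] with ω hω
        rw [hω]

theorem aemeasurable_lintegral_law {P : Measure Ω} {κ : Ω → Measure A} (hκ : Measurable κ)
    (hprob : ∀ᵐ ω ∂P, IsProbabilityMeasure (κ ω)) {g : Ω → A → ℝ≥0∞}
    (hg : Measurable (Function.uncurry g)) : AEMeasurable (fun ω => ∫⁻ b, g ω b ∂κ ω) P := by
  obtain ⟨K, hKf, hK⟩ := exists_kernel_eq hκ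
  refine ⟨fun ω => ∫⁻ b, g ω b ∂K ω, Measurable.lintegral_kernel_prod_right' (κ := K) hg, ?_⟩
  filter_upwards [hprob] with ω hω
  rw [hK ω hω]

end Transfer

/-- The transfer formula for conditional laws given a sub-σ-algebra. -/
theorem lintegral_of_condExp_law {Ω A : Type*} [MeasurableSpace A] {m mΩ : MeasurableSpace Ω}
    (hm : m ≤ mΩ) {P : Measure Ω} [IsFiniteMeasure P] {a : Ω → A} (ha : Measurable a)
    {κ : Ω → Measure A} (hκ : Measurable[m] κ) (hprob : ∀ᵐ ω ∂P, IsProbabilityMeasure (κ ω))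
    (hlaw : ∀ S : Set A, MeasurableSet S →
      P[(a ⁻¹' S).indicator (fun _ => (1 : ℝ)) | m] =ᵐ[P] fun ω => (κ ω).real S)
    {g : Ω → A → ℝ≥0∞} (hg : Measurable[m.prod inferInstance] (Function.uncurry g)) :
    ∫⁻ ω, g ω (a ω) ∂P = ∫⁻ ω, ∫⁻ b, g ω b ∂κ ω ∂P := by
  refine @lintegral_comp_of_condLaw Ω Ω A mΩ m _ P _ id (measurable_id'' hm) a ha κ hκ hprob ?_ g hg
  intro T hT S hS
  have hT' : MeasurableSet[mΩ] T := hm _ hT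
  have hind : Integrable ((a ⁻¹' S).indicator (fun _ => (1 : ℝ))) P :=
    (integrable_const _).indicator (ha hS)
  have h1 := setIntegral_condExp hm hind hT
  have h2 : ∫ ω in T, (κ ω).real S ∂P = (P (T ∩ a ⁻¹' S)).toReal := by
    rw [← setIntegral_congr_ae hT' ((hlaw S hS).mono fun _ h _ => h), h1,
      setIntegral_indicator (ha hS)]
    simp [Measure.real]
  have hmeas : Measurable fun ω => κ ω S :=
    (Measure.measurable_measure.1 hκ S hS).mono hm le_rfl
  have h3 : ∫ ω in T, (κ ω).real S ∂P = (∫⁻ ω in T, κ ω S ∂P).toReal := by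
    refine integral_toReal hmeas.aemeasurable (ae_restrict_of_ae ?_)
    filter_upwards [hprob] with ω hω
    exact measure_lt_top _ _
  change P (T ∩ a ⁻¹' S) = ∫⁻ ω in T, κ ω S ∂P
  refine (ENNReal.toReal_eq_toReal_iff' (measure_ne_top _ _) ?_).1 (h2.symm.trans h3)
  refine ne_top_of_le_ne_top (measure_ne_top P Set.univ) ?_
  calc ∫⁻ ω in T, κ ω S ∂P ≤ ∫⁻ ω, κ ω S ∂P := setLIntegral_le_lintegral _ _
    _ ≤ ∫⁻ _, 1 ∂P := by
      refine lintegral_mono_ae ?_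
      filter_upwards [hprob] with ω hω
      exact prob_le_one
    _ = P Set.univ := by simp

theorem exists_finite_range_approx {Ω : Type*} [MeasurableSpace Ω] {k : ℕ} {U : Ω → Vec k}
    (hU : Measurable U) : ∃ W : ℕ → Ω → Vec k, (∀ i, Measurable (W i) ∧ (Set.range (W i)).Finite) ∧
      ∀ ω, Filter.Tendsto (fun i => W i ω) Filter.atTop (nhds (U ω)) :=
  ⟨fun i => hU.stronglyMeasurable.approx i, fun _ => ⟨SimpleFunc.measurable _,
    SimpleFunc.finite_range _⟩, hU.stronglyMeasurable.tendsto_approx⟩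

/-! ### Conditional sub-Gaussianity in random directions. -/

section SubGaussian

variable {Ω : Type*} {m mΩ : MeasurableSpace Ω} {P : Measure Ω} [IsProbabilityMeasure P] {k : ℕ}
  {ε : Ω → Vec k} {ρ : ℝ}

/-- Conditionally sub-Gaussian noise has a bounded exponential moment in any predictable
direction. -/
theorem lintegral_mul_exp_inner_le (hm : m ≤ mΩ) (hε : Measurable ε)
    (hint : ∀ u : Vec k, Integrable (fun ω => Real.exp (inner ℝ u (ε ω))) P)
    (hsub : ∀ u : Vec k, P[fun ω => Real.exp (inner ℝ u (ε ω)) | m]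
      ≤ᵐ[P] fun _ => Real.exp (‖u‖ ^ 2 * ρ ^ 2 / 2))
    {U : Ω → Vec k} (hU : Measurable[m] U) {Z : Ω → ℝ≥0∞} (hZ : Measurable[m] Z) :
    ∫⁻ ω, Z ω * ENNReal.ofReal (Real.exp (inner ℝ (U ω) (ε ω) - ‖U ω‖ ^ 2 * ρ ^ 2 / 2)) ∂P
      ≤ ∫⁻ ω, Z ω ∂P := by
  set f : Vec k → Ω → ℝ≥0∞ := fun u ω =>
    ENNReal.ofReal (Real.exp (inner ℝ u (ε ω) - ‖u‖ ^ 2 * ρ ^ 2 / 2)) with hf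
  have hfm : ∀ {U : Ω → Vec k}, Measurable U → Measurable fun ω => f (U ω) ω := fun hU => by
    simp only [hf]; fun_prop
  -- For deterministic u the hypothesis says that P weighted by `f u` is dominated by P on the
  -- sub-σ-algebra `m`. It holds only up to a null set depending on u, so a random direction is
  -- reached through finitely many values first, then by Fatou.
  have hconst : ∀ (u : Vec k) {Z : Ω → ℝ≥0∞}, Measurable[m] Z →
      ∫⁻ ω, Z ω * f u ω ∂P ≤ ∫⁻ ω, Z ω ∂P := by
    intro u Z hZ
    have hfu : Measurable (f u) := hfm measurable_const
    have hle : (P.withDensity (f u)).trim hm ≤ P.trim hm := by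
      refine Measure.le_iff.2 fun s hs => ?_
      rw [trim_measurableSet_eq hm hs, trim_measurableSet_eq hm hs, withDensity_apply _ (hm _ hs)]
      have h1 : ∫ ω in s, Real.exp (inner ℝ u (ε ω)) ∂P
          ≤ Real.exp (‖u‖ ^ 2 * ρ ^ 2 / 2) * P.real s := by
        rw [← setIntegral_condExp hm (hint u) hs]
        calc _ ≤ ∫ _ in s, Real.exp (‖u‖ ^ 2 * ρ ^ 2 / 2) ∂P :=
              setIntegral_mono_ae integrable_condExp.integrableOn
                (integrable_const _).integrableOn (hsub u)
          _ = _ := by simp [mul_comm]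
      have h2 : ∀ ω, f u ω = ENNReal.ofReal (Real.exp (-(‖u‖ ^ 2 * ρ ^ 2 / 2)))
          * ENNReal.ofReal (Real.exp (inner ℝ u (ε ω))) := fun ω => by
        rw [← ENNReal.ofReal_mul (Real.exp_pos _).le, ← Real.exp_add]
        simp only [hf]; congr 2; ring
      calc ∫⁻ ω in s, f u ω ∂P
          = ENNReal.ofReal (Real.exp (-(‖u‖ ^ 2 * ρ ^ 2 / 2)))
            * ENNReal.ofReal (∫ ω in s, Real.exp (inner ℝ u (ε ω)) ∂P) := by
            rw [ofReal_integral_eq_lintegral_ofReal (hint u).integrableOn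
              (Filter.Eventually.of_forall fun _ => (Real.exp_pos _).le)]
            simp_rw [h2]
            exact lintegral_const_mul' _ _ ENNReal.ofReal_ne_top
        _ ≤ ENNReal.ofReal (Real.exp (-(‖u‖ ^ 2 * ρ ^ 2 / 2)))
            * ENNReal.ofReal (Real.exp (‖u‖ ^ 2 * ρ ^ 2 / 2) * P.real s) := by gcongr
        _ = P s := by
            rw [← ENNReal.ofReal_mul (Real.exp_pos _).le, ← mul_assoc, ← Real.exp_add]
            simp
    have hZ' : Measurable Z := hZ.mono hm le_rfl
    calc ∫⁻ ω, Z ω * f u ω ∂P = ∫⁻ ω, Z ω ∂P.withDensity (f u) := by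
          rw [lintegral_withDensity_eq_lintegral_mul _ hfu hZ']
          simp [mul_comm]
      _ = ∫⁻ ω, Z ω ∂(P.withDensity (f u)).trim hm := (lintegral_trim hm hZ).symm
      _ ≤ ∫⁻ ω, Z ω ∂P.trim hm := lintegral_mono' hle le_rfl
      _ = _ := lintegral_trim hm hZ
  have hsimple : ∀ W : Ω → Vec k, Measurable[m] W → (Set.range W).Finite →
      ∫⁻ ω, Z ω * f (W ω) ω ∂P ≤ ∫⁻ ω, Z ω ∂P := by
    intro W hW hfin
    set T := hfin.toFinset
    have hdec : ∀ h : Vec k → Ω → ℝ≥0∞, ∀ ω, h (W ω) ω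
        = ∑ c ∈ T, (W ⁻¹' {c}).indicator (h c) ω := by
      intro h ω
      rw [Finset.sum_eq_single (W ω)]
      · simp
      · intro c _ hc
        exact Set.indicator_of_notMem (fun h => hc (by simpa using h.symm)) _
      · intro h; exact absurd (hfin.mem_toFinset.2 (Set.mem_range_self ω)) h
    have hms : ∀ c, MeasurableSet[m] (W ⁻¹' {c}) := fun c => hW (measurableSet_singleton c)
    have hZ' : Measurable Z := hZ.mono hm le_rfl
    calc ∫⁻ ω, Z ω * f (W ω) ω ∂P
        = ∑ c ∈ T, ∫⁻ ω, (W ⁻¹' {c}).indicator (fun ω => Z ω * f c ω) ω ∂P := by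
          rw [← lintegral_finsetSum]
          · exact lintegral_congr fun ω => hdec (fun c ω => Z ω * f c ω) ω
          · exact fun c _ => (hZ'.mul (hfm measurable_const)).indicator (hm _ (hms c))
      _ = ∑ c ∈ T, ∫⁻ ω, (W ⁻¹' {c}).indicator Z ω * f c ω ∂P := by
          refine Finset.sum_congr rfl fun c _ => lintegral_congr fun ω => ?_
          by_cases h : ω ∈ W ⁻¹' {c} <;> simp [h]
      _ ≤ ∑ c ∈ T, ∫⁻ ω, (W ⁻¹' {c}).indicator Z ω ∂P :=
          Finset.sum_le_sum fun c _ => hconst c (hZ.indicator (hms c))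
      _ = ∫⁻ ω, Z ω ∂P := by
          rw [← lintegral_finsetSum]
          · exact lintegral_congr fun ω => (hdec (fun _ => Z) ω).symm
          · exact fun c _ => hZ'.indicator (hm _ (hms c))
  obtain ⟨W, hW, hWU⟩ :=
    @exists_finite_range_approx Ω m k U hU
  have hlim : ∀ ω, Filter.Tendsto (fun i => Z ω * f (W i ω) ω) Filter.atTop
      (nhds (Z ω * f (U ω) ω)) := by
    intro ω
    have h0 : f (U ω) ω ≠ 0 := by simp [hf, Real.exp_pos]
    refine ENNReal.Tendsto.const_mul ?_ (Or.inl h0)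
    have hc : Continuous fun u => f u ω := by
      simp only [hf]
      exact ENNReal.continuous_ofReal.comp (by fun_prop)
    exact (hc.tendsto _).comp (hWU ω)
  calc ∫⁻ ω, Z ω * f (U ω) ω ∂P
      = ∫⁻ ω, Filter.liminf (fun i => Z ω * f (W i ω) ω) Filter.atTop ∂P :=
        lintegral_congr fun ω => (hlim ω).liminf_eq.symm
    _ ≤ Filter.liminf (fun i => ∫⁻ ω, Z ω * f (W i ω) ω ∂P) Filter.atTop :=
        lintegral_liminf_le' fun i => ((hZ.mono hm le_rfl).mul
          (hfm ((hW i).1.mono hm le_rfl))).aemeasurable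
    _ ≤ Filter.liminf (fun _ : ℕ => ∫⁻ ω, Z ω ∂P) Filter.atTop :=
        Filter.liminf_le_liminf (Filter.Eventually.of_forall fun i => hsimple _ (hW i).1 (hW i).2)
    _ = _ := Filter.liminf_const _

end SubGaussian

/-- Hölder's inequality for a finite sum of integrals. -/
theorem sum_lintegral_prod_rpow_le {Ω τ ι : Type*} [MeasurableSpace Ω] {P : Measure Ω}
    [Countable τ] (s : Finset τ) (S : Finset ι) {f : ι → τ → Ω → ℝ≥0∞}
    (hf : ∀ i ∈ S, ∀ t, Measurable (f i t)) {p : ι → ℝ} (hp : ∑ i ∈ S, p i = 1)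
    (hp0 : ∀ i ∈ S, 0 ≤ p i) :
    ∑ t ∈ s, ∫⁻ ω, ∏ i ∈ S, f i t ω ^ p i ∂P ≤ ∏ i ∈ S, (∑ t ∈ s, ∫⁻ ω, f i t ω ∂P) ^ p i := by
  let _ : MeasurableSpace τ := ⊤
  -- The sum of integrals is one integral over rounds and outcomes, to which the ordinary Hölder
  -- inequality applies.
  let Q : Measure (τ × Ω) := ∑ t ∈ s, P.map fun ω => (t, ω)
  have hF : ∀ i ∈ S, Measurable fun q : τ × Ω => f i q.1 q.2 := fun i hi =>
    measurable_from_prod_countable_right fun t => hf i hi t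
  have hQ : ∀ g : τ × Ω → ℝ≥0∞, Measurable g → ∫⁻ q, g q ∂Q = ∑ t ∈ s, ∫⁻ ω, g (t, ω) ∂P := by
    intro g hg
    rw [lintegral_finsetSum_measure]
    exact Finset.sum_congr rfl fun t _ => lintegral_map hg measurable_prodMk_left
  have h := ENNReal.lintegral_prod_norm_pow_le (μ := Q) S
    (f := fun i q => f i q.1 q.2) (fun i hi => (hF i hi).aemeasurable) hp hp0
  rw [hQ _ (Finset.measurable_prod S fun i hi => (hF i hi).pow_const _)] at h
  refine h.trans_eq (Finset.prod_congr rfl fun i hi => ?_)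
  rw [hQ _ (hF i hi)]

/-- Hölder's inequality for a finite sum of integrals of almost everywhere measurable functions. -/
theorem sum_lintegral_prod_rpow_le' {Ω τ ι : Type*} [MeasurableSpace Ω] {P : Measure Ω}
    [Countable τ] (s : Finset τ) (S : Finset ι) {f : ι → τ → Ω → ℝ≥0∞}
    (hf : ∀ i ∈ S, ∀ t ∈ s, AEMeasurable (f i t) P) {p : ι → ℝ} (hp : ∑ i ∈ S, p i = 1)
    (hp0 : ∀ i ∈ S, 0 ≤ p i) :
    ∑ t ∈ s, ∫⁻ ω, ∏ i ∈ S, f i t ω ^ p i ∂P ≤ ∏ i ∈ S, (∑ t ∈ s, ∫⁻ ω, f i t ω ∂P) ^ p i := by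
  have hex : ∀ i t, ∃ g : Ω → ℝ≥0∞, Measurable g ∧ (i ∈ S → t ∈ s → f i t =ᵐ[P] g) := by
    intro i t
    by_cases h : i ∈ S ∧ t ∈ s
    · exact ⟨(hf i h.1 t h.2).mk _, (hf i h.1 t h.2).measurable_mk,
        fun _ _ => (hf i h.1 t h.2).ae_eq_mk⟩
    · exact ⟨0, measurable_zero, fun hi ht => absurd ⟨hi, ht⟩ h⟩
  choose g hg hfg using hex
  have h := sum_lintegral_prod_rpow_le (P := P) s S (f := g) (fun i _ t => hg i t) hp hp0
  convert h using 1
  · refine Finset.sum_congr rfl fun t ht => lintegral_congr_ae ?_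
    filter_upwards [(ae_ball_iff (Finset.countable_toSet S)).2 fun i hi => hfg i t hi ht] with ω hω
    exact Finset.prod_congr rfl fun i hi => by rw [hω i hi]
  · refine Finset.prod_congr rfl fun i hi => ?_
    rw [Finset.sum_congr rfl fun t ht => lintegral_congr_ae (hfg i t hi ht)]

theorem sum_lintegral_mul_sqrt_le {Ω : Type*} [MeasurableSpace Ω] {P : Measure Ω}
    (s : Finset ℕ) {f g : ℕ → Ω → ℝ≥0∞} (hf : ∀ t ∈ s, AEMeasurable (f t) P)
    (hg : ∀ t ∈ s, AEMeasurable (g t) P) :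
    ∑ t ∈ s, ∫⁻ ω, (f t ω * g t ω) ^ (1 / 2 : ℝ) ∂P
      ≤ ((∑ t ∈ s, ∫⁻ ω, f t ω ∂P) * ∑ t ∈ s, ∫⁻ ω, g t ω ∂P) ^ (1 / 2 : ℝ) := by
  have h := sum_lintegral_prod_rpow_le' (P := P) s (Finset.univ : Finset (Fin 2)) (f := ![f, g])
    (p := fun _ => 1 / 2) (fun i _ t ht => by fin_cases i <;> simp [hf t ht, hg t ht])
    (by norm_num) (fun _ _ => by norm_num)
  have h2 : (0 : ℝ) ≤ 1 / 2 := by norm_num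
  simpa only [Fin.prod_univ_two, Matrix.cons_val_zero, Matrix.cons_val_one,
    ← ENNReal.mul_rpow_of_nonneg _ _ h2] using h

theorem sum_lintegral_mul_cbrt_le {Ω : Type*} [MeasurableSpace Ω] {P : Measure Ω}
    (s : Finset ℕ) {f g h : ℕ → Ω → ℝ≥0∞} (hf : ∀ t ∈ s, AEMeasurable (f t) P)
    (hg : ∀ t ∈ s, AEMeasurable (g t) P) (hh : ∀ t ∈ s, AEMeasurable (h t) P) :
    ∑ t ∈ s, ∫⁻ ω, (f t ω * (g t ω * h t ω)) ^ (1 / 3 : ℝ) ∂P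
      ≤ ((∑ t ∈ s, ∫⁻ ω, f t ω ∂P) * ((∑ t ∈ s, ∫⁻ ω, g t ω ∂P) * ∑ t ∈ s, ∫⁻ ω, h t ω ∂P))
        ^ (1 / 3 : ℝ) := by
  have H := sum_lintegral_prod_rpow_le' (P := P) s (Finset.univ : Finset (Fin 3)) (f := ![f, g, h])
    (p := fun _ => 1 / 3) (fun i _ t ht => by fin_cases i <;> simp [hf t ht, hg t ht, hh t ht])
    (by norm_num) (fun _ _ => by norm_num)
  have h2 : (0 : ℝ) ≤ 1 / 3 := by norm_num
  simpa only [Fin.prod_univ_three, Matrix.cons_val_zero, Matrix.cons_val_one,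
    Matrix.cons_val, ← ENNReal.mul_rpow_of_nonneg _ _ h2, mul_assoc] using H

/-- Cauchy-Schwarz for functions with `f² ≤ w J`; the weights `w` need not be measurable. -/
theorem sum_lintegral_le_of_sq_le {Ω : Type*} [MeasurableSpace Ω] {P : Measure Ω}
    (s : Finset ℕ) {f J w : ℕ → Ω → ℝ≥0∞} (hf : ∀ t ∈ s, AEMeasurable (f t) P)
    (hJ : ∀ t ∈ s, AEMeasurable (J t) P)
    (h : ∀ᵐ ω ∂P, ∀ t ∈ s, J t ω ≠ ⊤ ∧ f t ω ^ 2 ≤ w t ω * J t ω) :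
    ∑ t ∈ s, ∫⁻ ω, f t ω ∂P
      ≤ ((∫⁻ ω, ∑ t ∈ s, w t ω ∂P) * ∑ t ∈ s, ∫⁻ ω, J t ω ∂P) ^ (1 / 2 : ℝ) := by
  -- The measurable quotient f²/J stands in for w in Cauchy–Schwarz; the lower integral of w is used
  -- only through monotonicity. Where J = 0 the hypothesis forces f = 0, so f² = (f²/J) · J
  -- throughout.
  have hy : ∀ t ∈ s, AEMeasurable (fun ω => f t ω ^ 2 / J t ω) P := fun t ht =>
    ((hf t ht).pow_const 2).div (hJ t ht)
  calc ∑ t ∈ s, ∫⁻ ω, f t ω ∂P = ∑ t ∈ s, ∫⁻ ω, (f t ω ^ 2 / J t ω * J t ω) ^ (1 / 2 : ℝ) ∂P := by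
        refine Finset.sum_congr rfl fun t ht => lintegral_congr_ae ?_
        filter_upwards [h] with ω hω
        obtain ⟨h1, h2⟩ := hω t ht
        have e : f t ω ^ 2 / J t ω * J t ω = f t ω ^ 2 := by
          refine ENNReal.div_mul_cancel' (fun h0 => ?_) (fun h0 => absurd h0 h1)
          simpa [h0] using h2
        rw [e, ← ENNReal.rpow_natCast, ← ENNReal.rpow_mul]
        norm_num
    _ ≤ _ := sum_lintegral_mul_sqrt_le s hy hJ
    _ ≤ _ := by
        gcongr
        rw [← lintegral_finsetSum' _ hy]
        refine lintegral_mono_ae ?_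
        filter_upwards [h] with ω hω
        exact Finset.sum_le_sum fun t ht => ENNReal.div_le_of_le_mul (hω t ht).2

/-- Hölder's inequality for functions with `f³ ≤ w g h`; the weights `w` need not be measurable. -/
theorem sum_lintegral_le_of_cube_le {Ω : Type*} [MeasurableSpace Ω] {P : Measure Ω}
    (s : Finset ℕ) {f g k w : ℕ → Ω → ℝ≥0∞} (hf : ∀ t ∈ s, AEMeasurable (f t) P)
    (hg : ∀ t ∈ s, AEMeasurable (g t) P) (hk : ∀ t ∈ s, AEMeasurable (k t) P)
    (h : ∀ᵐ ω ∂P, ∀ t ∈ s, g t ω * k t ω ≠ ⊤ ∧ f t ω ^ 3 ≤ w t ω * (g t ω * k t ω)) :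
    ∑ t ∈ s, ∫⁻ ω, f t ω ∂P
      ≤ ((∫⁻ ω, ∑ t ∈ s, w t ω ∂P)
        * ((∑ t ∈ s, ∫⁻ ω, g t ω ∂P) * ∑ t ∈ s, ∫⁻ ω, k t ω ∂P)) ^ (1 / 3 : ℝ) := by
  -- As for squares: the measurable f³/(g k) replaces w.
  have hy : ∀ t ∈ s, AEMeasurable (fun ω => f t ω ^ 3 / (g t ω * k t ω)) P := fun t ht =>
    ((hf t ht).pow_const 3).div ((hg t ht).mul (hk t ht))
  calc ∑ t ∈ s, ∫⁻ ω, f t ω ∂P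
      = ∑ t ∈ s, ∫⁻ ω, (f t ω ^ 3 / (g t ω * k t ω) * (g t ω * k t ω)) ^ (1 / 3 : ℝ) ∂P := by
        refine Finset.sum_congr rfl fun t ht => lintegral_congr_ae ?_
        filter_upwards [h] with ω hω
        obtain ⟨h1, h2⟩ := hω t ht
        have e : f t ω ^ 3 / (g t ω * k t ω) * (g t ω * k t ω) = f t ω ^ 3 := by
          refine ENNReal.div_mul_cancel' (fun h0 => ?_) (fun h0 => absurd h0 h1)
          simpa [h0] using h2
        rw [e, ← ENNReal.rpow_natCast, ← ENNReal.rpow_mul]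
        norm_num
    _ ≤ _ := sum_lintegral_mul_cbrt_le s hy hg hk
    _ ≤ _ := by
        gcongr
        rw [← lintegral_finsetSum' _ hy]
        refine lintegral_mono_ae ?_
        filter_upwards [h] with ω hω
        exact Finset.sum_le_sum fun t ht => ENNReal.div_le_of_le_mul (hω t ht).2

/-! ### Gaussian integrals with a matrix precision. -/

section Gaussian

variable {d : ℕ}

theorem lintegral_exp_neg_sq_pos_finite {r : ℝ} (hr : 0 < r) :
    (∫⁻ u : Vec d, ENNReal.ofReal (Real.exp (-(r * ‖u‖ ^ 2)))) ≠ 0 ∧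
      (∫⁻ u : Vec d, ENNReal.ofReal (Real.exp (-(r * ‖u‖ ^ 2)))) ≠ ⊤ := by
  constructor
  · intro h
    rw [lintegral_eq_zero_iff (by fun_prop)] at h
    have h' : ∀ᵐ _ : Vec d, False := by
      filter_upwards [h] with u hu
      simp only [Pi.zero_apply, ENNReal.ofReal_eq_zero] at hu
      exact absurd (Real.exp_pos _) (not_lt.2 hu)
    rw [Filter.eventually_false_iff_eq_bot, ae_eq_bot] at h'
    exact NeZero.ne _ h'
  · have h := GaussianFourier.integrable_cexp_neg_mul_sq_norm_add (V := Vec d) (b := (r : ℂ))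
      (by simpa using hr) 0 0
    have h2 : Integrable fun u : Vec d => Real.exp (-(r * ‖u‖ ^ 2)) := by
      refine (h.norm).congr (Filter.Eventually.of_forall fun u => ?_)
      simp only [zero_mul, add_zero]
      rw [Complex.norm_exp]
      congr 1
      norm_cast
      simp
    rw [← ofReal_integral_eq_lintegral_ofReal h2
      (Filter.Eventually.of_forall fun _ => (Real.exp_pos _).le)]
    exact ENNReal.ofReal_ne_top

/-- The Laplace transform of an unnormalised centred Gaussian density with precision `2 r V`. -/
theorem lintegral_exp_inner_sub_quad {V : Matrix (Fin d) (Fin d) ℝ} (hV : V.PosDef) {r : ℝ}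
    (hr : 0 < r) (S : Vec d) :
    ∫⁻ u : Vec d, ENNReal.ofReal (Real.exp (inner ℝ u S - r * quad V u))
      = ENNReal.ofReal (Real.exp (quad V⁻¹ S / (4 * r)) * (√V.det)⁻¹)
        * ∫⁻ u : Vec d, ENNReal.ofReal (Real.exp (-(r * ‖u‖ ^ 2))) := by
  obtain ⟨R, hR, rfl⟩ := posDef_factor hV
  set c : Vec d := (1 / (2 * r)) • act (Rᵀ * R)⁻¹ S with hc
  -- Completing the square around c = V⁻¹ S / (2r). Translation by c and the substitution by R then
  -- leave the factor 1/|det R| = 1/√(det V).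
  have hsq : ∀ u : Vec d, inner ℝ u S - r * quad (Rᵀ * R) u
      = quad (Rᵀ * R)⁻¹ S / (4 * r) + -(r * ‖act R (u - c)‖ ^ 2) := by
    intro u
    have e1 : inner ℝ (act R u) (act R c) = inner ℝ u S / (2 * r) := by
      have h : act Rᵀ (act R c) = (1 / (2 * r)) • S := by
        rw [← act_mul, hc, map_smul, act_act_inv (posDef_isUnit_det hV)]
      have h' := inner_act Rᵀ u (act R c)
      rw [Matrix.transpose_transpose] at h'
      rw [← h', h, inner_smul_right]
      ring
    have e2 : ‖act R c‖ ^ 2 = quad (Rᵀ * R)⁻¹ S / (4 * r ^ 2) := by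
      have h : act Rᵀ (act R c) = (1 / (2 * r)) • S := by
        rw [← act_mul, hc, map_smul, act_act_inv (posDef_isUnit_det hV)]
      have h' := inner_act Rᵀ c (act R c)
      rw [Matrix.transpose_transpose, real_inner_self_eq_norm_sq] at h'
      rw [← h', h, inner_smul_right, hc, inner_smul_left, quad, real_inner_comm]
      simp
      ring
    rw [map_sub, norm_sub_sq_real, e1, e2, quad_transpose_mul]
    field_simp
    ring
  have hdet : LinearMap.det (act R) ≠ 0 := by
    rw [act, Matrix.toEuclideanLin, LinearMap.det_toLpLin]
    exact hR.ne_zero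
  have hmap := Measure.map_linearMap_addHaar_eq_smul_addHaar (volume : Measure (Vec d)) hdet
  have hmeas : Measurable (act R) := (act R).continuous_of_finiteDimensional.measurable
  have hsqrt : √(Rᵀ * R).det = |R.det| := by
    rw [Matrix.det_mul, Matrix.det_transpose, ← sq, Real.sqrt_sq_eq_abs]
  calc ∫⁻ u : Vec d, ENNReal.ofReal (Real.exp (inner ℝ u S - r * quad (Rᵀ * R) u))
      = ENNReal.ofReal (Real.exp (quad (Rᵀ * R)⁻¹ S / (4 * r)))
        * ∫⁻ u : Vec d, ENNReal.ofReal (Real.exp (-(r * ‖act R (u - c)‖ ^ 2))) := by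
        rw [← lintegral_const_mul' _ _ ENNReal.ofReal_ne_top]
        refine lintegral_congr fun u => ?_
        rw [hsq, Real.exp_add, ENNReal.ofReal_mul (Real.exp_pos _).le]
    _ = ENNReal.ofReal (Real.exp (quad (Rᵀ * R)⁻¹ S / (4 * r)))
        * ∫⁻ u : Vec d, ENNReal.ofReal (Real.exp (-(r * ‖act R u‖ ^ 2))) := by
        rw [lintegral_sub_right_eq_self
          (fun u => ENNReal.ofReal (Real.exp (-(r * ‖act R u‖ ^ 2)))) c]
    _ = ENNReal.ofReal (Real.exp (quad (Rᵀ * R)⁻¹ S / (4 * r)))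
        * ∫⁻ u : Vec d, ENNReal.ofReal (Real.exp (-(r * ‖u‖ ^ 2)))
            ∂(Measure.map (act R) volume) := by
        rw [lintegral_map (by fun_prop) hmeas]
    _ = _ := by
        rw [hmap, lintegral_smul_measure, smul_eq_mul, ← mul_assoc,
          ← ENNReal.ofReal_mul (Real.exp_pos _).le, hsqrt, abs_inv, act, Matrix.toEuclideanLin,
          LinearMap.det_toLpLin]

end Gaussian

namespace Game

/-! ### The noise process and the confidence event -/

variable {A Z : Type*} [TopologicalSpace A] [MeasurableSpace Z] {d m : ℕ} {G : Game A Z d m}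
  {lam ρ B L : ℝ} {θ₀ θs : Vec d}

/-- The accumulated noise `∑_{s < t} M_sᵀ ε_s`. -/
noncomputable def noiseSum (G : Game A Z d m) (z : ℕ → Z) (a : ℕ → A) (ε : ℕ → Vec m) (t : ℕ) :
    Vec d :=
  ∑ s ∈ Finset.Ico 1 t, act (G.M (z s) (a s))ᵀ (ε s)

theorem noiseSum_one (z : ℕ → Z) (a : ℕ → A) (ε : ℕ → Vec m) : G.noiseSum z a ε 1 = 0 := by
  simp [noiseSum]

theorem noiseSum_succ (z : ℕ → Z) (a : ℕ → A) (ε : ℕ → Vec m) {t : ℕ} (ht : 1 ≤ t) :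
    G.noiseSum z a ε (t + 1) = G.noiseSum z a ε t + act (G.M (z t) (a t))ᵀ (ε t) := by
  rw [noiseSum, Finset.sum_Ico_succ_top ht, noiseSum]

/-- The exponential process of the noise in direction `u`, before normalisation by the prior. -/
noncomputable def expNoise (G : Game A Z d m) (lam ρ : ℝ) (z : ℕ → Z) (a : ℕ → A) (ε : ℕ → Vec m)
    (u : Vec d) (t : ℕ) : ℝ≥0∞ :=
  ENNReal.ofReal (Real.exp (inner ℝ u (G.noiseSum z a ε t)
    - ρ ^ 2 / 2 * (quad (G.covMat lam z a t) u - lam * ‖u‖ ^ 2)))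

theorem expNoise_one (z : ℕ → Z) (a : ℕ → A) (ε : ℕ → Vec m) (u : Vec d) :
    G.expNoise lam ρ z a ε u 1 = 1 := by
  simp [expNoise, noiseSum_one, covMat_one, quad_smul_one]

theorem expNoise_succ (z : ℕ → Z) (a : ℕ → A) (ε : ℕ → Vec m) (u : Vec d) {t : ℕ} (ht : 1 ≤ t) :
    G.expNoise lam ρ z a ε u (t + 1) = G.expNoise lam ρ z a ε u t
      * ENNReal.ofReal (Real.exp (inner ℝ (act (G.M (z t) (a t)) u) (ε t)
        - ‖act (G.M (z t) (a t)) u‖ ^ 2 * ρ ^ 2 / 2)) := by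
  have h := inner_act (G.M (z t) (a t))ᵀ u (ε t)
  rw [Matrix.transpose_transpose] at h
  rw [expNoise, expNoise, ← ENNReal.ofReal_mul (Real.exp_pos _).le, ← Real.exp_add,
    noiseSum_succ _ _ _ ht, covMat_succ _ _ ht, quad_add, quad_transpose_mul, inner_add_right, h]
  congr 2
  ring

/-- The mixture supermartingale of the noise. -/
noncomputable def mixture (G : Game A Z d m) (lam ρ : ℝ) (z : ℕ → Z) (a : ℕ → A) (ε : ℕ → Vec m)
    (t : ℕ) : ℝ :=
  Real.exp (dualNorm (G.covMat lam z a t) (G.noiseSum z a ε t) ^ 2 / (2 * ρ ^ 2)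
    - G.logVol lam z a t / 2)

/-- The Gaussian weight of precision ρ² λ supplies exactly the term λ ‖u‖² that `expNoise` leaves
out, so the integrand has precision ρ² V_t. The ratio of the two normalisations is exp(-`logVol` /
2). -/
theorem lintegral_expNoise_mul (hlam : 0 < lam) (hρ : 0 < ρ) (z : ℕ → Z) (a : ℕ → A)
    (ε : ℕ → Vec m) (t : ℕ) :
    ∫⁻ u : Vec d, ENNReal.ofReal (Real.exp (-(ρ ^ 2 / 2 * lam * ‖u‖ ^ 2)))
        * G.expNoise lam ρ z a ε u t
      = ENNReal.ofReal (G.mixture lam ρ z a ε t)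
        * ∫⁻ u : Vec d, ENNReal.ofReal (Real.exp (-(ρ ^ 2 / 2 * lam * ‖u‖ ^ 2))) := by
  have hr : 0 < ρ ^ 2 / 2 := by positivity
  have hV := covMat_posDef (G := G) z a hlam t
  have hV0 := smul_one_posDef (d := d) hlam
  have h1 := lintegral_exp_inner_sub_quad hV hr (G.noiseSum z a ε t)
  have h0 := lintegral_exp_inner_sub_quad hV0 hr 0
  have e0 : ∀ u : Vec d, inner ℝ u (0 : Vec d)
      - ρ ^ 2 / 2 * quad (lam • (1 : Matrix (Fin d) (Fin d) ℝ)) u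
        = -(ρ ^ 2 / 2 * lam * ‖u‖ ^ 2) := fun u => by
    rw [inner_zero_right, quad_smul_one]; ring
  simp only [e0] at h0
  have e1 : ∀ u : Vec d, ENNReal.ofReal (Real.exp (-(ρ ^ 2 / 2 * lam * ‖u‖ ^ 2)))
      * G.expNoise lam ρ z a ε u t = ENNReal.ofReal (Real.exp
        (inner ℝ u (G.noiseSum z a ε t) - ρ ^ 2 / 2 * quad (G.covMat lam z a t) u)) := fun u => by
    rw [expNoise, ← ENNReal.ofReal_mul (Real.exp_pos _).le, ← Real.exp_add]
    congr 2
    ring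
  simp only [e1]
  rw [h1, h0, ← mul_assoc, ← ENNReal.ofReal_mul (show 0 ≤ G.mixture lam ρ z a ε t from (Real.exp_pos _).le)]
  congr 2
  have hexp : Real.exp (-(G.logVol lam z a t / 2))
      = √(lam • (1 : Matrix (Fin d) (Fin d) ℝ)).det * (√(G.covMat lam z a t).det)⁻¹ := by
    have : -(G.logVol lam z a t / 2) = Real.log (lam • (1 : Matrix (Fin d) (Fin d) ℝ)).det / 2
        - Real.log (G.covMat lam z a t).det / 2 := by
      rw [logVol]; ring
    rw [this, Real.exp_sub, Real.exp_half, Real.exp_half, Real.exp_log hV0.det_pos,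
      Real.exp_log hV.det_pos, div_eq_mul_inv]
  have hs : √(lam • (1 : Matrix (Fin d) (Fin d) ℝ)).det ≠ 0 :=
    (Real.sqrt_pos.2 hV0.det_pos).ne'
  rw [mixture, sub_eq_add_neg, Real.exp_add, hexp, dualNorm_sq hV]
  have : quad (lam • (1 : Matrix (Fin d) (Fin d) ℝ))⁻¹ (0 : Vec d) = 0 := by simp [quad]
  rw [this]
  simp only [zero_div, Real.exp_zero, one_mul]
  rw [show 4 * (ρ ^ 2 / 2) = 2 * ρ ^ 2 by ring]
  field_simp

theorem logVol_half_le_sum (hlam : 0 < lam) {z : ℕ → Z} {a : ℕ → A} {n t : ℕ} (h1 : 1 ≤ t)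
    (ht : t ≤ n + 1) : G.logVol lam z a t / 2
      ≤ ∑ s ∈ Finset.Icc 1 n, G.infoGain (G.covMat lam z a s) (a s) (z s) := by
  rw [logVol_eq_sum _ _ hlam h1, mul_div_cancel_left₀ _ two_ne_zero]
  refine Finset.sum_le_sum_of_subset_of_nonneg (fun s hs => ?_) fun s _ _ =>
    infoGain_nonneg (covMat_posDef _ _ hlam _) _ _
  rw [Finset.mem_Ico] at hs
  exact Finset.mem_Icc.2 (by omega)

section Failure

variable {Ω : Type*} {z : ℕ → Ω → Z} {a : ℕ → Ω → A} {ε : ℕ → Ω → Vec m} {t : ℕ}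

/-- The event that the noise up to round `t` exceeds its confidence bound. -/
def noiseFailure (G : Game A Z d m) (lam ρ : ℝ) (z : ℕ → Ω → Z) (a : ℕ → Ω → A)
    (ε : ℕ → Ω → Vec m) (t : ℕ) : Set Ω :=
  {ω | ρ ^ 2 * (3 * Real.log t + G.logVol lam (fun s => z s ω) (fun s => a s ω) t)
    < dualNorm (G.covMat lam (fun s => z s ω) (fun s => a s ω) t)
      (G.noiseSum (fun s => z s ω) (fun s => a s ω) (fun s => ε s ω) t) ^ 2}

theorem noiseFailure_one : noiseFailure G lam ρ z a ε 1 = ∅ := by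
  ext ω
  simp [noiseFailure, noiseSum_one, dualNorm, quad, logVol_one]

/-- The 3 log t in the failure event, halved by the 2ρ² in the exponent, is the exponent 3/2: large
enough to be summable, smaller than the 2 that the radius β_t would give. -/
theorem lt_mixture_of_mem (hρ : 0 < ρ) (h1 : 1 ≤ t) {ω : Ω} (hω : ω ∈ noiseFailure G lam ρ z a ε t) :
    (t : ℝ) ^ (3 / 2 : ℝ)
      ≤ G.mixture lam ρ (fun s => z s ω) (fun s => a s ω) (fun s => ε s ω) t := by
  have ht : (0 : ℝ) < t := by exact_mod_cast h1
  rw [Real.rpow_def_of_pos ht, mixture]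
  refine Real.exp_le_exp.2 ?_
  have h2 : ρ ^ 2 * (3 * Real.log t + _) < _ := hω
  have : 3 * Real.log t + G.logVol lam (fun s => z s ω) (fun s => a s ω) t
      ≤ 2 * (dualNorm (G.covMat lam (fun s => z s ω) (fun s => a s ω) t)
      (G.noiseSum (fun s => z s ω) (fun s => a s ω) (fun s => ε s ω) t) ^ 2 / (2 * ρ ^ 2)) := by
    rw [← mul_div_assoc, mul_div_mul_left _ _ two_ne_zero, le_div_iff₀ (by positivity), mul_comm]
    exact h2.le
  linarith

end Failure

section Measurability

variable {Ω : Type*} [MeasurableSpace Ω] [MeasurableSpace A] [OpensMeasurableSpace A]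
  [SecondCountableTopology A] [TopologicalSpace.MetrizableSpace A]
  {z : ℕ → Ω → Z} {a : ℕ → Ω → A} {ε y : ℕ → Ω → Vec m} {t : ℕ}

theorem measurable_noiseSum (hz : ∀ s ∈ Finset.Ico 1 t, Measurable (z s))
    (ha : ∀ s ∈ Finset.Ico 1 t, Measurable (a s)) (hε : ∀ s ∈ Finset.Ico 1 t, Measurable (ε s)) :
    Measurable fun ω => G.noiseSum (fun s => z s ω) (fun s => a s ω) (fun s => ε s ω) t :=
  Finset.measurable_fun_sum _ fun s hs =>
    (entryMeasurable_M_comp (hz s hs) (ha s hs)).transpose.act (hε s hs)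

theorem measurable_expNoise (hz : ∀ s ∈ Finset.Ico 1 t, Measurable (z s))
    (ha : ∀ s ∈ Finset.Ico 1 t, Measurable (a s)) (hε : ∀ s ∈ Finset.Ico 1 t, Measurable (ε s)) :
    Measurable fun p : Ω × Vec d => G.expNoise lam ρ (fun s => z s p.1) (fun s => a s p.1)
      (fun s => ε s p.1) p.2 t := by
  have h1 := (measurable_noiseSum (G := G) hz ha hε).comp (measurable_fst : Measurable (Prod.fst : Ω × Vec d → Ω))
  have h2 := ((entryMeasurable_covMat (G := G) (lam := lam) hz ha).comp
    (measurable_fst : Measurable (Prod.fst : Ω × Vec d → Ω))).quad (measurable_snd (α := Ω))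
  refine (((measurable_snd.inner h1).sub ((h2.sub ?_).const_mul _)).exp).ennreal_ofReal
  fun_prop

theorem measurable_mixture (hz : ∀ s ∈ Finset.Ico 1 t, Measurable (z s))
    (ha : ∀ s ∈ Finset.Ico 1 t, Measurable (a s)) (hε : ∀ s ∈ Finset.Ico 1 t, Measurable (ε s)) :
    Measurable fun ω => G.mixture lam ρ (fun s => z s ω) (fun s => a s ω) (fun s => ε s ω) t :=
  (((((entryMeasurable_covMat hz ha).dualNorm (measurable_noiseSum hz ha hε)).pow_const 2).div_const
    _).sub ((measurable_logVol hz ha).div_const 2)).exp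

theorem measurable_noise {z : Ω → Z} {a : Ω → A} {ε y : Ω → Vec m} (hz : Measurable z)
    (ha : Measurable a) (hy : Measurable y)
    (heq : ∀ ω, y ω = act (G.M (z ω) (a ω)) θs + ε ω) : Measurable ε := by
  have : ε = fun ω => y ω - act (G.M (z ω) (a ω)) θs := by
    ext1 ω; rw [heq, add_sub_cancel_left]
  rw [this]
  exact hy.sub ((entryMeasurable_M_comp hz ha).act measurable_const)

theorem measurableSet_noiseFailure (hz : ∀ s ∈ Finset.Ico 1 t, Measurable (z s))
    (ha : ∀ s ∈ Finset.Ico 1 t, Measurable (a s)) (hε : ∀ s ∈ Finset.Ico 1 t, Measurable (ε s)) :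
    MeasurableSet (noiseFailure G lam ρ z a ε t) :=
  measurableSet_lt (((measurable_logVol hz ha).const_add _).const_mul _)
    (((entryMeasurable_covMat hz ha).dualNorm (measurable_noiseSum hz ha hε)).pow_const 2)

theorem measurable_indicator_avail {z : Ω → Z} (hz : Measurable z) :
    Measurable (Function.uncurry fun (ω : Ω) (b : A) =>
      {p : Ω × A | p.2 ∈ G.avail (z p.1)}ᶜ.indicator (1 : Ω × A → ℝ≥0∞) (ω, b)) :=
  measurable_one.indicator (Game.measurableSet_graph hz).compl

theorem measurable_act_comp {z : Ω → Z} {a : Ω → A} (hz : Measurable z) (ha : Measurable a)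
    (u : Vec d) : Measurable fun ω => act (G.M (z ω) (a ω)) u :=
  (entryMeasurable_M_comp hz ha).act measurable_const

end Measurability

namespace IsConditionalIDS

variable [MeasurableSpace A] {Ω : Type*} {mΩ : MeasurableSpace Ω} {P : Measure Ω}
  {F : Filtration ℕ mΩ} {n : ℕ} {z : ℕ → Ω → Z} {μ : ℕ → Ω → Measure A} {a : ℕ → Ω → A}
  {y ε : ℕ → Ω → Vec m} {s t : ℕ}

theorem context_history (h : G.IsConditionalIDS lam ρ B θ₀ θs P F n z μ a y ε) (ht : t ≤ n + 1)
    (hs : s ∈ Finset.Ico 1 t) : Measurable[F (t - 1)] (z s) := by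
  rw [Finset.mem_Ico] at hs
  exact (h.context_predictable s (Finset.mem_Icc.2 (by omega))).mono (F.mono (by omega)) le_rfl

theorem action_history (h : G.IsConditionalIDS lam ρ B θ₀ θs P F n z μ a y ε) (ht : t ≤ n + 1)
    (hs : s ∈ Finset.Ico 1 t) : Measurable[F (t - 1)] (a s) := by
  rw [Finset.mem_Ico] at hs
  exact (h.action_adapted s (Finset.mem_Icc.2 (by omega))).mono (F.mono (by omega)) le_rfl

theorem measurable_action (h : G.IsConditionalIDS lam ρ B θ₀ θs P F n z μ a y ε)
    (ht : t ∈ Finset.Icc 1 n) : Measurable (a t) :=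
  (h.action_adapted t ht).mono (F.le _) le_rfl

theorem lintegral_action [IsProbabilityMeasure P]
    (h : G.IsConditionalIDS lam ρ B θ₀ θs P F n z μ a y ε) (ht : t ∈ Finset.Icc 1 n)
    {g : Ω → A → ℝ≥0∞}
    (hg : Measurable[(F (t - 1) : MeasurableSpace Ω).prod inferInstance] (Function.uncurry g)) :
    ∫⁻ ω, g ω (a t ω) ∂P = ∫⁻ ω, ∫⁻ b, g ω b ∂μ t ω ∂P :=
  lintegral_of_condExp_law (F.le _) (h.measurable_action ht) (h.policy_predictable t ht)
    ((h.policy_ids t ht).mono fun _ hω => hω.1) (h.action_law t ht) hg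

variable [BorelSpace A] [SecondCountableTopology A] [TopologicalSpace.MetrizableSpace A]

theorem noise_adapted (h : G.IsConditionalIDS lam ρ B θ₀ θs P F n z μ a y ε)
    (ht : t ∈ Finset.Icc 1 n) : Measurable[F t] (ε t) :=
  @measurable_noise A Z _ _ d m G θs Ω (F t) _ _ _ _ (z t) (a t) (ε t) (y t)
    ((h.context_predictable t ht).mono (F.mono (Nat.sub_le t 1)) le_rfl) (h.action_adapted t ht)
    (h.observation_adapted t ht) (h.observation_eq t ht)

theorem noise_history (h : G.IsConditionalIDS lam ρ B θ₀ θs P F n z μ a y ε) (ht : t ≤ n + 1)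
    (hs : s ∈ Finset.Ico 1 t) : Measurable[F (t - 1)] (ε s) := by
  rw [Finset.mem_Ico] at hs
  exact (h.noise_adapted (Finset.mem_Icc.2 (by omega))).mono (F.mono (by omega)) le_rfl

/-- Supermartingale induction: given the past and the current action, the direction M_tᵀ-paired with
the new noise, namely M_t u, is known, so the new factor has conditional mean at most 1. -/
theorem lintegral_expNoise_le [IsProbabilityMeasure P]
    (h : G.IsConditionalIDS lam ρ B θ₀ θs P F n z μ a y ε) (u : Vec d) (h1 : 1 ≤ t)
    (ht : t ≤ n + 1) :
    ∫⁻ ω, G.expNoise lam ρ (fun s => z s ω) (fun s => a s ω) (fun s => ε s ω) u t ∂P ≤ 1 := by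
  induction t, h1 using Nat.le_induction with
  | base => simp [expNoise_one]
  | succ t h1 ih =>
    have htm : t ∈ Finset.Icc 1 n := Finset.mem_Icc.2 ⟨h1, by omega⟩
    simp only [expNoise_succ _ _ _ _ h1]
    have hale : MeasurableSpace.comap (a t) inferInstance ≤ mΩ :=
      (h.measurable_action htm).comap_le
    have hε : Measurable (ε t) := (h.noise_adapted htm).mono (F.le _) le_rfl
    have hle :
        ((F (t - 1) : MeasurableSpace Ω) ⊔ MeasurableSpace.comap (a t) inferInstance) ≤ mΩ := sup_le (F.le _) hale
    have hF : (F (t - 1) : MeasurableSpace Ω) ≤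
        ((F (t - 1) : MeasurableSpace Ω) ⊔ MeasurableSpace.comap (a t) inferInstance) := le_sup_left
    have ha :
        Measurable[((F (t - 1) : MeasurableSpace Ω) ⊔ MeasurableSpace.comap (a t) inferInstance)] (a t) :=
      (comap_measurable (a t)).mono (le_sup_right (a := (F (t - 1) : MeasurableSpace Ω))) le_rfl
    have hz :
        Measurable[((F (t - 1) : MeasurableSpace Ω) ⊔ MeasurableSpace.comap (a t) inferInstance)] (z t) := (h.context_predictable t htm).mono hF le_rfl
    have hU :=
      @measurable_act_comp A Z _ _ d m G Ω
        ((F (t - 1) : MeasurableSpace Ω) ⊔ MeasurableSpace.comap (a t) inferInstance) _ _ _ _ (z t) (a t) hz ha u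
    have hD := (@measurable_expNoise A Z _ _ d m G lam ρ Ω (F (t - 1)) _ _ _ _ z a ε t
      (fun s hs => h.context_history (by omega) hs) (fun s hs => h.action_history (by omega) hs)
      (fun s hs => h.noise_history (by omega) hs)).comp
        (@measurable_prodMk_right _ _ (F (t - 1)) _ u)
    exact (lintegral_mul_exp_inner_le hle hε (h.noise_integrable t htm)
      (h.noise_subgaussian t htm) hU (hD.mono hF le_rfl)).trans (ih (by omega))

/-- Tonelli: average the bound for each u against the Gaussian weight, then cancel its finite
positive mass. -/
theorem lintegral_mixture_le [IsProbabilityMeasure P]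
    (h : G.IsConditionalIDS lam ρ B θ₀ θs P F n z μ a y ε) (hlam : 0 < lam) (hρ : 0 < ρ)
    (h1 : 1 ≤ t) (ht : t ≤ n + 1) :
    ∫⁻ ω, ENNReal.ofReal
      (G.mixture lam ρ (fun s => z s ω) (fun s => a s ω) (fun s => ε s ω) t) ∂P ≤ 1 := by
  set w : Vec d → ℝ≥0∞ := fun u => ENNReal.ofReal (Real.exp (-(ρ ^ 2 / 2 * lam * ‖u‖ ^ 2))) with hw
  obtain ⟨hw0, hw1⟩ := lintegral_exp_neg_sq_pos_finite (d := d) (r := ρ ^ 2 / 2 * lam)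
    (by positivity)
  have hz : ∀ s ∈ Finset.Ico 1 t, Measurable (z s) := fun s hs =>
    (h.context_history ht hs).mono (F.le _) le_rfl
  have ha : ∀ s ∈ Finset.Ico 1 t, Measurable (a s) := fun s hs =>
    (h.action_history ht hs).mono (F.le _) le_rfl
  have hε : ∀ s ∈ Finset.Ico 1 t, Measurable (ε s) := fun s hs =>
    (h.noise_history ht hs).mono (F.le _) le_rfl
  have hwm : Measurable w := by simp only [hw]; fun_prop
  have hD := measurable_expNoise (G := G) (lam := lam) (ρ := ρ) hz ha hε
  have key : (∫⁻ ω, ENNReal.ofReal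
      (G.mixture lam ρ (fun s => z s ω) (fun s => a s ω) (fun s => ε s ω) t) ∂P) * ∫⁻ u, w u
      ≤ 1 * ∫⁻ u, w u := by
    rw [← lintegral_mul_const' _ _ hw1]
    calc _ = ∫⁻ ω, ∫⁻ u, w u * G.expNoise lam ρ (fun s => z s ω) (fun s => a s ω)
            (fun s => ε s ω) u t ∂volume ∂P :=
          lintegral_congr fun ω => (lintegral_expNoise_mul hlam hρ _ _ _ t).symm
      _ = ∫⁻ u, ∫⁻ ω, w u * G.expNoise lam ρ (fun s => z s ω) (fun s => a s ω)
            (fun s => ε s ω) u t ∂P := by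
          refine lintegral_lintegral_swap (Measurable.aemeasurable ?_)
          exact (hwm.comp measurable_snd).mul hD
      _ ≤ ∫⁻ u, w u := by
          refine lintegral_mono fun u => ?_
          rw [lintegral_const_mul' _ _ ENNReal.ofReal_ne_top]
          exact mul_le_of_le_one_right' (h.lintegral_expNoise_le u h1 ht)
      _ = _ := (one_mul _).symm
  exact (ENNReal.mul_le_mul_iff_left hw0 hw1).1 key

theorem measurableSet_failure (h : G.IsConditionalIDS lam ρ B θ₀ θs P F n z μ a y ε)
    (ht : t ≤ n + 1) : MeasurableSet[F (t - 1)] (noiseFailure G lam ρ z a ε t) :=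
  @Game.measurableSet_noiseFailure A Z _ _ d m G lam ρ Ω (F (t - 1)) _ _ _ _ z a ε t
    (fun _ hs => h.context_history ht hs) (fun _ hs => h.action_history ht hs)
    (fun _ hs => h.noise_history ht hs)

theorem measurable_mixture_process (h : G.IsConditionalIDS lam ρ B θ₀ θs P F n z μ a y ε)
    (ht : t ≤ n + 1) : Measurable fun ω =>
      G.mixture lam ρ (fun s => z s ω) (fun s => a s ω) (fun s => ε s ω) t :=
  measurable_mixture (fun _ hs => (h.context_history ht hs).mono (F.le _) le_rfl)
    (fun _ hs => (h.action_history ht hs).mono (F.le _) le_rfl)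
    (fun _ hs => (h.noise_history ht hs).mono (F.le _) le_rfl)

theorem measure_noiseFailure_le [IsProbabilityMeasure P]
    (h : G.IsConditionalIDS lam ρ B θ₀ θs P F n z μ a y ε) (hlam : 0 < lam) (hρ : 0 < ρ)
    (h1 : 1 ≤ t) (ht : t ≤ n + 1) :
    P (noiseFailure G lam ρ z a ε t) ≤ ENNReal.ofReal (1 / (t : ℝ) ^ (3 / 2 : ℝ)) := by
  have ht0 : (0 : ℝ) < (t : ℝ) ^ (3 / 2 : ℝ) := by positivity
  have hsub : noiseFailure G lam ρ z a ε t ⊆ {ω | ENNReal.ofReal ((t : ℝ) ^ (3 / 2 : ℝ)) ≤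
      ENNReal.ofReal (G.mixture lam ρ (fun s => z s ω) (fun s => a s ω) (fun s => ε s ω) t)} :=
    fun ω hω => ENNReal.ofReal_le_ofReal (lt_mixture_of_mem hρ h1 hω)
  refine (measure_mono hsub).trans ?_
  refine (meas_ge_le_lintegral_div
    (h.measurable_mixture_process ht).ennreal_ofReal.aemeasurable (by simpa using ht0)
    ENNReal.ofReal_ne_top).trans ?_
  rw [one_div, ENNReal.ofReal_inv_of_pos ht0, ENNReal.div_eq_inv_mul]
  exact mul_le_of_le_one_right' (h.lintegral_mixture_le hlam hρ h1 ht)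

/-- A failure bound that vanishes with the expected information, needed because the global regret
bound has no additive constant. Markov's inequality is applied to the excess of the mixture over 1,
which e^x ≥ 1 + x makes nonnegative after adding the total information. -/
theorem measure_noiseFailure_le_mul_info [IsProbabilityMeasure P]
    (h : G.IsConditionalIDS lam ρ B θ₀ θs P F n z μ a y ε) (hlam : 0 < lam) (hρ : 0 < ρ)
    (h1 : 1 ≤ t) (ht : t ≤ n + 1) :
    P (noiseFailure G lam ρ z a ε t)
      ≤ ENNReal.ofReal (2 / (t : ℝ) ^ (3 / 2 : ℝ)) * G.expTotalInfo lam P n z a := by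
  rcases h1.eq_or_lt with rfl | h2
  · simp [noiseFailure_one]
  have htr : (2 : ℝ) ≤ t := by exact_mod_cast h2
  have ht2 : (2 : ℝ) ≤ (t : ℝ) ^ (3 / 2 : ℝ) := by
    calc (2 : ℝ) ≤ t := htr
      _ = (t : ℝ) ^ (1 : ℝ) := (Real.rpow_one _).symm
      _ ≤ _ := Real.rpow_le_rpow_of_exponent_le (by linarith) (by norm_num)
  set x := (t : ℝ) ^ (3 / 2 : ℝ) with hx
  set f := noiseFailure G lam ρ z a ε t with hf
  have hfm : MeasurableSet f := F.le _ _ (h.measurableSet_failure ht)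
  set N := fun ω => G.mixture lam ρ (fun s => z s ω) (fun s => a s ω) (fun s => ε s ω) t with hN
  -- On the event the mixture is at least x ≥ x/2 + 1, as x ≥ 2 for t ≥ 2. Off it the mixture is at
  -- least 1 - `logVol` / 2, and half the volume is at most the total gain. Integrating, the two
  -- ones cancel since the mixture has mean at most 1.
  have hpt : ∀ ω, f.indicator (fun _ => ENNReal.ofReal (x / 2)) ω + 1 ≤ ENNReal.ofReal (N ω)
      + ENNReal.ofReal (∑ s ∈ Finset.Icc 1 n, G.infoGain
        (G.covMat lam (fun s => z s ω) (fun s => a s ω) s) (a s ω) (z s ω)) := by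
    intro ω
    have hl := logVol_half_le_sum (G := G) (n := n) (t := t) hlam (z := fun s => z s ω)
      (a := fun s => a s ω) h1 ht
    have hl0 := logVol_nonneg (G := G) (fun s => z s ω) (fun s => a s ω) hlam h1
    rw [← ENNReal.ofReal_add (show 0 ≤ N ω from (Real.exp_pos _).le) (by linarith)]
    by_cases hω : ω ∈ f
    · have := lt_mixture_of_mem hρ h1 hω
      rw [Set.indicator_of_mem hω, ← ENNReal.ofReal_one, ← ENNReal.ofReal_add (by linarith) one_pos.le]
      refine ENNReal.ofReal_le_ofReal ?_
      simp only [hN]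
      linarith
    · rw [Set.indicator_of_notMem hω, zero_add, ← ENNReal.ofReal_one]
      refine ENNReal.ofReal_le_ofReal ?_
      have h3 := Real.add_one_le_exp (dualNorm (G.covMat lam (fun s => z s ω) (fun s => a s ω) t)
        (G.noiseSum (fun s => z s ω) (fun s => a s ω) (fun s => ε s ω) t) ^ 2 / (2 * ρ ^ 2)
          - G.logVol lam (fun s => z s ω) (fun s => a s ω) t / 2)
      have h4 : 0 ≤ dualNorm (G.covMat lam (fun s => z s ω) (fun s => a s ω) t)
        (G.noiseSum (fun s => z s ω) (fun s => a s ω) (fun s => ε s ω) t) ^ 2 / (2 * ρ ^ 2) := by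
        positivity
      simp only [hN, mixture]
      linarith
  have hint := lintegral_mono (μ := P) hpt
  rw [lintegral_add_right _ measurable_const, lintegral_indicator_const hfm,
    lintegral_add_left (h.measurable_mixture_process ht).ennreal_ofReal] at hint
  have hint' : ENNReal.ofReal (x / 2) * P f + 1 ≤ G.expTotalInfo lam P n z a + 1 := by
    calc _ = ENNReal.ofReal (x / 2) * P f + ∫⁻ _, 1 ∂P := by simp
      _ ≤ _ := hint
      _ ≤ _ := by
        rw [add_comm]
        exact add_le_add_right (h.lintegral_mixture_le hlam hρ h1 ht) _
  have hle := (ENNReal.add_le_add_iff_right ENNReal.one_ne_top).1 hint'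
  calc P f = ENNReal.ofReal (2 / x) * (ENNReal.ofReal (x / 2) * P f) := by
        rw [← mul_assoc, ← ENNReal.ofReal_mul (by positivity), div_mul_div_cancel₀ (by positivity),
          div_self two_ne_zero, ENNReal.ofReal_one, one_mul]
    _ ≤ _ := by gcongr

/-- The sampling distributions are carried by the available sets; the transfer formula, applied to
the indicator of the complement of the graph, carries this over to the played actions. -/
theorem ae_mem_avail [IsProbabilityMeasure P]
    (h : G.IsConditionalIDS lam ρ B θ₀ θs P F n z μ a y ε) :
    ∀ᵐ ω ∂P, ∀ t ∈ Finset.Icc 1 n, a t ω ∈ G.avail (z t ω) := by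
  refine (ae_ball_iff (Finset.countable_toSet _)).2 fun t ht => ?_
  have hg := @measurable_indicator_avail A Z _ _ d m G Ω (F (t - 1)) _ _ _ _ (z t)
    (h.context_predictable t ht)
  set g : Ω → A → ℝ≥0∞ := fun ω b =>
    {p : Ω × A | p.2 ∈ G.avail (z t p.1)}ᶜ.indicator (1 : Ω × A → ℝ≥0∞) (ω, b)
  have hz : ∫⁻ ω, g ω (a t ω) ∂P = 0 := by
    rw [h.lintegral_action ht hg]
    refine (lintegral_congr_ae ?_).trans (lintegral_zero)
    filter_upwards [h.policy_ids t ht] with ω hω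
    refine (lintegral_congr_ae ?_).trans (lintegral_zero)
    filter_upwards [ae_of_compl_eq_zero hω.2.1] with b hb
    simp [g, hb]
  rw [lintegral_eq_zero_iff] at hz
  · filter_upwards [hz] with ω hω
    by_contra hc
    simp [g, hc] at hω
  · have := (hg.mono (sup_le_sup (MeasurableSpace.comap_mono (F.le _)) le_rfl) le_rfl)
    exact this.comp (measurable_id.prodMk (h.measurable_action ht))

end IsConditionalIDS

end Game

/-- The margin between the high-probability radius of the noise and the confidence radius. -/
theorem exists_margin {ρ b C l₀ : ℝ} (hρ : 0 < ρ) (hb : 0 ≤ b) (hC : 0 ≤ C) (hl₀ : 0 < l₀) :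
    ∃ κ > 0, ∃ ζ > 0, ∀ l, l₀ ≤ l → ∀ v, 0 ≤ v → v ≤ C * l →
      ρ * √(3 * l + v) + b + κ * √l ≤ ρ * √(4 * l + v) + b ∧
      ρ * √(3 * l + v) + b ≤ (1 - ζ) * (ρ * √(4 * l + v) + b) := by
  set D := √(4 + C) with hD
  have hD0 : 0 < D := Real.sqrt_pos.2 (by linarith)
  have hs0 : 0 < √l₀ := Real.sqrt_pos.2 hl₀
  set κ := ρ / (2 * D) with hκ
  have hκ0 : 0 < κ := by positivity
  set T := ρ * D + b / √l₀ with hT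
  have hT0 : 0 < T := by positivity
  refine ⟨κ, hκ0, κ / T, by positivity, fun l hl v hv hvl => ?_⟩
  have hl0 : 0 < l := hl₀.trans_le hl
  have hsl : 0 < √l := Real.sqrt_pos.2 hl0
  have h4 : √(4 * l + v) ≤ D * √l := by
    rw [hD, ← Real.sqrt_mul (by linarith)]
    exact Real.sqrt_le_sqrt (by linarith)
  have hx : 0 < √(4 * l + v) := Real.sqrt_pos.2 (by linarith)
  -- The difference of the roots is l divided by their sum, and the sum is at most 2 D √l because v
  -- ≤ C l.
  have hkey : √(3 * l + v) + √l / (2 * D) ≤ √(4 * l + v) := by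
    have h3 : √(3 * l + v) ≤ √(4 * l + v) := Real.sqrt_le_sqrt (by linarith)
    have e3 := Real.sq_sqrt (show 0 ≤ 3 * l + v by linarith)
    have e4 := Real.sq_sqrt (show 0 ≤ 4 * l + v by linarith)
    have el := Real.sq_sqrt hl0.le
    have hprod : l ≤ (√(4 * l + v) - √(3 * l + v)) * (2 * (D * √l)) := by
      calc l = (√(4 * l + v) - √(3 * l + v)) * (√(4 * l + v) + √(3 * l + v)) := by linarith
        _ ≤ _ := mul_le_mul_of_nonneg_left (by linarith) (by linarith)
    have : √l / (2 * D) ≤ √(4 * l + v) - √(3 * l + v) := by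
      rw [div_le_iff₀ (by positivity)]
      refine le_of_mul_le_mul_right ?_ hsl
      calc √l * √l = l := Real.mul_self_sqrt hl0.le
        _ ≤ _ := hprod
        _ = _ := by ring
    linarith
  have h1 : ρ * √(3 * l + v) + b + κ * √l ≤ ρ * √(4 * l + v) + b := by
    have := mul_le_mul_of_nonneg_left hkey hρ.le
    have e : ρ * (√(3 * l + v) + √l / (2 * D)) = ρ * √(3 * l + v) + κ * √l := by
      rw [hκ]; ring
    linarith
  refine ⟨h1, ?_⟩
  -- The whole radius is also of order √l, with l ≥ l₀ absorbing b. The margin is therefore a fixed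
  -- fraction ζ = κ / T of it.
  have hsT : ρ * √(4 * l + v) + b ≤ T * √l := by
    have hbl : b ≤ b / √l₀ * √l := by
      rw [div_mul_eq_mul_div, le_div_iff₀ hs0]
      exact mul_le_mul_of_nonneg_left (Real.sqrt_le_sqrt hl) hb
    have := mul_le_mul_of_nonneg_left h4 hρ.le
    rw [hT, add_mul]
    linarith
  have : κ / T * (ρ * √(4 * l + v) + b) ≤ κ * √l := by
    calc κ / T * (ρ * √(4 * l + v) + b) ≤ κ / T * (T * √l) :=
          mul_le_mul_of_nonneg_left hsT (by positivity)
      _ = κ * √l := by field_simp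
  linarith

namespace Game

variable {A Z : Type*} [TopologicalSpace A] [MeasurableSpace Z] {d m : ℕ} {G : Game A Z d m}
  {lam ρ B L : ℝ} {θ₀ θs : Vec d} {z : ℕ → Z} {a : ℕ → A} {y ε : ℕ → Vec m} {t n : ℕ}

/-! ### The confidence set of a round -/

/-- The radius `β_t^{1/2}` of the confidence set. -/
noncomputable def radius (G : Game A Z d m) (lam ρ B : ℝ) (z : ℕ → Z) (a : ℕ → A) (t : ℕ) : ℝ :=
  ρ * √(4 * Real.log t + G.logVol lam z a t) + √lam * B

theorem confCoef_eq (z : ℕ → Z) (a : ℕ → A) (t : ℕ) :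
    G.confCoef lam ρ B z a t = G.radius lam ρ B z a t ^ 2 := by
  rw [confCoef, radius, logVol, Real.log_pow, ← add_sub_assoc]
  congr 5
  push_cast
  ring

theorem confSet_eq (θ₀ : Vec d) (z : ℕ → Z) (a : ℕ → A) (y : ℕ → Vec m) (t : ℕ) :
    G.confSet lam ρ B θ₀ z a y t
      = ellipsoid (G.covMat lam z a t) (G.lsEstimate lam θ₀ z a y t) (G.radius lam ρ B z a t) := by
  rw [confSet, confCoef_eq]
  rfl

theorem radius_nonneg (hρ : 0 < ρ) (hB : 0 ≤ B) : 0 ≤ G.radius lam ρ B z a t := by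
  rw [radius]; positivity

theorem radius_mono (hlam : 0 < lam) (hρ : 0 < ρ) {s : ℕ} (hs : 1 ≤ s) (hst : s ≤ t) :
    G.radius lam ρ B z a s ≤ G.radius lam ρ B z a t := by
  have h1 := logVol_mono (G := G) z a hlam hs hst
  have h2 : Real.log s ≤ Real.log t :=
    Real.log_le_log (by exact_mod_cast hs) (by exact_mod_cast hst)
  rw [radius, radius]
  gcongr

theorem le_radius_sq (hlam : 0 < lam) (hρ : 0 < ρ) (hB : 0 ≤ B) (ht : 2 ≤ t) :
    4 * Real.log 2 * ρ ^ 2 ≤ G.radius lam ρ B z a t ^ 2 := by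
  have h1 := logVol_nonneg (G := G) z a hlam (show 1 ≤ t by omega)
  have h2 : Real.log 2 ≤ Real.log t := Real.log_le_log (by norm_num) (by exact_mod_cast ht)
  have h0 : 0 < Real.log 2 := Real.log_pos one_lt_two
  calc 4 * Real.log 2 * ρ ^ 2 ≤ (4 * Real.log t + G.logVol lam z a t) * ρ ^ 2 := by
        gcongr; linarith
    _ = (ρ * √(4 * Real.log t + G.logVol lam z a t)) ^ 2 := by
        rw [mul_pow, Real.sq_sqrt (by linarith), mul_comm]
    _ ≤ _ := by
        rw [radius]
        gcongr
        exact le_add_of_nonneg_right (by positivity)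

theorem lsEstimate_sub (hlam : 0 < lam)
    (hy : ∀ s ∈ Finset.Ico 1 t, y s = act (G.M (z s) (a s)) θs + ε s) :
    G.lsEstimate lam θ₀ z a y t - θs
      = act (G.covMat lam z a t)⁻¹ (G.noiseSum z a ε t + lam • (θ₀ - θs)) := by
  have hV := posDef_isUnit_det (covMat_posDef (G := G) z a hlam t)
  have h1 : act (G.covMat lam z a t) θs = lam • θs
      + ∑ s ∈ Finset.Ico 1 t, act (G.M (z s) (a s))ᵀ (act (G.M (z s) (a s)) θs) := by
    simp only [covMat, act, map_add, LinearMap.add_apply, map_sum, LinearMap.sum_apply, map_smul,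
      LinearMap.smul_apply]
    congr 1
    · congr 1; exact act_one θs
    · exact Finset.sum_congr rfl fun s _ => act_mul _ _ _
  have h2 : lam • θ₀ + ∑ s ∈ Finset.Ico 1 t, act (G.M (z s) (a s))ᵀ (y s)
      = (G.noiseSum z a ε t + lam • (θ₀ - θs)) + act (G.covMat lam z a t) θs := by
    rw [h1, noiseSum, Finset.sum_congr rfl fun s hs => by rw [hy s hs, map_add],
      Finset.sum_add_distrib, smul_sub]
    abel
  rw [lsEstimate, h2, map_add, act_inv_act hV, add_sub_cancel_right]

/-- The estimation error is V_t⁻¹ applied to accumulated noise plus the regularisation bias λ (θ₀ -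
θ*), whose dual norm is at most √λ B because V_t ≥ λ. -/
theorem sqrt_quad_sub_lsEstimate_le (hlam : 0 < lam) (hρ : 0 < ρ) (ht : 1 ≤ t)
    (hθ : ‖θs - θ₀‖ ≤ B)
    (hy : ∀ s ∈ Finset.Ico 1 t, y s = act (G.M (z s) (a s)) θs + ε s)
    (hgood : dualNorm (G.covMat lam z a t) (G.noiseSum z a ε t) ^ 2
      ≤ ρ ^ 2 * (3 * Real.log t + G.logVol lam z a t)) :
    √(quad (G.covMat lam z a t) (θs - G.lsEstimate lam θ₀ z a y t))
      ≤ ρ * √(3 * Real.log t + G.logVol lam z a t) + √lam * B := by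
  have hV := covMat_posDef (G := G) z a hlam t
  have hl : 0 ≤ 3 * Real.log t + G.logVol lam z a t := by
    have := logVol_nonneg (G := G) z a hlam ht
    have := Real.log_nonneg (show (1 : ℝ) ≤ t by exact_mod_cast ht)
    linarith
  have e : √(quad (G.covMat lam z a t) (θs - G.lsEstimate lam θ₀ z a y t))
      = dualNorm (G.covMat lam z a t) (G.noiseSum z a ε t + lam • (θ₀ - θs)) := by
    rw [← neg_sub, quad_neg, lsEstimate_sub hlam hy, quad_act_inv hV, dualNorm]
  rw [e]
  refine (dualNorm_add_le hV _ _).trans (add_le_add ?_ ?_)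
  · refine abs_le_of_sq_le_sq' ?_ (by positivity) |>.2
    rwa [mul_pow, Real.sq_sqrt hl]
  · rw [dualNorm_smul hV, abs_of_pos hlam]
    calc lam * dualNorm (G.covMat lam z a t) (θ₀ - θs) ≤ lam * (‖θ₀ - θs‖ / √lam) := by
          gcongr
          exact dualNorm_le hlam hV (le_quad_covMat z a t) _
      _ = √lam * ‖θ₀ - θs‖ := by
          rw [mul_div_assoc', div_eq_iff (Real.sqrt_pos.2 hlam).ne']
          nth_rewrite 1 [← Real.mul_self_sqrt hlam.le]
          ring
      _ ≤ √lam * B := by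
          rw [norm_sub_rev]
          gcongr

/-- From 1 + tU ≤ t (1 + U), with log 2 ≤ log t turning the constant into a multiple of log t. This
is the hypothesis v ≤ C l of `exists_margin`. -/
theorem logVol_le_mul_log (hlam : 0 < lam) (hB : G.Bounded L) (ht : 2 ≤ t)
    (ha : ∀ s ∈ Finset.Ico 1 t, a s ∈ G.avail (z s)) :
    G.logVol lam z a t
      ≤ d * (1 + Real.log (1 + d * L ^ 2 / lam) / Real.log 2) * Real.log t := by
  have ht' : (2 : ℝ) ≤ t := by exact_mod_cast ht
  have hU : 0 ≤ d * L ^ 2 / lam := by positivity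
  have h2 : 0 < Real.log 2 := Real.log_pos one_lt_two
  have hlog : Real.log 2 ≤ Real.log t := Real.log_le_log (by norm_num) ht'
  have hlU : 0 ≤ Real.log (1 + d * L ^ 2 / lam) := Real.log_nonneg (by linarith)
  refine (logVol_le z a hlam hB (by omega) ha).trans ?_
  rw [mul_assoc]
  gcongr
  calc Real.log (1 + t * (d * L ^ 2 / lam)) ≤ Real.log (t * (1 + d * L ^ 2 / lam)) := by
        refine Real.log_le_log (by positivity) ?_
        rw [mul_add]; linarith
    _ = Real.log t + Real.log (1 + d * L ^ 2 / lam) :=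
        Real.log_mul (by positivity) (by positivity)
    _ ≤ Real.log t + Real.log (1 + d * L ^ 2 / lam) / Real.log 2 * Real.log t := by
        gcongr
        rw [div_mul_eq_mul_div, le_div_iff₀ h2]
        gcongr
    _ = _ := by ring

/-! ### Regret of a single round -/

section Round

variable [MeasurableSpace A]

theorem integral_gap_nonneg {z : Z} {μ : Measure A} (hμ : μ (G.avail z)ᶜ = 0) (θ : Vec d) :
    0 ≤ ∫ b, G.gap b z θ ∂μ :=
  integral_nonneg_of_ae ((ae_of_compl_eq_zero hμ).mono fun _ hb => gap_nonneg hb θ)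

variable [BorelSpace A]

theorem integrable_infoGain (hlam : 0 < lam) {V : Matrix (Fin d) (Fin d) ℝ} (hV : V.PosDef)
    (hVl : ∀ v, lam * ‖v‖ ^ 2 ≤ quad V v) (hB : G.Bounded L) {z : Z} {μ : Measure A}
    [IsFiniteMeasure μ] (hμ : μ (G.avail z)ᶜ = 0) :
    Integrable (fun b => G.infoGain V b z) μ :=
  integrable_of_bounded hμ (continuous_infoGain G hV z).measurable
    fun b hb => ⟨infoGain_nonneg hV b z, infoGain_le_const hlam hV hVl hB hb⟩

theorem integrable_infoGain_sq (hlam : 0 < lam) {V : Matrix (Fin d) (Fin d) ℝ} (hV : V.PosDef)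
    (hVl : ∀ v, lam * ‖v‖ ^ 2 ≤ quad V v) (hB : G.Bounded L) {z : Z} {μ : Measure A}
    [IsFiniteMeasure μ] (hμ : μ (G.avail z)ᶜ = 0) :
    Integrable (fun b => G.infoGain V b z ^ 2) μ :=
  integrable_of_bounded hμ ((continuous_infoGain G hV z).measurable.pow_const 2)
    fun b hb => ⟨sq_nonneg _, pow_le_pow_left₀ (infoGain_nonneg hV b z)
      (infoGain_le_const hlam hV hVl hB hb) 2⟩

theorem integrable_gapEstimate (hlam : 0 < lam) {V : Matrix (Fin d) (Fin d) ℝ} (hV : V.PosDef)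
    (hVl : ∀ v, lam * ‖v‖ ^ 2 ≤ quad V v) {c : Vec d} {s : ℝ} (hs : 0 ≤ s) (hB : G.Bounded L)
    {z : Z} {μ : Measure A} [IsFiniteMeasure μ] (hμ : μ (G.avail z)ᶜ = 0) :
    Integrable (fun b => G.gapEstimate (ellipsoid V c s) b z) μ :=
  integrable_of_bounded hμ (continuous_gapEstimate G hV hs z).measurable
    fun _ hb => ⟨gapEstimate_nonneg hV hs hb, gapEstimate_le_const hlam hV hVl hs hB hb⟩

variable [SecondCountableTopology A]

theorem measurable_gap_action (G : Game A Z d m) (z : Z) (θ : Vec d) :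
    Measurable fun b => G.gap b z θ := by
  have h : Measurable fun p : Z × A => G.gap p.2 p.1 θ := measurable_gap measurable_id θ
  exact h.comp (measurable_prodMk_left (x := z))

theorem integrable_gap (hB : G.Bounded L) {z : Z} {μ : Measure A} [IsFiniteMeasure μ]
    (hμ : μ (G.avail z)ᶜ = 0) (θ : Vec d) : Integrable (fun b => G.gap b z θ) μ :=
  integrable_of_bounded hμ (measurable_gap_action G z θ)
    fun _ hb => ⟨gap_nonneg hb θ, gap_le_norm hB hb θ⟩

theorem integral_gap_le (hB : G.Bounded L) {z : Z} {μ : Measure A} [IsProbabilityMeasure μ]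
    (hμ : μ (G.avail z)ᶜ = 0) {θ : Vec d} {c : ℝ} (hc : ∀ b ∈ G.avail z, G.gap b z θ ≤ c) :
    ∫ b, G.gap b z θ ∂μ ≤ c := by
  calc ∫ b, G.gap b z θ ∂μ ≤ ∫ _, c ∂μ :=
        integral_mono_ae (integrable_gap hB hμ θ) (integrable_const c)
          ((ae_of_compl_eq_zero hμ).mono hc)
    _ = c := by simp

end Round

end Game

/-- The information charged to a round: half the information gain `I` as long as the accumulated
volume `v` is at most `ℓ`, and `I + K I²` afterwards. -/
noncomputable def infoBudget (K ℓ v I : ℝ) : ℝ := if v ≤ ℓ then I / 2 else I + K * I ^ 2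

theorem infoBudget_nonneg {K ℓ v I : ℝ} (hK : 0 ≤ K) (hI : 0 ≤ I) : 0 ≤ infoBudget K ℓ v I := by
  rw [infoBudget]; split_ifs <;> positivity

theorem sq_integral_le {A : Type*} [MeasurableSpace A] {μ : Measure A} [IsProbabilityMeasure μ]
    {f : A → ℝ} (hf : Integrable f μ) (hf2 : Integrable (fun b => f b ^ 2) μ) :
    (∫ b, f b ∂μ) ^ 2 ≤ ∫ b, f b ^ 2 ∂μ := by
  set c := ∫ b, f b ∂μ with hc
  have h : 0 ≤ ∫ b, (f b - c) ^ 2 ∂μ := integral_nonneg fun _ => sq_nonneg _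
  have e : ∫ b, (f b - c) ^ 2 ∂μ = (∫ b, f b ^ 2 ∂μ) - 2 * c * c + c ^ 2 := by
    have : ∀ b, (f b - c) ^ 2 = f b ^ 2 - 2 * c * f b + c ^ 2 := fun b => by ring
    have hi : Integrable (fun b => f b ^ 2 - 2 * c * f b) μ := hf2.sub (hf.const_mul _)
    simp only [this]
    rw [integral_add hi (integrable_const _), integral_sub hf2 (hf.const_mul _), integral_const_mul,
      integral_const, ← hc]
    simp
  linarith

/-! ### Paying for the second-order terms, and the regret of a good round. -/

namespace Game

variable {A Z : Type*} [TopologicalSpace A] [MeasurableSpace Z] {d m : ℕ} {G : Game A Z d m}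
  {lam ρ B L : ℝ} {θ₀ θs : Vec d} {z : ℕ → Z} {a : ℕ → A} {y ε : ℕ → Vec m} {t n : ℕ}

/-- If the volume stays below ℓ, every round is charged half. Otherwise the rounds before the first
crossing carry total gain at least ℓ/2, since the volume is twice the gain so far. They save at
least ℓ/4, which dominates K ∑ I². -/
theorem sum_infoBudget_le (hlam : 0 < lam) (hB : G.Bounded L) {K ℓ : ℝ} (hK : 0 ≤ K)
    (hℓ : 4 * K * (d * L ^ 2 * (1 + d * L ^ 2 / lam) * (d / lam) / 4) ≤ ℓ)
    (ha : ∀ s ∈ Finset.Icc 1 n, a s ∈ G.avail (z s)) :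
    ∑ t ∈ Finset.Icc 1 n, infoBudget K ℓ (G.logVol lam z a t)
        (G.infoGain (G.covMat lam z a t) (a t) (z t))
      ≤ ∑ t ∈ Finset.Icc 1 n, G.infoGain (G.covMat lam z a t) (a t) (z t) := by
  set I : ℕ → ℝ := fun t => G.infoGain (G.covMat lam z a t) (a t) (z t) with hI
  set v : ℕ → ℝ := fun t => G.logVol lam z a t with hv
  have hI0 : ∀ t, 0 ≤ I t := fun t => infoGain_nonneg (covMat_posDef z a hlam t) _ _
  by_cases hH : ∀ t ∈ Finset.Icc 1 n, v t ≤ ℓ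
  · refine Finset.sum_le_sum fun t ht => ?_
    rw [infoBudget, if_pos (hH t ht)]
    have : 0 ≤ I t := hI0 t
    change I t / 2 ≤ I t
    linarith
  classical
  push Not at hH
  set τ := Nat.find hH with hτ
  obtain ⟨hτm, hτv⟩ := Nat.find_spec hH
  have hτm' := Finset.mem_Icc.1 hτm
  have hbefore : ∀ s ∈ Finset.Ico 1 τ, s ∈ Finset.Icc 1 n ∧ v s ≤ ℓ := by
    intro s hs
    rw [Finset.mem_Ico] at hs
    have hsn : s ∈ Finset.Icc 1 n := Finset.mem_Icc.2 ⟨hs.1, by omega⟩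
    refine ⟨hsn, ?_⟩
    by_contra hc
    exact Nat.find_min hH hs.2 ⟨hsn, not_le.1 hc⟩
  have hsq := sum_infoGain_sq_le (G := G) z a hlam hB ha
  have h1 : ∑ s ∈ Finset.Ico 1 τ, I s ≤ ∑ t ∈ Finset.Icc 1 n, if v t ≤ ℓ then I t else 0 := by
    rw [← Finset.sum_filter]
    exact Finset.sum_le_sum_of_subset_of_nonneg
      (fun s hs => Finset.mem_filter.2 (hbefore s hs)) fun s _ _ => hI0 s
  have h2 : ℓ ≤ 2 * ∑ s ∈ Finset.Ico 1 τ, I s := by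
    rw [← logVol_eq_sum (G := G) z a hlam hτm'.1]
    exact hτv.le
  have h3 : ∑ t ∈ Finset.Icc 1 n, infoBudget K ℓ (v t) (I t) ≤ ∑ t ∈ Finset.Icc 1 n,
      (I t - (if v t ≤ ℓ then I t else 0) / 2 + K * I t ^ 2) := by
    refine Finset.sum_le_sum fun t _ => ?_
    have := mul_nonneg hK (sq_nonneg (I t))
    rw [infoBudget]
    split_ifs <;> linarith
  rw [Finset.sum_add_distrib, Finset.sum_sub_distrib, ← Finset.sum_div, ← Finset.mul_sum] at h3
  have h4 := mul_le_mul_of_nonneg_left hsq hK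
  change K * ∑ t ∈ Finset.Icc 1 n, I t ^ 2 ≤ _ at h4
  change ∑ t ∈ Finset.Icc 1 n, infoBudget K ℓ (v t) (I t) ≤ _
  linarith

theorem lsEstimate_one (hlam : 0 < lam) (z : ℕ → Z) (a : ℕ → A) (y : ℕ → Vec m) :
    G.lsEstimate lam θ₀ z a y 1 = θ₀ := by
  have h : act (G.covMat lam z a 1) θ₀ = lam • θ₀ := by
    rw [covMat_one]; simp [act]
  rw [lsEstimate, Finset.Ico_self, Finset.sum_empty, add_zero, ← h,
    act_inv_act (posDef_isUnit_det (covMat_posDef z a hlam 1))]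

section Round

variable [MeasurableSpace A] [BorelSpace A] [SecondCountableTopology A] [T2Space A] {zt : Z}
  {μ : Measure A}

/-- Replaces the factor I (1 + K I) of `IsIDS.local_bound` by the budget of the round. `hmargin`
asks that the slack of the confidence radius suffice for the factor κ between gap estimate and gap
while the volume is at most ℓ. -/
theorem IsIDS.local_round (hlam : 0 < lam) (hρ : 0 < ρ) (hB0 : 0 ≤ B) (hB : G.Bounded L)
    (h1 : 1 ≤ t) (hθ : ‖θs - θ₀‖ ≤ B)
    (hy : ∀ s ∈ Finset.Ico 1 t, y s = act (G.M (z s) (a s)) θs + ε s)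
    (hgood : dualNorm (G.covMat lam z a t) (G.noiseSum z a ε t) ^ 2
      ≤ ρ ^ 2 * (3 * Real.log t + G.logVol lam z a t))
    (hμ : G.IsIDS (G.confSet lam ρ B θ₀ z a y t) (G.covMat lam z a t) zt μ)
    (hα : G.localAlignment (G.confSet lam ρ B θ₀ z a y t) zt ≠ ⊤)
    {K ℓ κ : ℝ} (hK : K = 4 * (1 + d * L ^ 2 / lam / 2) ^ 2) (hκ : 1 ≤ κ)
    (hκK : 2 * (1 + K * (d * L ^ 2 / lam / 2)) ≤ κ ^ 2)
    (hmargin : ρ * √(3 * Real.log t + G.logVol lam z a t) + √lam * B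
      + (κ - 1) * (√(lam * Real.exp ℓ) * (‖θ₀‖ + B + 1)) ≤ G.radius lam ρ B z a t) :
    (∫ b, G.gap b zt θs ∂μ) ^ 2
      ≤ (G.localAlignment (G.confSet lam ρ B θ₀ z a y t) zt).toReal
        * (8 * G.radius lam ρ B z a t ^ 2 * ∫ b, infoBudget K ℓ (G.logVol lam z a t)
          (G.infoGain (G.covMat lam z a t) b zt) ∂μ) := by
  rw [confSet_eq] at hμ hα ⊢
  have := hμ.1
  have hV := covMat_posDef (G := G) z a hlam t
  have hVl := le_quad_covMat (G := G) (lam := lam) z a t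
  have hs := radius_nonneg (G := G) (lam := lam) (z := z) (a := a) (t := t) hρ hB0
  have hξ := sqrt_quad_sub_lsEstimate_le hlam hρ h1 hθ hy hgood
  set V := G.covMat lam z a t
  set c := G.lsEstimate lam θ₀ z a y t
  set s := G.radius lam ρ B z a t
  set ξ := ρ * √(3 * Real.log t + G.logVol lam z a t) + √lam * B
  set α := (G.localAlignment (ellipsoid V c s) zt).toReal with hαdef
  set I := ∫ b, G.infoGain V b zt ∂μ with hI
  set Δ := ∫ b, G.gapEstimate (ellipsoid V c s) b zt ∂μ with hΔ
  have hα0 : 0 ≤ α := ENNReal.toReal_nonneg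
  have hW : 0 < √(lam * Real.exp ℓ) := Real.sqrt_pos.2 (by positivity)
  have hR : 0 < ‖θ₀‖ + B + 1 := by positivity
  have hξs : ξ ≤ s := by
    have : 0 ≤ (κ - 1) * (√(lam * Real.exp ℓ) * (‖θ₀‖ + B + 1)) :=
      mul_nonneg (by linarith) (by positivity)
    linarith
  have hround := hμ.local_bound hlam hV hVl hs hB hα
  rw [← hK] at hround
  have hIi := integrable_infoGain hlam hV hVl hB hμ.2.1
  have hI2i := integrable_infoGain_sq hlam hV hVl hB hμ.2.1
  have hgi := integrable_gap hB hμ.2.1 θs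
  have hei := integrable_gapEstimate (c := c) hlam hV hVl hs hB hμ.2.1
  have hI0 : 0 ≤ I := integral_nonneg fun b => infoGain_nonneg hV b zt
  have hg0 := integral_gap_nonneg hμ.2.1 θs
  have hK0 : 0 ≤ K := by rw [hK]; positivity
  -- Small volume: the squared gap is smaller than the squared estimate by κ² ≥ 2 (1 + K I), which
  -- turns I (1 + K I) into I / 2. Large volume: the estimate merely dominates the gap, and Jensen
  -- moves the square of I inside the integral.
  by_cases hv : G.logVol lam z a t ≤ ℓ
  · simp only [infoBudget, if_pos hv]
    rw [integral_div, ← hI]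
    have hIU : I ≤ d * L ^ 2 / lam / 2 := by
      calc I ≤ ∫ _, d * L ^ 2 / lam / 2 ∂μ := integral_mono_ae hIi (integrable_const _)
            ((ae_of_compl_eq_zero hμ.2.1).mono fun b hb => infoGain_le_const hlam hV hVl hB hb)
        _ = _ := by simp
    have hWn : ∀ v : Vec d, ‖v‖ ≤ √(lam * Real.exp ℓ) * dualNorm V v := fun v => by
      refine (norm_le_dualNorm (G := G) z a hlam t v).trans ?_
      refine mul_le_mul_of_nonneg_right ?_ (dualNorm_nonneg _ _)
      gcongr
    have hθR : ‖θs‖ ≤ ‖θ₀‖ + B + 1 := by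
      calc ‖θs‖ = ‖θ₀ + (θs - θ₀)‖ := by rw [add_sub_cancel]
        _ ≤ ‖θ₀‖ + ‖θs - θ₀‖ := norm_add_le _ _
        _ ≤ _ := by linarith
    have hκb : κ ≤ 1 + (s - ξ) / (√(lam * Real.exp ℓ) * (‖θ₀‖ + B + 1)) := by
      have : κ - 1 ≤ (s - ξ) / (√(lam * Real.exp ℓ) * (‖θ₀‖ + B + 1)) := by
        rw [le_div_iff₀ (by positivity)]
        linarith
      linarith
    have hκΔ : κ * ∫ b, G.gap b zt θs ∂μ ≤ Δ := by
      rw [← integral_const_mul]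
      exact integral_mono_ae (hgi.const_mul _) hei ((ae_of_compl_eq_zero hμ.2.1).mono fun b hb =>
        mul_gap_le_gapEstimate hV hs hξ hξs hW hWn hR hθR hκb (by linarith) hb)
    have hsq : κ ^ 2 * (∫ b, G.gap b zt θs ∂μ) ^ 2 ≤ Δ ^ 2 := by
      rw [← mul_pow]
      exact pow_le_pow_left₀ (mul_nonneg (by linarith) hg0) hκΔ 2
    have hbud : I * (1 + K * I) ≤ κ ^ 2 * (I / 2) := by
      have : 1 + K * I ≤ κ ^ 2 / 2 := by
        have := mul_le_mul_of_nonneg_left hIU hK0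
        linarith
      calc I * (1 + K * I) ≤ I * (κ ^ 2 / 2) := mul_le_mul_of_nonneg_left this hI0
        _ = _ := by ring
    refine le_of_mul_le_mul_left ?_ (show 0 < κ ^ 2 by positivity)
    calc κ ^ 2 * (∫ b, G.gap b zt θs ∂μ) ^ 2 ≤ Δ ^ 2 := hsq
      _ ≤ α * (8 * s ^ 2 * (I * (1 + K * I))) := hround
      _ ≤ α * (8 * s ^ 2 * (κ ^ 2 * (I / 2))) := by gcongr
      _ = _ := by ring
  · simp only [infoBudget, if_neg hv]
    have hmem : θs ∈ ellipsoid V c s := by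
      have hq : √(quad V (θs - c)) ≤ s := hξ.trans hξs
      exact (Real.sqrt_le_left hs).1 hq
    have hle : ∫ b, G.gap b zt θs ∂μ ≤ Δ :=
      integral_mono hgi hei fun b => gap_le_gapEstimate hV hs hmem b zt
    have hJ : I * (1 + K * I) ≤ ∫ b, (G.infoGain V b zt + K * G.infoGain V b zt ^ 2) ∂μ := by
      rw [integral_add hIi (hI2i.const_mul _), integral_const_mul]
      have := mul_le_mul_of_nonneg_left (sq_integral_le hIi hI2i) hK0
      rw [← hI] at this ⊢
      linarith
    calc (∫ b, G.gap b zt θs ∂μ) ^ 2 ≤ Δ ^ 2 := pow_le_pow_left₀ hg0 hle 2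
      _ ≤ α * (8 * s ^ 2 * (I * (1 + K * I))) := hround
      _ ≤ _ := by gcongr

theorem IsIDS.global_round (hlam : 0 < lam) (hρ : 0 < ρ) (hB0 : 0 ≤ B) (hB : G.Bounded L)
    (h1 : 1 ≤ t) (hθ : ‖θs - θ₀‖ ≤ B)
    (hy : ∀ s ∈ Finset.Ico 1 t, y s = act (G.M (z s) (a s)) θs + ε s)
    (hgood : dualNorm (G.covMat lam z a t) (G.noiseSum z a ε t) ^ 2
      ≤ ρ ^ 2 * (3 * Real.log t + G.logVol lam z a t))
    (hμ : G.IsIDS (G.confSet lam ρ B θ₀ z a y t) (G.covMat lam z a t) zt μ)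
    (hα : G.globalAlignment zt ≠ ⊤) {ζ : ℝ} (hζ : 0 < ζ)
    (hmargin : t = 1 ∨ ρ * √(3 * Real.log t + G.logVol lam z a t) + √lam * B
      ≤ (1 - ζ) * G.radius lam ρ B z a t) :
    (∫ b, G.gap b zt θs ∂μ) ^ 3
      ≤ 16 * (2 + d * L ^ 2 / lam) * (1 + 2 / ζ) * (‖θ₀‖ + B + 1)
        * ((G.globalAlignment zt).toReal * G.radius lam ρ B z a t ^ 2
          * ∫ b, G.infoGain (G.covMat lam z a t) b zt ∂μ) := by
  rw [confSet_eq] at hμ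
  have := hμ.1
  have hV := covMat_posDef (G := G) z a hlam t
  have hVl := le_quad_covMat (G := G) (lam := lam) z a t
  have hs := radius_nonneg (G := G) (lam := lam) (z := z) (a := a) (t := t) hρ hB0
  have hξ := sqrt_quad_sub_lsEstimate_le hlam hρ h1 hθ hy hgood
  have hξs : ρ * √(3 * Real.log t + G.logVol lam z a t) + √lam * B
      ≤ G.radius lam ρ B z a t := by
    have : 0 ≤ Real.log t := Real.log_nonneg (by exact_mod_cast h1)
    rw [radius]
    gcongr
    norm_num
  have hθR : ‖θs‖ ≤ ‖θ₀‖ + B := by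
    calc ‖θs‖ = ‖θ₀ + (θs - θ₀)‖ := by rw [add_sub_cancel]
      _ ≤ ‖θ₀‖ + ‖θs - θ₀‖ := norm_add_le _ _
      _ ≤ _ := by linarith
  have hR : 0 < ‖θ₀‖ + B + 1 := by positivity
  have hQ : 1 ≤ 1 + 2 / ζ := by
    have : 0 < 2 / ζ := by positivity
    linarith
  have hmem : θs ∈ ellipsoid (G.covMat lam z a t) (G.lsEstimate lam θ₀ z a y t)
      (G.radius lam ρ B z a t) := (Real.sqrt_le_left hs).1 (hξ.trans hξs)
  have hmin : ∫ b, G.gap b zt θs ∂μ ≤ min (∫ b, G.gapEstimate (ellipsoid (G.covMat lam z a t)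
      (G.lsEstimate lam θ₀ z a y t) (G.radius lam ρ B z a t)) b zt ∂μ) (‖θ₀‖ + B + 1) := by
    refine le_min (integral_mono (integrable_gap hB hμ.2.1 θs)
      (integrable_gapEstimate hlam hV hVl hs hB hμ.2.1)
      fun b => gap_le_gapEstimate hV hs hmem b zt) ?_
    refine integral_gap_le hB hμ.2.1 fun b hb => (gap_le_norm hB hb θs).trans ?_
    linarith
  refine (pow_le_pow_left₀ (integral_gap_nonneg hμ.2.1 θs) hmin 3).trans ?_
  refine hμ.global_bound hlam hV hVl hs hB hα (by positivity) hR fun g hg b hb => ?_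
  -- In round 1 one has log t = 0 and there may be no margin, but the estimate is θ₀ and the radius
  -- √λ B, so gap estimates are at most ‖θ₀‖ + B outright.
  rcases hmargin with rfl | hmargin
  · refine (gapEstimate_le_const hlam hV hVl hs hB hb).trans ?_
    have hg0 := gapEstimate_nonneg (c := G.lsEstimate lam θ₀ z a y 1) hV hs hg
    have e : G.radius lam ρ B z a 1 / √lam = B := by
      rw [radius, logVol_one]
      simp [(Real.sqrt_pos.2 hlam).ne']
    rw [lsEstimate_one hlam] at hg0 ⊢
    rw [e]
    calc ‖θ₀‖ + B ≤ G.gapEstimate (ellipsoid (G.covMat lam z a 1) θ₀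
          (G.radius lam ρ B z a 1)) g zt + (‖θ₀‖ + B + 1) := by linarith
      _ ≤ _ := le_mul_of_one_le_left (by linarith) hQ
  · exact gapEstimate_le_of_greedy hV hs hζ (hξ.trans hmargin) (by linarith) hB hg hb

end Round

end Game

theorem measurable_uncurry_of_le {Ω A : Type*} [MeasurableSpace A] {m mΩ : MeasurableSpace Ω}
    (hm : m ≤ mΩ) {g : Ω → A → ℝ≥0∞}
    (hg : Measurable[m.prod inferInstance] (Function.uncurry g)) :
    Measurable (Function.uncurry g) :=
  hg.mono (sup_le_sup (MeasurableSpace.comap_mono hm) le_rfl) le_rfl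

namespace Game

variable {A Z : Type*} [TopologicalSpace A] [MeasurableSpace Z] {d m : ℕ} {G : Game A Z d m}
  {lam ρ B L : ℝ} {θ₀ θs : Vec d}

/-! ### Bounds on the regret of a round -/

theorem radius_sq_le_confCoef (hlam : 0 < lam) (hρ : 0 < ρ) (hB : 0 ≤ B)
    {t n : ℕ} (ht : t ∈ Finset.Icc 1 n) (z : ℕ → Z) (a : ℕ → A) :
    G.radius lam ρ B z a t ^ 2 ≤ G.confCoef lam ρ B z a n := by
  rw [Finset.mem_Icc] at ht
  rw [confCoef_eq]
  exact pow_le_pow_left₀ (radius_nonneg hρ hB) (radius_mono hlam hρ ht.1 ht.2) 2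

theorem lintegral_sum_mul_confCoef {Ω : Type*} [MeasurableSpace Ω]
    {P : Measure Ω} {n : ℕ} {z : ℕ → Ω → Z} {a : ℕ → Ω → A} (hn : 1 ≤ n) (C : ℝ) (α : ℕ → Ω → ℝ≥0∞) :
    ∫⁻ ω, ∑ t ∈ Finset.Icc 1 n, ENNReal.ofReal C * (α t ω
        * ENNReal.ofReal (G.confCoef lam ρ B (fun s => z s ω) (fun s => a s ω) n)) ∂P
      = ENNReal.ofReal C * n * G.expAlignConf lam ρ B P n z a α := by
  have hn0 : (n : ℝ≥0∞) ≠ 0 := by simp; omega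
  rw [expAlignConf, ← lintegral_const_mul' _ _
    (ENNReal.mul_ne_top ENNReal.ofReal_ne_top (ENNReal.natCast_ne_top n))]
  refine lintegral_congr fun ω => ?_
  rw [← Finset.mul_sum, ← Finset.sum_mul, mul_assoc (ENNReal.ofReal C), ← mul_assoc (n : ℝ≥0∞),
    ENNReal.mul_div_cancel hn0 (ENNReal.natCast_ne_top n)]

section Round

variable [MeasurableSpace A] [BorelSpace A] [SecondCountableTopology A]

theorem lintegral_gap_eq (hB : G.Bounded L) {zt : Z} {μ : Measure A} [IsFiniteMeasure μ]
    (hμ : μ (G.avail zt)ᶜ = 0) (θ : Vec d) :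
    ∫⁻ b, ENNReal.ofReal (G.gap b zt θ) ∂μ = ENNReal.ofReal (∫ b, G.gap b zt θ ∂μ) :=
  (ofReal_integral_eq_lintegral_ofReal (integrable_gap hB hμ θ)
    ((ae_of_compl_eq_zero hμ).mono fun _ hb => gap_nonneg hb θ)).symm

theorem lintegral_gap_le (hB : G.Bounded L) (hθ : ‖θs - θ₀‖ ≤ B) {zt : Z} {μ : Measure A}
    [IsProbabilityMeasure μ] (hμ : μ (G.avail zt)ᶜ = 0) :
    ∫⁻ b, ENNReal.ofReal (G.gap b zt θs) ∂μ ≤ ENNReal.ofReal (‖θ₀‖ + B + 1) := by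
  rw [lintegral_gap_eq hB hμ]
  refine ENNReal.ofReal_le_ofReal (integral_gap_le hB hμ fun b hb =>
    (gap_le_norm hB hb θs).trans ?_)
  calc ‖θs‖ = ‖θ₀ + (θs - θ₀)‖ := by rw [add_sub_cancel]
    _ ≤ ‖θ₀‖ + ‖θs - θ₀‖ := norm_add_le _ _
    _ ≤ _ := by linarith

/-- Used on failure rounds, where the confidence set says nothing: two of the three factors are
bounded through alignment, the third by R = ‖θ₀‖ + B + 1. -/
theorem lintegral_gap_cube_le (hB : G.Bounded L) (hθ : ‖θs - θ₀‖ ≤ B) {zt : Z} {μ : Measure A}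
    [IsProbabilityMeasure μ] (hμ : μ (G.avail zt)ᶜ = 0) (hα : G.globalAlignment zt ≠ ⊤) :
    (∫⁻ b, ENNReal.ofReal (G.gap b zt θs) ∂μ) ^ 3
      ≤ ENNReal.ofReal ((‖θ₀‖ + B + 1) ^ 3 * L ^ 2) * G.globalAlignment zt := by
  have hB0 : 0 ≤ B := (norm_nonneg _).trans hθ
  have hR : 0 ≤ ‖θ₀‖ + B + 1 := by positivity
  have hθR : ‖θs‖ ≤ ‖θ₀‖ + B + 1 := by
    calc ‖θs‖ = ‖θ₀ + (θs - θ₀)‖ := by rw [add_sub_cancel]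
      _ ≤ ‖θ₀‖ + ‖θs - θ₀‖ := norm_add_le _ _
      _ ≤ _ := by linarith
  have hg0 := integral_gap_nonneg hμ θs
  rw [lintegral_gap_eq hB hμ, ← ENNReal.ofReal_pow hg0, ← ENNReal.ofReal_toReal hα,
    ← ENNReal.ofReal_mul (by positivity)]
  refine ENNReal.ofReal_le_ofReal ?_
  set x := (‖θ₀‖ + B + 1) ^ 2 * L ^ 2 * (G.globalAlignment zt).toReal with hx
  have hx0 : 0 ≤ x := by positivity
  have h1 : ∫ b, G.gap b zt θs ∂μ ≤ √x := by
    refine integral_gap_le hB hμ fun b hb => Real.le_sqrt_of_sq_le ?_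
    refine (gap_sq_le_globalAlignment hB hb hα θs).trans ?_
    rw [hx]
    gcongr
  have h2 : ∫ b, G.gap b zt θs ∂μ ≤ ‖θ₀‖ + B + 1 :=
    integral_gap_le hB hμ fun b hb => (gap_le_norm hB hb θs).trans hθR
  calc (∫ b, G.gap b zt θs ∂μ) ^ 3
      = (∫ b, G.gap b zt θs ∂μ) * (∫ b, G.gap b zt θs ∂μ) ^ 2 := by ring
    _ ≤ (‖θ₀‖ + B + 1) * √x ^ 2 := by gcongr
    _ = _ := by rw [Real.sq_sqrt hx0, hx]; ring

end Round

section Measurability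

variable {Ω : Type*} [MeasurableSpace Ω] [MeasurableSpace A] [OpensMeasurableSpace A]
  [SecondCountableTopology A] [TopologicalSpace.MetrizableSpace A]
  {z : ℕ → Ω → Z} {a : ℕ → Ω → A} {t : ℕ}

theorem measurable_ofReal_infoGain (hzt : Measurable (z t))
    (hz : ∀ s ∈ Finset.Ico 1 t, Measurable (z s)) (ha : ∀ s ∈ Finset.Ico 1 t, Measurable (a s)) :
    Measurable (Function.uncurry fun (ω : Ω) (b : A) => ENNReal.ofReal
      (G.infoGain (G.covMat lam (fun s => z s ω) (fun s => a s ω) t) b (z t ω))) :=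
  (measurable_infoGain hzt (entryMeasurable_covMat hz ha)).ennreal_ofReal

theorem measurable_ofReal_infoBudget (K ℓ : ℝ) (hzt : Measurable (z t))
    (hz : ∀ s ∈ Finset.Ico 1 t, Measurable (z s)) (ha : ∀ s ∈ Finset.Ico 1 t, Measurable (a s)) :
    Measurable (Function.uncurry fun (ω : Ω) (b : A) => ENNReal.ofReal
      (infoBudget K ℓ (G.logVol lam (fun s => z s ω) (fun s => a s ω) t)
        (G.infoGain (G.covMat lam (fun s => z s ω) (fun s => a s ω) t) b (z t ω)))) := by
  have hI := measurable_infoGain (G := G) hzt (entryMeasurable_covMat (G := G) (lam := lam) hz ha)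
  have hv : Measurable fun p : Ω × A => G.logVol lam (fun s => z s p.1) (fun s => a s p.1) t :=
    (measurable_logVol hz ha).comp measurable_fst
  exact (Measurable.ite (measurableSet_le hv measurable_const) (hI.div_const 2)
    (hI.add ((hI.pow_const 2).const_mul K))).ennreal_ofReal

end Measurability

namespace IsConditionalIDS

variable [MeasurableSpace A] {Ω : Type*} {mΩ : MeasurableSpace Ω} {P : Measure Ω}
  {F : Filtration ℕ mΩ} {n : ℕ} {z : ℕ → Ω → Z} {μ : ℕ → Ω → Measure A} {a : ℕ → Ω → A}
  {y ε : ℕ → Ω → Vec m} {s t : ℕ}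

theorem aemeasurable_policy (h : G.IsConditionalIDS lam ρ B θ₀ θs P F n z μ a y ε)
    (ht : t ∈ Finset.Icc 1 n) {g : Ω → A → ℝ≥0∞}
    (hg : Measurable[(F (t - 1) : MeasurableSpace Ω).prod inferInstance] (Function.uncurry g)) :
    AEMeasurable (fun ω => ∫⁻ b, g ω b ∂μ t ω) P :=
  aemeasurable_lintegral_law ((h.policy_predictable t ht).mono (F.le _) le_rfl)
    ((h.policy_ids t ht).mono fun _ hω => hω.1) (measurable_uncurry_of_le (F.le _) hg)

theorem lintegral_sum_action [IsProbabilityMeasure P]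
    (h : G.IsConditionalIDS lam ρ B θ₀ θs P F n z μ a y ε)
    {g : ℕ → Ω → A → ℝ≥0∞} (hg : ∀ t ∈ Finset.Icc 1 n,
      Measurable[(F (t - 1) : MeasurableSpace Ω).prod inferInstance] (Function.uncurry (g t))) :
    ∫⁻ ω, ∑ t ∈ Finset.Icc 1 n, g t ω (a t ω) ∂P
      = ∑ t ∈ Finset.Icc 1 n, ∫⁻ ω, ∫⁻ b, g t ω b ∂μ t ω ∂P := by
  rw [lintegral_finsetSum' _ fun t ht => ?_]
  · exact Finset.sum_congr rfl fun t ht => h.lintegral_action ht (hg t ht)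
  · exact ((measurable_uncurry_of_le (F.le _) (hg t ht)).comp
      (measurable_id.prodMk (h.measurable_action ht))).aemeasurable

variable [BorelSpace A] [SecondCountableTopology A]

theorem measurable_gap_round (h : G.IsConditionalIDS lam ρ B θ₀ θs P F n z μ a y ε)
    (ht : t ∈ Finset.Icc 1 n) :
    Measurable[(F (t - 1) : MeasurableSpace Ω).prod inferInstance]
      (Function.uncurry fun (ω : Ω) (b : A) => ENNReal.ofReal (G.gap b (z t ω) θs)) :=
  @Measurable.ennreal_ofReal _ ((F (t - 1) : MeasurableSpace Ω).prod inferInstance) _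
    (@measurable_gap A Z _ _ d m G Ω (F (t - 1)) _ _ _ (z t) (h.context_predictable t ht) θs)

theorem regret_eq [IsProbabilityMeasure P]
    (h : G.IsConditionalIDS lam ρ B θ₀ θs P F n z μ a y ε) :
    G.regret θs P n z a
      = ∑ t ∈ Finset.Icc 1 n, ∫⁻ ω, ∫⁻ b, ENNReal.ofReal (G.gap b (z t ω) θs) ∂μ t ω ∂P :=
  h.lintegral_sum_action fun _ ht => h.measurable_gap_round ht

variable [TopologicalSpace.MetrizableSpace A]

theorem measurable_infoGain_round (h : G.IsConditionalIDS lam ρ B θ₀ θs P F n z μ a y ε)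
    (ht : t ∈ Finset.Icc 1 n) :
    Measurable[(F (t - 1) : MeasurableSpace Ω).prod inferInstance]
      (Function.uncurry fun (ω : Ω) (b : A) => ENNReal.ofReal
      (G.infoGain (G.covMat lam (fun s => z s ω) (fun s => a s ω) t) b (z t ω))) :=
  have ht' : t ≤ n + 1 := (Finset.mem_Icc.1 ht).2.trans (Nat.le_succ n)
  @measurable_ofReal_infoGain A Z _ _ d m G lam Ω (F (t - 1)) _ _ _ _ z a t
    (h.context_predictable t ht) (fun _ hs => h.context_history ht' hs)
    (fun _ hs => h.action_history ht' hs)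

theorem measurable_infoBudget_round (h : G.IsConditionalIDS lam ρ B θ₀ θs P F n z μ a y ε)
    (K ℓ : ℝ) (ht : t ∈ Finset.Icc 1 n) :
    Measurable[(F (t - 1) : MeasurableSpace Ω).prod inferInstance]
      (Function.uncurry fun (ω : Ω) (b : A) => ENNReal.ofReal
      (infoBudget K ℓ (G.logVol lam (fun s => z s ω) (fun s => a s ω) t)
        (G.infoGain (G.covMat lam (fun s => z s ω) (fun s => a s ω) t) b (z t ω)))) :=
  have ht' : t ≤ n + 1 := (Finset.mem_Icc.1 ht).2.trans (Nat.le_succ n)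
  @measurable_ofReal_infoBudget A Z _ _ d m G lam Ω (F (t - 1)) _ _ _ _ z a t K ℓ
    (h.context_predictable t ht) (fun _ hs => h.context_history ht' hs)
    (fun _ hs => h.action_history ht' hs)

theorem sum_lintegral_infoGain [IsProbabilityMeasure P]
    (h : G.IsConditionalIDS lam ρ B θ₀ θs P F n z μ a y ε)
    (hlam : 0 < lam) :
    ∑ t ∈ Finset.Icc 1 n, ∫⁻ ω, ∫⁻ b, ENNReal.ofReal
      (G.infoGain (G.covMat lam (fun s => z s ω) (fun s => a s ω) t) b (z t ω)) ∂μ t ω ∂P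
      = G.expTotalInfo lam P n z a := by
  rw [← h.lintegral_sum_action fun _ ht => h.measurable_infoGain_round ht, expTotalInfo]
  exact lintegral_congr fun ω => (ENNReal.ofReal_sum_of_nonneg fun s _ =>
    infoGain_nonneg (covMat_posDef _ _ hlam _) _ _).symm

theorem sum_lintegral_infoBudget_le [IsProbabilityMeasure P]
    (h : G.IsConditionalIDS lam ρ B θ₀ θs P F n z μ a y ε)
    (hlam : 0 < lam) (hB : G.Bounded L) {K ℓ : ℝ} (hK : 0 ≤ K)
    (hℓ : 4 * K * (d * L ^ 2 * (1 + d * L ^ 2 / lam) * (d / lam) / 4) ≤ ℓ) :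
    ∑ t ∈ Finset.Icc 1 n, ∫⁻ ω, ∫⁻ b, ENNReal.ofReal
      (infoBudget K ℓ (G.logVol lam (fun s => z s ω) (fun s => a s ω) t)
        (G.infoGain (G.covMat lam (fun s => z s ω) (fun s => a s ω) t) b (z t ω))) ∂μ t ω ∂P
      ≤ G.expTotalInfo lam P n z a := by
  rw [← h.lintegral_sum_action fun _ ht => h.measurable_infoBudget_round K ℓ ht, expTotalInfo]
  refine lintegral_mono_ae ?_
  filter_upwards [h.ae_mem_avail] with ω hω
  rw [← ENNReal.ofReal_sum_of_nonneg fun s _ => infoBudget_nonneg hK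
    (infoGain_nonneg (covMat_posDef _ _ hlam _) _ _)]
  exact ENNReal.ofReal_le_ofReal (sum_infoBudget_le hlam hB hK hℓ hω)

theorem sum_measure_noiseFailure_le [IsProbabilityMeasure P]
    (h : G.IsConditionalIDS lam ρ B θ₀ θs P F n z μ a y ε)
    (hlam : 0 < lam) (hρ : 0 < ρ) :
    ∑ t ∈ Finset.Icc 1 n, P (noiseFailure G lam ρ z a ε t)
      ≤ ENNReal.ofReal (∑' t : ℕ, 1 / (t : ℝ) ^ (3 / 2 : ℝ)) := by
  have hs : Summable fun t : ℕ => 1 / (t : ℝ) ^ (3 / 2 : ℝ) :=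
    Real.summable_one_div_nat_rpow.2 (by norm_num)
  calc _ ≤ ∑ t ∈ Finset.Icc 1 n, ENNReal.ofReal (1 / (t : ℝ) ^ (3 / 2 : ℝ)) := by
        refine Finset.sum_le_sum fun t ht => ?_
        rw [Finset.mem_Icc] at ht
        exact h.measure_noiseFailure_le hlam hρ ht.1 (by omega)
    _ = ENNReal.ofReal (∑ t ∈ Finset.Icc 1 n, 1 / (t : ℝ) ^ (3 / 2 : ℝ)) :=
        (ENNReal.ofReal_sum_of_nonneg fun _ _ => by positivity).symm
    _ ≤ _ := ENNReal.ofReal_le_ofReal (hs.sum_le_tsum _ fun _ _ => by positivity)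

theorem sum_measure_noiseFailure_le_mul_info [IsProbabilityMeasure P]
    (h : G.IsConditionalIDS lam ρ B θ₀ θs P F n z μ a y ε) (hlam : 0 < lam) (hρ : 0 < ρ) :
    ∑ t ∈ Finset.Icc 1 n, P (noiseFailure G lam ρ z a ε t)
      ≤ ENNReal.ofReal (2 * ∑' t : ℕ, 1 / (t : ℝ) ^ (3 / 2 : ℝ)) * G.expTotalInfo lam P n z a := by
  have hs : Summable fun t : ℕ => 1 / (t : ℝ) ^ (3 / 2 : ℝ) :=
    Real.summable_one_div_nat_rpow.2 (by norm_num)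
  calc _ ≤ ∑ t ∈ Finset.Icc 1 n,
          ENNReal.ofReal (2 / (t : ℝ) ^ (3 / 2 : ℝ)) * G.expTotalInfo lam P n z a := by
        refine Finset.sum_le_sum fun t ht => ?_
        rw [Finset.mem_Icc] at ht
        exact h.measure_noiseFailure_le_mul_info hlam hρ ht.1 (by omega)
    _ = ENNReal.ofReal (∑ t ∈ Finset.Icc 1 n, 2 / (t : ℝ) ^ (3 / 2 : ℝ))
          * G.expTotalInfo lam P n z a := by
        rw [← Finset.sum_mul, ENNReal.ofReal_sum_of_nonneg fun _ _ => by positivity]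
    _ ≤ _ := by
        gcongr
        have e : ∀ t : ℕ, 2 / (t : ℝ) ^ (3 / 2 : ℝ) = 2 * (1 / (t : ℝ) ^ (3 / 2 : ℝ)) :=
          fun t => by ring
        rw [Finset.sum_congr rfl fun t _ => e t, ← Finset.mul_sum]
        exact mul_le_mul_of_nonneg_left (hs.sum_le_tsum _ fun _ _ => by positivity) two_pos.le

end IsConditionalIDS

end Game

/-! ### Regret bounds over the whole horizon. -/

namespace Game

namespace IsConditionalIDS

variable {A Z : Type*} [TopologicalSpace A] [MeasurableSpace Z] {d m : ℕ} {G : Game A Z d m}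
  {lam ρ B L : ℝ} {θ₀ θs : Vec d} [MeasurableSpace A] [BorelSpace A] [SecondCountableTopology A]
  [TopologicalSpace.MetrizableSpace A] {Ω : Type*} {mΩ : MeasurableSpace Ω} {P : Measure Ω}
  {F : Filtration ℕ mΩ} {n : ℕ} {z : ℕ → Ω → Z}
  {μ : ℕ → Ω → Measure A} {a : ℕ → Ω → A} {y ε : ℕ → Ω → Vec m}

theorem ae_round [IsProbabilityMeasure P]
    (h : G.IsConditionalIDS lam ρ B θ₀ θs P F n z μ a y ε) :
    ∀ᵐ ω ∂P, (∀ t ∈ Finset.Icc 1 n, a t ω ∈ G.avail (z t ω)) ∧ ∀ t ∈ Finset.Icc 1 n,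
      G.IsIDS (G.confSet lam ρ B θ₀ (fun s => z s ω) (fun s => a s ω) (fun s => y s ω) t)
      (G.covMat lam (fun s => z s ω) (fun s => a s ω) t) (z t ω) (μ t ω) :=
  h.ae_mem_avail.and ((ae_ball_iff (Finset.countable_toSet _)).2 h.policy_ids)

/-- Integral of a constant over the event that the noise leaves its confidence bound. -/
theorem lintegral_indicator_failure_le (h : G.IsConditionalIDS lam ρ B θ₀ θs P F n z μ a y ε)
    {t : ℕ} (ht : t ∈ Finset.Icc 1 n) (c : ℝ≥0∞) :
    ∫⁻ ω, (noiseFailure G lam ρ z a ε t).indicator (fun _ => c) ω ∂P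
      = c * P (noiseFailure G lam ρ z a ε t) :=
  lintegral_indicator_const (F.le _ _ (h.measurableSet_failure
    ((Finset.mem_Icc.1 ht).2.trans (Nat.le_succ n)))) c

/-- Rounds before t₀ and failure rounds cost at most R each and make up the additive constant. On
the others Cauchy–Schwarz is applied with the information budget, whose expected sum is at most
E[γ_n], so the constant 8 survives. -/
theorem regret_le_local [IsProbabilityMeasure P]
    (h : G.IsConditionalIDS lam ρ B θ₀ θs P F n z μ a y ε) (hlam : 0 < lam)
    (hρ : 0 < ρ) (hB : G.Bounded L) (hθ : ‖θs - θ₀‖ ≤ B) (hn : 1 ≤ n)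
    (hα : ∀ᵐ ω ∂P, ∀ t ∈ Finset.Icc 1 n, G.realizedLocalAlignment lam ρ B θ₀ z a y t ω ≠ ⊤)
    {K ℓ κ : ℝ} {t₀ : ℕ} (hK : K = 4 * (1 + d * L ^ 2 / lam / 2) ^ 2)
    (hℓ : 4 * K * (d * L ^ 2 * (1 + d * L ^ 2 / lam) * (d / lam) / 4) ≤ ℓ) (hκ : 1 ≤ κ)
    (hκK : 2 * (1 + K * (d * L ^ 2 / lam / 2)) ≤ κ ^ 2) (ht₀ : 2 ≤ t₀)
    (hm : ∀ t : ℕ, t₀ ≤ t → ∀ v, 0 ≤ v →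
      v ≤ d * (1 + Real.log (1 + d * L ^ 2 / lam) / Real.log 2) * Real.log t →
      ρ * √(3 * Real.log t + v) + √lam * B
        + (κ - 1) * (√(lam * Real.exp ℓ) * (‖θ₀‖ + B + 1)) ≤ ρ * √(4 * Real.log t + v) + √lam * B) :
    G.regret θs P n z a ≤
      (8 * G.expAlignConf lam ρ B P n z a (G.realizedLocalAlignment lam ρ B θ₀ z a y)
        * G.expTotalInfo lam P n z a * n) ^ (1 / 2 : ℝ)
      + ENNReal.ofReal ((‖θ₀‖ + B + 1) * (t₀ + ∑' t : ℕ, 1 / (t : ℝ) ^ (3 / 2 : ℝ))) := by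
  have hB0 : 0 ≤ B := (norm_nonneg _).trans hθ
  have hR : 0 ≤ ‖θ₀‖ + B + 1 := by positivity
  have hK0 : 0 ≤ K := by rw [hK]; positivity
  have htsum : 0 ≤ ∑' t : ℕ, 1 / (t : ℝ) ^ (3 / 2 : ℝ) := tsum_nonneg fun _ => by positivity
  set R : ℝ≥0∞ := ENNReal.ofReal (‖θ₀‖ + B + 1) with hRdef
  set r : ℕ → Ω → ℝ≥0∞ := fun t ω => ∫⁻ b, ENNReal.ofReal (G.gap b (z t ω) θs) ∂μ t ω with hr
  set J : ℕ → Ω → ℝ≥0∞ := fun t ω => ∫⁻ b, ENNReal.ofReal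
      (infoBudget K ℓ (G.logVol lam (fun s => z s ω) (fun s => a s ω) t)
        (G.infoGain (G.covMat lam (fun s => z s ω) (fun s => a s ω) t) b (z t ω))) ∂μ t ω with hJ
  set f : ℕ → Set Ω := noiseFailure G lam ρ z a ε with hf
  -- The mean gap of the round, set to zero on early and failure rounds.
  set g : ℕ → Ω → ℝ≥0∞ := fun t => if t₀ ≤ t then (f t)ᶜ.indicator (r t) else 0 with hg
  set w : ℕ → Ω → ℝ≥0∞ := fun t ω => ENNReal.ofReal 8 *
    (G.realizedLocalAlignment lam ρ B θ₀ z a y t ω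
      * ENNReal.ofReal (G.confCoef lam ρ B (fun s => z s ω) (fun s => a s ω) n)) with hw
  have hfm : ∀ t ∈ Finset.Icc 1 n, MeasurableSet (f t) := fun t ht =>
    F.le _ _ (h.measurableSet_failure ((Finset.mem_Icc.1 ht).2.trans (Nat.le_succ n)))
  have hrm : ∀ t ∈ Finset.Icc 1 n, AEMeasurable (r t) P := fun t ht =>
    h.aemeasurable_policy ht (h.measurable_gap_round ht)
  have hJm : ∀ t ∈ Finset.Icc 1 n, AEMeasurable (J t) P := fun t ht =>
    h.aemeasurable_policy ht (h.measurable_infoBudget_round K ℓ ht)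
  have hgm : ∀ t ∈ Finset.Icc 1 n, AEMeasurable (g t) P := fun t ht => by
    simp only [hg]
    split_ifs
    · exact (hrm t ht).indicator (hfm t ht).compl
    · exact aemeasurable_const
  have hgood : ∀ᵐ ω ∂P, ∀ t ∈ Finset.Icc 1 n, J t ω ≠ ⊤ ∧ g t ω ^ 2 ≤ w t ω * J t ω := by
    filter_upwards [h.ae_round, hα] with ω hω hαω t ht
    obtain ⟨hav, hids⟩ := hω
    have hμ := hids t ht
    have := hμ.1
    have ht1 := Finset.mem_Icc.1 ht
    have hV := covMat_posDef (G := G) (fun s => z s ω) (fun s => a s ω) hlam t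
    have hVl := le_quad_covMat (G := G) (lam := lam) (fun s => z s ω) (fun s => a s ω) t
    have hbi : Integrable (fun b => infoBudget K ℓ
        (G.logVol lam (fun s => z s ω) (fun s => a s ω) t)
        (G.infoGain (G.covMat lam (fun s => z s ω) (fun s => a s ω) t) b (z t ω))) (μ t ω) := by
      have h1 := integrable_infoGain hlam hV hVl hB hμ.2.1
      have h2 := integrable_infoGain_sq hlam hV hVl hB hμ.2.1
      simp only [infoBudget]
      split_ifs
      · exact h1.div_const 2
      · exact h1.add (h2.const_mul K)
    have hbn : ∀ b, 0 ≤ infoBudget K ℓ (G.logVol lam (fun s => z s ω) (fun s => a s ω) t)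
        (G.infoGain (G.covMat lam (fun s => z s ω) (fun s => a s ω) t) b (z t ω)) := fun b =>
      infoBudget_nonneg hK0 (infoGain_nonneg hV _ _)
    have hJe : J t ω = ENNReal.ofReal (∫ b, infoBudget K ℓ
        (G.logVol lam (fun s => z s ω) (fun s => a s ω) t)
        (G.infoGain (G.covMat lam (fun s => z s ω) (fun s => a s ω) t) b (z t ω)) ∂μ t ω) :=
      (ofReal_integral_eq_lintegral_ofReal hbi (Filter.Eventually.of_forall hbn)).symm
    refine ⟨by rw [hJe]; exact ENNReal.ofReal_ne_top, ?_⟩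
    by_cases hcase : t₀ ≤ t ∧ ω ∉ f t
    swap
    · have : g t ω = 0 := by
        simp only [hg]
        split_ifs with h1
        · exact Set.indicator_of_notMem (fun h2 => hcase ⟨h1, h2⟩) _
        · rfl
      simp [this]
    have hge : g t ω = r t ω := by
      simp only [hg, if_pos hcase.1]
      exact Set.indicator_of_mem hcase.2 _
    have hav' : ∀ s ∈ Finset.Ico 1 t, a s ω ∈ G.avail (z s ω) := fun s hs => by
      rw [Finset.mem_Ico] at hs
      exact hav s (Finset.mem_Icc.2 (by omega))
    have hround := hμ.local_round (y := fun s => y s ω) (ε := fun s => ε s ω) (κ := κ) (ℓ := ℓ)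
      hlam hρ hB0 hB ht1.1 hθ
      (fun s hs => h.observation_eq s (by
        rw [Finset.mem_Ico] at hs
        exact Finset.mem_Icc.2 (by omega)) ω)
      (not_lt.1 hcase.2) (hαω t ht) hK hκ hκK
      (hm t hcase.1 _ (logVol_nonneg _ _ hlam ht1.1)
        (logVol_le_mul_log hlam hB (ht₀.trans hcase.1) hav'))
    have hre : r t ω = ENNReal.ofReal (∫ b, G.gap b (z t ω) θs ∂μ t ω) :=
      lintegral_gap_eq hB hμ.2.1 θs
    have hwe : w t ω = ENNReal.ofReal (8 * ((G.realizedLocalAlignment lam ρ B θ₀ z a y t ω).toReal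
        * G.confCoef lam ρ B (fun s => z s ω) (fun s => a s ω) n)) := by
      rw [ENNReal.ofReal_mul (by norm_num), ENNReal.ofReal_mul ENNReal.toReal_nonneg,
        ENNReal.ofReal_toReal (hαω t ht)]
    have hI := integral_nonneg_of_ae (μ := μ t ω) (Filter.Eventually.of_forall hbn)
    rw [hge, hre, hJe, hwe, ← ENNReal.ofReal_pow (integral_gap_nonneg hμ.2.1 θs),
      ← ENNReal.ofReal_mul' hI]
    refine ENNReal.ofReal_le_ofReal (hround.trans ?_)
    have hβ := radius_sq_le_confCoef (G := G) hlam hρ hB0 ht (fun s => z s ω) fun s => a s ω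
    rw [← mul_assoc, mul_left_comm, ← mul_assoc]
    refine mul_le_mul_of_nonneg_right ?_ hI
    rw [mul_assoc]
    exact mul_le_mul_of_nonneg_left
      (mul_le_mul_of_nonneg_left hβ ENNReal.toReal_nonneg) (by norm_num)
  have hsplit : ∀ t ∈ Finset.Icc 1 n, ∫⁻ ω, r t ω ∂P
      ≤ ∫⁻ ω, g t ω ∂P + ((if t < t₀ then R else 0) + R * P (f t)) := by
    intro t ht
    rw [← h.lintegral_indicator_failure_le ht]
    have e : (if t < t₀ then R else 0) = ∫⁻ _, (if t < t₀ then R else 0) ∂P := by simp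
    rw [e, ← lintegral_add_left measurable_const, ← lintegral_add_left' (hgm t ht)]
    refine lintegral_mono_ae ?_
    filter_upwards [h.ae_round] with ω hω
    have := (hω.2 t ht).1
    have hrR : r t ω ≤ R := lintegral_gap_le hB hθ (hω.2 t ht).2.1
    by_cases h1 : t < t₀
    · rw [if_pos h1]
      exact hrR.trans (le_add_left (le_add_right le_rfl))
    · by_cases h2 : ω ∈ f t
      · rw [Set.indicator_of_mem h2]
        exact hrR.trans (le_add_left (le_add_left le_rfl))
      · have : g t ω = r t ω := by
          simp only [hg, if_pos (not_lt.1 h1)]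
          exact Set.indicator_of_mem h2 _
        rw [this]
        exact le_add_right le_rfl
  rw [h.regret_eq]
  refine (Finset.sum_le_sum hsplit).trans ?_
  rw [Finset.sum_add_distrib, Finset.sum_add_distrib, ← Finset.mul_sum]
  refine add_le_add ?_ ?_
  · refine (sum_lintegral_le_of_sq_le _ hgm hJm hgood).trans ?_
    refine ENNReal.rpow_le_rpow ?_ (by norm_num)
    rw [lintegral_sum_mul_confCoef hn]
    calc _ ≤ ENNReal.ofReal 8 * n * G.expAlignConf lam ρ B P n z a
            (G.realizedLocalAlignment lam ρ B θ₀ z a y) * G.expTotalInfo lam P n z a :=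
          mul_le_mul_right (h.sum_lintegral_infoBudget_le hlam hB hK0 hℓ) _
      _ = _ := by
          rw [show ENNReal.ofReal 8 = 8 by norm_num]
          ring
  · rw [mul_add, ENNReal.ofReal_add (by positivity) (by positivity), ENNReal.ofReal_mul hR,
      ENNReal.ofReal_mul hR, ENNReal.ofReal_natCast]
    refine add_le_add ?_ (mul_le_mul_right (h.sum_measure_noiseFailure_le hlam hρ) _)
    rw [← Finset.sum_filter, Finset.sum_const, nsmul_eq_mul, mul_comm]
    refine mul_le_mul_right ?_ _
    have hsub : (Finset.Icc 1 n).filter (· < t₀) ⊆ Finset.range t₀ := fun s hs =>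
      Finset.mem_range.2 (Finset.mem_filter.1 hs).2
    exact_mod_cast (Finset.card_le_card hsub).trans_eq (Finset.card_range t₀)

/-- Hölder with three exponents 1/3, once on good rounds with factors α β, I and 1, and once on
failure rounds with factors α β and the failure indicator twice. In the second, one sum of failure
probabilities is bounded by c and the other by 2c E[γ_n]. -/
theorem regret_le_global [IsProbabilityMeasure P]
    (h : G.IsConditionalIDS lam ρ B θ₀ θs P F n z μ a y ε) (hlam : 0 < lam)
    (hρ : 0 < ρ) (hB : G.Bounded L) (hθ : ‖θs - θ₀‖ ≤ B) (hn : 1 ≤ n)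
    (hα : ∀ᵐ ω ∂P, ∀ t ∈ Finset.Icc 1 n, G.realizedGlobalAlignment z t ω ≠ ⊤)
    {ζ C₁ C₂ c : ℝ} (hζ : 0 < ζ)
    (hC₁ : C₁ = 16 * (2 + d * L ^ 2 / lam) * (1 + 2 / ζ) * (‖θ₀‖ + B + 1))
    (hC₂ : C₂ = (‖θ₀‖ + B + 1) ^ 3 * L ^ 2 / (4 * Real.log 2 * ρ ^ 2))
    (hc : c = ∑' t : ℕ, 1 / (t : ℝ) ^ (3 / 2 : ℝ))
    (hm : ∀ t : ℕ, 2 ≤ t → ∀ v, 0 ≤ v →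
      v ≤ d * (1 + Real.log (1 + d * L ^ 2 / lam) / Real.log 2) * Real.log t →
      ρ * √(3 * Real.log t + v) + √lam * B
        ≤ (1 - ζ) * (ρ * √(4 * Real.log t + v) + √lam * B)) :
    G.regret θs P n z a ≤
      (ENNReal.ofReal C₁ ^ (1 / 3 : ℝ) + ENNReal.ofReal (C₂ * (c * (2 * c))) ^ (1 / 3 : ℝ))
        * ((n : ℝ≥0∞) ^ (2 / 3 : ℝ) * (G.expAlignConf lam ρ B P n z a (G.realizedGlobalAlignment z)
          * G.expTotalInfo lam P n z a) ^ (1 / 3 : ℝ)) := by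
  have hB0 : 0 ≤ B := (norm_nonneg _).trans hθ
  have hR : 0 ≤ ‖θ₀‖ + B + 1 := by positivity
  have hlog2 : 0 < Real.log 2 := Real.log_pos one_lt_two
  have hC₁0 : 0 ≤ C₁ := by rw [hC₁]; positivity
  have hC₂0 : 0 ≤ C₂ := by rw [hC₂]; positivity
  have hc0 : 0 ≤ c := by rw [hc]; exact tsum_nonneg fun _ => by positivity
  set r : ℕ → Ω → ℝ≥0∞ := fun t ω => ∫⁻ b, ENNReal.ofReal (G.gap b (z t ω) θs) ∂μ t ω with hr
  set J : ℕ → Ω → ℝ≥0∞ := fun t ω => ∫⁻ b, ENNReal.ofReal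
    (G.infoGain (G.covMat lam (fun s => z s ω) (fun s => a s ω) t) b (z t ω)) ∂μ t ω with hJ
  set f : ℕ → Set Ω := noiseFailure G lam ρ z a ε with hf
  set w : ℝ → ℕ → Ω → ℝ≥0∞ := fun C t ω => ENNReal.ofReal C *
    (G.realizedGlobalAlignment z t ω
      * ENNReal.ofReal (G.confCoef lam ρ B (fun s => z s ω) (fun s => a s ω) n)) with hw
  have hfm : ∀ t ∈ Finset.Icc 1 n, MeasurableSet (f t) := fun t ht =>
    F.le _ _ (h.measurableSet_failure ((Finset.mem_Icc.1 ht).2.trans (Nat.le_succ n)))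
  have hrm : ∀ t ∈ Finset.Icc 1 n, AEMeasurable (r t) P := fun t ht =>
    h.aemeasurable_policy ht (h.measurable_gap_round ht)
  have hJm : ∀ t ∈ Finset.Icc 1 n, AEMeasurable (J t) P := fun t ht =>
    h.aemeasurable_policy ht (h.measurable_infoGain_round ht)
  have hgood : ∀ᵐ ω ∂P, ∀ t ∈ Finset.Icc 1 n, J t ω * 1 ≠ ⊤ ∧
      (f t)ᶜ.indicator (r t) ω ^ 3 ≤ w C₁ t ω * (J t ω * 1) := by
    filter_upwards [h.ae_round, hα] with ω hω hαω t ht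
    obtain ⟨hav, hids⟩ := hω
    have hμ := hids t ht
    have := hμ.1
    have ht1 := Finset.mem_Icc.1 ht
    have hV := covMat_posDef (G := G) (fun s => z s ω) (fun s => a s ω) hlam t
    have hVl := le_quad_covMat (G := G) (lam := lam) (fun s => z s ω) (fun s => a s ω) t
    have hJe : J t ω = ENNReal.ofReal (∫ b,
        G.infoGain (G.covMat lam (fun s => z s ω) (fun s => a s ω) t) b (z t ω) ∂μ t ω) :=
      (ofReal_integral_eq_lintegral_ofReal (integrable_infoGain hlam hV hVl hB hμ.2.1)
        (Filter.Eventually.of_forall fun b => infoGain_nonneg hV b _)).symm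
    rw [mul_one]
    refine ⟨by rw [hJe]; exact ENNReal.ofReal_ne_top, ?_⟩
    by_cases hfω : ω ∈ f t
    · rw [Set.indicator_of_notMem (by simpa using hfω)]
      simp
    have hav' : ∀ s ∈ Finset.Ico 1 t, a s ω ∈ G.avail (z s ω) := fun s hs => by
      rw [Finset.mem_Ico] at hs
      exact hav s (Finset.mem_Icc.2 (by omega))
    have hround := hμ.global_round (y := fun s => y s ω) (ε := fun s => ε s ω)
      hlam hρ hB0 hB ht1.1 hθ
      (fun s hs => h.observation_eq s (by
        rw [Finset.mem_Ico] at hs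
        exact Finset.mem_Icc.2 (by omega)) ω)
      (not_lt.1 hfω) (hαω t ht) hζ
      (ht1.1.eq_or_lt.imp (fun h1 => h1.symm) fun h1 => hm t h1 _ (logVol_nonneg _ _ hlam ht1.1)
        (logVol_le_mul_log hlam hB h1 hav'))
    rw [← hC₁] at hround
    have hre : r t ω = ENNReal.ofReal (∫ b, G.gap b (z t ω) θs ∂μ t ω) :=
      lintegral_gap_eq hB hμ.2.1 θs
    have hwe : w C₁ t ω = ENNReal.ofReal (C₁ * ((G.realizedGlobalAlignment z t ω).toReal
        * G.confCoef lam ρ B (fun s => z s ω) (fun s => a s ω) n)) := by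
      rw [ENNReal.ofReal_mul hC₁0, ENNReal.ofReal_mul ENNReal.toReal_nonneg,
        ENNReal.ofReal_toReal (hαω t ht)]
    rw [Set.indicator_of_mem (show ω ∈ (f t)ᶜ from hfω), hre, hJe, hwe,
      ← ENNReal.ofReal_pow (integral_gap_nonneg hμ.2.1 θs),
      ← ENNReal.ofReal_mul' (integral_nonneg fun b => infoGain_nonneg hV b _)]
    refine ENNReal.ofReal_le_ofReal (hround.trans ?_)
    have hβ := radius_sq_le_confCoef (G := G) hlam hρ hB0 ht (fun s => z s ω) fun s => a s ω
    rw [mul_assoc C₁]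
    refine mul_le_mul_of_nonneg_left ?_ hC₁0
    exact mul_le_mul_of_nonneg_right (mul_le_mul_of_nonneg_left hβ ENNReal.toReal_nonneg)
      (integral_nonneg fun b => infoGain_nonneg hV b _)
  have hbad : ∀ᵐ ω ∂P, ∀ t ∈ Finset.Icc 1 n,
      (f t).indicator (fun _ => (1 : ℝ≥0∞)) ω * (f t).indicator (fun _ => (1 : ℝ≥0∞)) ω ≠ ⊤ ∧
      (f t).indicator (r t) ω ^ 3 ≤ w C₂ t ω
        * ((f t).indicator (fun _ => (1 : ℝ≥0∞)) ω * (f t).indicator (fun _ => (1 : ℝ≥0∞)) ω) := by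
    filter_upwards [h.ae_round, hα] with ω hω hαω t ht
    have hμ := hω.2 t ht
    have := hμ.1
    have ht1 := Finset.mem_Icc.1 ht
    by_cases hfω : ω ∈ f t
    swap
    · simp [hfω]
    -- No failure occurs in round 1, so n ≥ 2 here and β_n ≥ 4 (log 2) ρ² > 0. For n = 1 the
    -- coefficient could vanish.
    have ht2 : 2 ≤ t := by
      rcases ht1.1.eq_or_lt with h1 | h1
      · rw [← h1, hf, noiseFailure_one] at hfω
        exact absurd hfω (Set.notMem_empty _)
      · exact h1
    simp only [Set.indicator_of_mem hfω, mul_one]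
    refine ⟨ENNReal.one_ne_top, (lintegral_gap_cube_le hB hθ hμ.2.1 (hαω t ht)).trans ?_⟩
    have hβ := le_radius_sq (G := G) (z := fun s => z s ω) (a := fun s => a s ω) hlam hρ hB0
      (ht2.trans ht1.2)
    rw [← confCoef_eq] at hβ
    have hden : 0 < 4 * Real.log 2 * ρ ^ 2 := by positivity
    simp only [hw]
    rw [mul_comm (G.realizedGlobalAlignment z t ω), ← mul_assoc, ← ENNReal.ofReal_mul hC₂0]
    refine mul_le_mul_left (ENNReal.ofReal_le_ofReal ?_) _
    calc (‖θ₀‖ + B + 1) ^ 3 * L ^ 2 = C₂ * (4 * Real.log 2 * ρ ^ 2) := by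
          rw [hC₂, div_mul_cancel₀ _ hden.ne']
      _ ≤ _ := mul_le_mul_of_nonneg_left hβ hC₂0
  have hsplit : ∀ t ∈ Finset.Icc 1 n, ∫⁻ ω, r t ω ∂P
      = ∫⁻ ω, (f t)ᶜ.indicator (r t) ω ∂P + ∫⁻ ω, (f t).indicator (r t) ω ∂P := by
    intro t ht
    rw [lintegral_indicator (hfm t ht).compl, lintegral_indicator (hfm t ht), add_comm,
      lintegral_add_compl _ (hfm t ht)]
  set E := G.expAlignConf lam ρ B P n z a (G.realizedGlobalAlignment z) with hE
  set Γ := G.expTotalInfo lam P n z a with hΓ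
  have h3 : (0 : ℝ) ≤ 1 / 3 := by norm_num
  have hn2 : ((n : ℝ≥0∞) * n) ^ (1 / 3 : ℝ) = (n : ℝ≥0∞) ^ (2 / 3 : ℝ) := by
    rw [← sq, ← ENNReal.rpow_natCast, ← ENNReal.rpow_mul]
    norm_num
  rw [h.regret_eq, Finset.sum_congr rfl hsplit, Finset.sum_add_distrib, add_mul]
  refine add_le_add ?_ ?_
  · refine (sum_lintegral_le_of_cube_le _ (fun t ht => (hrm t ht).indicator (hfm t ht).compl) hJm
      (fun _ _ => aemeasurable_const) hgood).trans ?_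
    rw [lintegral_sum_mul_confCoef hn, h.sum_lintegral_infoGain hlam, ← hn2,
      ← ENNReal.mul_rpow_of_nonneg _ _ h3, ← ENNReal.mul_rpow_of_nonneg _ _ h3]
    refine ENNReal.rpow_le_rpow (le_of_eq ?_) h3
    simp only [lintegral_const, measure_univ, mul_one, Finset.sum_const, Nat.card_Icc,
      nsmul_eq_mul, Nat.add_sub_cancel]
    ring
  · refine (sum_lintegral_le_of_cube_le _ (fun t ht => (hrm t ht).indicator (hfm t ht))
      (fun t ht => aemeasurable_const.indicator (hfm t ht))
      (fun t ht => aemeasurable_const.indicator (hfm t ht)) hbad).trans ?_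
    have hP : ∑ t ∈ Finset.Icc 1 n, ∫⁻ ω, (f t).indicator (fun _ => (1 : ℝ≥0∞)) ω ∂P
        = ∑ t ∈ Finset.Icc 1 n, P (f t) := Finset.sum_congr rfl fun t ht => by
      rw [h.lintegral_indicator_failure_le ht, one_mul]
    have h1 := h.sum_measure_noiseFailure_le hlam hρ
    have h2 := h.sum_measure_noiseFailure_le_mul_info hlam hρ
    rw [← hc] at h1 h2
    rw [lintegral_sum_mul_confCoef hn, hP, ← hn2,
      ← ENNReal.mul_rpow_of_nonneg _ _ h3, ← ENNReal.mul_rpow_of_nonneg _ _ h3]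
    refine ENNReal.rpow_le_rpow ?_ h3
    have hn1 : (1 : ℝ≥0∞) ≤ n := by exact_mod_cast hn
    calc ENNReal.ofReal C₂ * n * E * ((∑ t ∈ Finset.Icc 1 n, P (f t))
          * ∑ t ∈ Finset.Icc 1 n, P (f t))
        ≤ ENNReal.ofReal C₂ * (n * n) * E * (ENNReal.ofReal c * (ENNReal.ofReal (2 * c) * Γ)) := by
          gcongr
          exact le_mul_of_one_le_left' hn1
      _ = _ := by
          rw [ENNReal.ofReal_mul hC₂0, ENNReal.ofReal_mul hc0]
          ring

end IsConditionalIDS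

end Game

end ContextualPM

/-! ### Choice of the constants. -/

theorem mainTheorem8 (d m : ℕ) (lam L ρ B : ℝ) (θ₀ : Vec d) (hlam : 0 < lam) (hρ : 0 < ρ) :
    ∃ C : ℝ≥0,
      ∀ (A : Type*) (Z : Type*) (Ω : Type*)
        [TopologicalSpace A] [CompactSpace A] [TopologicalSpace.MetrizableSpace A]
        [MeasurableSpace A] [BorelSpace A] [MeasurableSpace Z] [mΩ : MeasurableSpace Ω]
        (G : Game A Z d m) (_ : G.Bounded L)
        (θs : Vec d) (_ : ‖θs - θ₀‖ ≤ B)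
        (P : Measure Ω) (_ : IsProbabilityMeasure P) (F : Filtration ℕ mΩ)
        (n : ℕ) (_ : 1 ≤ n)
        (z : ℕ → Ω → Z) (μ : ℕ → Ω → Measure A) (a : ℕ → Ω → A) (y ε : ℕ → Ω → Vec m),
        G.IsConditionalIDS lam ρ B θ₀ θs P F n z μ a y ε →
        -- the locally observable case
        ((∀ᵐ ω ∂P, ∀ t ∈ Finset.Icc 1 n, G.realizedLocalAlignment lam ρ B θ₀ z a y t ω ≠ ⊤) →
          G.regret θs P n z a ≤
            (8 * G.expAlignConf lam ρ B P n z a (G.realizedLocalAlignment lam ρ B θ₀ z a y)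
              * G.expTotalInfo lam P n z a * n) ^ (1 / 2 : ℝ) + C) ∧
        -- the globally observable case
        ((∀ᵐ ω ∂P, ∀ t ∈ Finset.Icc 1 n, G.realizedGlobalAlignment z t ω ≠ ⊤) →
          G.regret θs P n z a ≤
            C * ((n : ℝ≥0∞) ^ (2 / 3 : ℝ)
              * (G.expAlignConf lam ρ B P n z a (G.realizedGlobalAlignment z)
                * G.expTotalInfo lam P n z a) ^ (1 / 3 : ℝ))) := by
  -- For negative B no parameter is admissible.
  rcases lt_or_ge B 0 with hB | hB
  · exact ⟨0, fun A Z Ω _ _ _ _ _ _ _ G _ θs hθ =>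
      absurd ((norm_nonneg _).trans hθ) (not_le.2 hB)⟩
  have hlog2 : 0 < Real.log 2 := Real.log_pos one_lt_two
  have hlogU : 0 ≤ Real.log (1 + d * L ^ 2 / lam) :=
    Real.log_nonneg (le_add_of_nonneg_right (by positivity))
  obtain ⟨δ, hδ, ζ, hζ, hmargin⟩ := exists_margin (b := √lam * B)
    (C := d * (1 + Real.log (1 + d * L ^ 2 / lam) / Real.log 2)) hρ (by positivity)
    (by positivity) hlog2
  set K : ℝ := 4 * (1 + d * L ^ 2 / lam / 2) ^ 2 with hK
  -- ℓ is chosen so that ℓ/4 equals K times the bound on ∑ I², and κ so that κ² = 2 (1 + K U / 2),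
  -- where U = d L² / λ and U / 2 bounds the gain of one round.
  set ℓ : ℝ := 4 * K * (d * L ^ 2 * (1 + d * L ^ 2 / lam) * (d / lam) / 4) with hℓ
  set κ : ℝ := √(2 * (1 + K * (d * L ^ 2 / lam / 2))) with hκ
  have hκ0 : 0 ≤ K * (d * L ^ 2 / lam / 2) := by positivity
  have hκ1 : 1 ≤ κ := Real.one_le_sqrt.2 (by linarith)
  have hκ2 : 2 * (1 + K * (d * L ^ 2 / lam / 2)) ≤ κ ^ 2 :=
    (Real.sq_sqrt (by positivity)).ge
  -- The margin is δ √(log t), so it provides the factor κ once √(log t) ≥ x, that is, from some t₀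
  -- on.
  set x : ℝ := (κ - 1) * (√(lam * Real.exp ℓ) * (‖θ₀‖ + B + 1)) / δ with hx
  obtain ⟨t₀, ht₀, ht₀x⟩ : ∃ t₀ : ℕ, 2 ≤ t₀ ∧ ∀ t : ℕ, t₀ ≤ t → x ≤ √(Real.log t) := by
    have h : Filter.Tendsto (fun t : ℕ => √(Real.log t)) Filter.atTop Filter.atTop :=
      Real.tendsto_sqrt_atTop.comp (Real.tendsto_log_atTop.comp tendsto_natCast_atTop_atTop)
    obtain ⟨N, hN⟩ := Filter.eventually_atTop.1 (h.eventually_ge_atTop x)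
    exact ⟨max N 2, le_max_right _ _, fun t ht => hN t ((le_max_left _ _).trans ht)⟩
  have hlog : ∀ t : ℕ, 2 ≤ t → Real.log 2 ≤ Real.log t := fun t ht =>
    Real.log_le_log (by norm_num) (by exact_mod_cast ht)
  set c : ℝ := ∑' t : ℕ, 1 / (t : ℝ) ^ (3 / 2 : ℝ) with hc
  set C₀ : ℝ := (‖θ₀‖ + B + 1) * (t₀ + c) with hC₀
  set C₁ : ℝ := 16 * (2 + d * L ^ 2 / lam) * (1 + 2 / ζ) * (‖θ₀‖ + B + 1) with hC₁
  set C₂ : ℝ := (‖θ₀‖ + B + 1) ^ 3 * L ^ 2 / (4 * Real.log 2 * ρ ^ 2) with hC₂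
  set D : ℝ≥0∞ := ENNReal.ofReal C₁ ^ (1 / 3 : ℝ)
    + ENNReal.ofReal (C₂ * (c * (2 * c))) ^ (1 / 3 : ℝ) with hD
  have hD1 : D ≠ ⊤ := ENNReal.add_ne_top.2
    ⟨ENNReal.rpow_ne_top_of_nonneg (by norm_num) ENNReal.ofReal_ne_top,
      ENNReal.rpow_ne_top_of_nonneg (by norm_num) ENNReal.ofReal_ne_top⟩
  refine ⟨C₀.toNNReal + D.toNNReal, ?_⟩
  intro A Z Ω _ _ _ _ _ _ _ G hG θs hθ P _ F n hn z μ a y ε h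
  rw [ENNReal.coe_add, ENNReal.coe_toNNReal hD1]
  refine ⟨fun hα => ?_, fun hα => ?_⟩
  · refine (h.regret_le_local hlam hρ hG hθ hn hα hK le_rfl hκ1 hκ2 ht₀ ?_).trans
      (add_le_add_right le_self_add _)
    intro t ht v hv hvl
    refine le_trans (add_le_add_right ?_ _) (hmargin _ (hlog t (ht₀.trans ht)) v hv hvl).1
    rw [← div_le_iff₀' hδ]
    exact ht₀x t ht
  · refine (h.regret_le_global hlam hρ hG hθ hn hα hζ hC₁ hC₂ hc ?_).trans
      (mul_le_mul_left le_add_self _)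
    exact fun t ht v hv hvl => (hmargin _ (hlog t ht) v hv hvl).2
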